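/- **Setting.** Fix integers $n\ge 1$, $k\ge 1$ and a norm $\|\cdot\|$ on $\mathbb R^n$; matrices and row vectors carry the corresponding operator norms. Let $$D=\{(x,y)\in\mathbb R^n\times\mathbb R:\|x\|\le 1,\ |y|\le 1\},\quad D_\pm=\{(x,y)\in D:\pm y>0\},\quad D_0=\{(x,y)\in D: y=0\},\quad D^*=D_-\cup D_+,$$ and write $\|f\|_D=\sup_{D^*}\|f\|$. Let $T=(F,G):D^*\to D$ be of class $C^{k+1}$ with $\partial_yG\neq 0$ on $D^*$, and put $$A=\partial_xF\,(\partial_yG)^{-1},\qquad B=\partial_yF\,(\partial_yG)^{-1},\qquad C=\partial_xG\,(\partial_yG)^{-1}.$$ Assume: * $(L_1)$ There are constants $\alpha>0$, $\gamma>k-1$, $K>0$, a neighbourhood $U$ of $D_0$ in $D$, vectors $x_\pm^*,B_\pm^*\in\mathbb R^n$, reals $y_\pm^*$, nonzero reals $A_\pm^*$, and $C^{k+1}$ functions $\varphi_\pm,\psi_\pm$ on $U\cap D_\pm$ such that on $U\cap D_\pm$ $$F=x_\pm^*+|y|^\alpha(B_\pm^*+\varphi_\pm),\qquad G=y_\pm^*+|y|^\alpha(A_\pm^*+\psi_\pm),$$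 $$\Big\|\frac{\partial^{l+m}\varphi_\pm}{\partial x^l\partial y^m}\Big\|\le K|y|^{\gamma-m},\qquad \Big\|\frac{\partial^{l+m}\psi_\pm}{\partial x^l\partial y^m}\Big\|\le K|y|^{\gamma-m}\qquad (l,m\ge 0,\ l+m\le k+1).$$ * $(L_2)$ $1-\|A\|_D>2\sqrt{\|B\|_D\|C\|_D}$. * $(L_3)$ $\|\partial_yG\|_D<\infty$. For $i\ge 1$ set $$\Theta(i)=\frac{(2\cdot i!)^2\,(\|A\|_D+\|C\|_D\|B\|_D)\,\max_{p+q=i}(\|A\|_D+\|B\|_D)^p(\|C\|_D+1)^q}{\|\partial_yG\|_D^{-i}\,\big(1+\|A\|_D+\sqrt{(1-\|A\|_D)^2-4\|B\|_D\|C\|_D}\big)^2}.$$ Then $\Theta(1)<1$; and if $k\ge 2$, also $\Theta(k)<1$ and ($\|\partial_yG\|_D\ge\frac14$ or $\|\partial_xF\|_D\ge\frac14$). Let $$L=\frac{2\|C\|_D}{1-\|A\|_D+\sqrt{(1-\|A\|_D)^2-4\|B\|_D\|C\|_D}},$$ which equals $\dfrac{1-\|A\|_D-\sqrt{(1-\|A\|_D)^2-4\|B\|_D\|C\|_D}}{2\|B\|_D}$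 when $\|B\|_D\ne 0$. Let $\mathcal A_L$ be the set of continuous $\nu:D\to\mathbb R^{1\times n}$ with $\|\nu\|\le L$ on $D$ and $\nu=0$ on $D_0$. For $\nu\in\mathcal A_L$ define $\Gamma(\nu)$ on $D$ by $$\Gamma(\nu)=\frac{(\nu\circ T)A-C}{1-(\nu\circ T)B}\ \text{ if } y\neq 0,\qquad \Gamma(\nu)=0\ \text{ if } y=0.$$ **Proposition.** $\Gamma$ maps $\mathcal A_L$ into itself and has a unique fixed point $\nu^*$ in $\mathcal A_L$. If $\bar\nu\in\mathcal A_L$ is of class $C^k$ and $D^i\bar\nu(x,0)=0$ for all $0\le i\le k$ and $(x,0)\in D_0$, then every $\Gamma^m(\bar\nu)$ is of class $C^k$ on $D$, and there are continuous functions $A_1,\dots,A_k$ on $D$, with $A_j(x,y)$ a $j$-linear map from $\mathbb R^{n+1}$ to $\mathbb R^{1\times n}$, such that $$\lim_{m\to\infty}\big(\Gamma^m(\bar\nu),D\Gamma^m(\bar\nu),\dots,D^k\Gamma^m(\bar\nu)\big)=(\nu^*,A_1,\dots,A_k)$$ uniformly on $D$. -/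

import Mathlib

open Set Filter Topology

noncomputable section

/-! Throughout, `E` is a finite-dimensional real normed space: it plays the role of `ℝⁿ` with a
fixed norm. Column vectors are elements of `E`, `n × n` matrices are elements of `E →L[ℝ] E`, row
vectors are elements of `E →L[ℝ] ℝ`; matrices and row vectors carry the corresponding operator norm.
Functions on subsets of `E × ℝ` are represented by total functions of which only the values on the
subset are used; derivatives are derivatives within the subset. -/

namespace Lorenz

section Domain

/-- `D = {(x, y) : ‖x‖ ≤ 1, |y| ≤ 1}`. -/
def dom (E : Type*) [NormedAddCommGroup E] : Set (E × ℝ) :=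
  {p | ‖p.1‖ ≤ 1 ∧ |p.2| ≤ 1}

/-- `D₊`, the part of `D` where `y > 0`. -/
def domPos (E : Type*) [NormedAddCommGroup E] : Set (E × ℝ) :=
  {p | p ∈ dom E ∧ 0 < p.2}

/-- `D₋`, the part of `D` where `y < 0`. -/
def domNeg (E : Type*) [NormedAddCommGroup E] : Set (E × ℝ) :=
  {p | p ∈ dom E ∧ p.2 < 0}

/-- `D₀`, the part of `D` where `y = 0`. -/
def domZero (E : Type*) [NormedAddCommGroup E] : Set (E × ℝ) :=
  {p | p ∈ dom E ∧ p.2 = 0}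

/-- `D* = D₋ ∪ D₊ = D \ D₀`. -/
def domStar (E : Type*) [NormedAddCommGroup E] : Set (E × ℝ) :=
  domNeg E ∪ domPos E

/-- `‖f‖_D`, the supremum of `‖f‖` over `D*` (meaningful when `f` is bounded on `D*`). -/
def supNorm {E X : Type*} [NormedAddCommGroup E] [NormedAddCommGroup X] (f : E × ℝ → X) : ℝ :=
  sSup ((fun p => ‖f p‖) '' domStar E)

end Domain

section Coefficients

variable {E : Type*} [NormedAddCommGroup E] [NormedSpace ℝ E]

/-- `∂ₓF` for `T = (F, G)` on `D*`. -/
def dxF (T : E × ℝ → E × ℝ) (p : E × ℝ) : E →L[ℝ] E :=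
  (ContinuousLinearMap.fst ℝ E ℝ).comp
    ((fderivWithin ℝ T (domStar E) p).comp (ContinuousLinearMap.inl ℝ E ℝ))

/-- `∂ᵧF` for `T = (F, G)` on `D*`. -/
def dyF (T : E × ℝ → E × ℝ) (p : E × ℝ) : E :=
  (fderivWithin ℝ T (domStar E) p (0, 1)).1

/-- `∂ₓG` for `T = (F, G)` on `D*`. -/
def dxG (T : E × ℝ → E × ℝ) (p : E × ℝ) : E →L[ℝ] ℝ :=
  (ContinuousLinearMap.snd ℝ E ℝ).comp
    ((fderivWithin ℝ T (domStar E) p).comp (ContinuousLinearMap.inl ℝ E ℝ))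

/-- `∂ᵧG` for `T = (F, G)` on `D*`. -/
def dyG (T : E × ℝ → E × ℝ) (p : E × ℝ) : ℝ :=
  (fderivWithin ℝ T (domStar E) p (0, 1)).2

/-- `A = ∂ₓF (∂ᵧG)⁻¹`. -/
def coefA (T : E × ℝ → E × ℝ) (p : E × ℝ) : E →L[ℝ] E := (dyG T p)⁻¹ • dxF T p

/-- `B = ∂ᵧF (∂ᵧG)⁻¹`. -/
def coefB (T : E × ℝ → E × ℝ) (p : E × ℝ) : E := (dyG T p)⁻¹ • dyF T p

/-- `C = ∂ₓG (∂ᵧG)⁻¹`. -/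
def coefC (T : E × ℝ → E × ℝ) (p : E × ℝ) : E →L[ℝ] ℝ := (dyG T p)⁻¹ • dxG T p

/-- `√((1 - ‖A‖_D)² - 4 ‖B‖_D ‖C‖_D)`. -/
def disc (T : E × ℝ → E × ℝ) : ℝ :=
  Real.sqrt ((1 - supNorm (coefA T)) ^ 2 - 4 * supNorm (coefB T) * supNorm (coefC T))

/-- The maximum over `m + n = i` of `(‖A‖_D + ‖B‖_D)^m (‖C‖_D + 1)^n`. -/
def maxProd (T : E × ℝ → E × ℝ) (i : ℕ) : ℝ :=
  (Finset.HasAntidiagonal.antidiagonal i).sup' ⟨(0, i), by simp⟩ fun q =>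
    (supNorm (coefA T) + supNorm (coefB T)) ^ q.1 * (supNorm (coefC T) + 1) ^ q.2

/-- The quotient required to be `< 1` in the third condition on `T`, at order `i`. -/
def theta (T : E × ℝ → E × ℝ) (i : ℕ) : ℝ :=
  ((2 * (Nat.factorial i : ℝ)) ^ 2
      * (supNorm (coefA T) + supNorm (coefC T) * supNorm (coefB T)) * maxProd T i) /
    (((supNorm (dyG T))⁻¹) ^ i * (1 + supNorm (coefA T) + disc T) ^ 2)

/-- The smaller root of `‖B‖_D L² - (1 - ‖A‖_D) L + ‖C‖_D = 0`, in a form that also covers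
`‖B‖_D = 0`. See `boundL_eq` for the usual form. -/
def boundL (T : E × ℝ → E × ℝ) : ℝ :=
  2 * supNorm (coefC T) / (1 - supNorm (coefA T) + disc T)

end Coefficients

section Assumptions

variable {E : Type*} [NormedAddCommGroup E] [NormedSpace ℝ E]

/-- `‖∂^{l+m} f / ∂x^l ∂y^m‖ ≤ K |y|^{γ - m}` on `S` for all `l + m ≤ k + 1`. The mixed partial
derivative at `p` is the `l`-linear map on `E` obtained from the derivative of order `l + m` by
inserting the `y`-direction `(0, 1)` in `m` slots; the inequality bounds its operator norm. -/
def MixedBound {X : Type*} [NormedAddCommGroup X] [NormedSpace ℝ X]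
    (k : ℕ) (S : Set (E × ℝ)) (γ K : ℝ) (f : E × ℝ → X) : Prop :=
  ∀ l m : ℕ, l + m ≤ k + 1 → ∀ p ∈ S, ∀ v : Fin l → E,
    ‖iteratedFDerivWithin ℝ (l + m) f S p
        (Fin.append (fun i => (v i, (0 : ℝ))) (fun _ : Fin m => ((0 : E), (1 : ℝ))))‖
      ≤ K * |p.2| ^ (γ - (m : ℝ)) * ∏ i, ‖v i‖

/-- The one-sided form of `T` on `S`:
`F = x* + |y|^α (B* + φ)` and `G = y* + |y|^α (A* + ψ)` with `A* ≠ 0`, with `φ, ψ` of class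
`C^{k+1}` and with bounds on their mixed partial derivatives. -/
def HasForm (k : ℕ) (T : E × ℝ → E × ℝ) (S : Set (E × ℝ)) (α γ K : ℝ) : Prop :=
  ∃ (xs Bs : E) (ys As : ℝ) (φ : E × ℝ → E) (ψ : E × ℝ → ℝ),
    As ≠ 0 ∧
    ContDiffOn ℝ (k + 1) φ S ∧ ContDiffOn ℝ (k + 1) ψ S ∧
    MixedBound k S γ K φ ∧ MixedBound k S γ K ψ ∧
    ∀ p ∈ S, T p = (xs + |p.2| ^ α • (Bs + φ p), ys + |p.2| ^ α * (As + ψ p))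

/-- The standing assumptions on the map `T = (F, G) : D* → D`. Since `D₀` is compact, a
neighbourhood of `D₀` in `D` is a set containing `{p ∈ D : |y| < δ}` for some `δ > 0`.
The finiteness of `‖∂ᵧG‖_D` is part of the meaning of the third condition
(that of the other suprema is a consequence of the rest). -/
structure IsLorenzMap (k : ℕ) (T : E × ℝ → E × ℝ) : Prop where
  mapsTo : MapsTo T (domStar E) (dom E)
  contDiffOn : ContDiffOn ℝ (k + 1) T (domStar E)
  dyG_ne_zero : ∀ p ∈ domStar E, dyG T p ≠ 0
  form : ∃ α γ K δ : ℝ, 0 < α ∧ (k : ℝ) - 1 < γ ∧ 0 < K ∧ 0 < δ ∧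
    HasForm k T {p | p ∈ domPos E ∧ |p.2| < δ} α γ K ∧
    HasForm k T {p | p ∈ domNeg E ∧ |p.2| < δ} α γ K
  dominated : 1 - supNorm (coefA T) > 2 * Real.sqrt (supNorm (coefB T) * supNorm (coefC T))
  dyG_bdd : BddAbove ((fun p => ‖dyG T p‖) '' domStar E)
  theta_one : theta T 1 < 1
  theta_k : 2 ≤ k → theta T k < 1
  lower : 2 ≤ k → 1 / 4 ≤ supNorm (dyG T) ∨ 1 / 4 ≤ supNorm (dxF T)

end Assumptions

section GraphTransform

variable {E : Type*} [NormedAddCommGroup E] [NormedSpace ℝ E]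

/-- The set `𝒜_L` of functions `ν : D → ℝ^{1 × n}` that are continuous, bounded by `L`, and vanish
on `D₀`. -/
def classA (E : Type*) [NormedAddCommGroup E] [NormedSpace ℝ E] (L : ℝ) :
    Set (E × ℝ → E →L[ℝ] ℝ) :=
  {ν | ContinuousOn ν (dom E) ∧ (∀ p ∈ dom E, ‖ν p‖ ≤ L) ∧ ∀ p ∈ domZero E, ν p = 0}

/-- The graph transform: `Γ(ν) = (ν∘T A - C) / (1 - ν∘T B)` for `y ≠ 0`, and `0` for `y = 0`. -/
def graphTransform (T : E × ℝ → E × ℝ) (ν : E × ℝ → E →L[ℝ] ℝ) : E × ℝ → E →L[ℝ] ℝ :=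
  fun p =>
    if p.2 = 0 then 0
    else (1 - ν (T p) (coefB T p))⁻¹ • ((ν (T p)).comp (coefA T p) - coefC T p)

end GraphTransform

section Facts

theorem supNorm_nonneg {E X : Type*} [NormedAddCommGroup E] [NormedAddCommGroup X] (f : E × ℝ → X) : 0 ≤ supNorm f := by
  apply Real.sSup_nonneg
  rintro _ ⟨p, _, rfl⟩
  exact norm_nonneg _

/-- For `‖B‖_D ≠ 0` the constant `boundL` is
`(1 - ‖A‖_D - √((1 - ‖A‖_D)² - 4 ‖B‖_D ‖C‖_D)) / (2 ‖B‖_D)`. -/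
theorem boundL_eq {E : Type*} [NormedAddCommGroup E] [NormedSpace ℝ E] (T : E × ℝ → E × ℝ)
    (h : 1 - supNorm (coefA T) > 2 * Real.sqrt (supNorm (coefB T) * supNorm (coefC T)))
    (hB : supNorm (coefB T) ≠ 0) :
    boundL T = (1 - supNorm (coefA T) - disc T) / (2 * supNorm (coefB T)) := by
  have hb := supNorm_nonneg (coefB T)
  have hc := supNorm_nonneg (coefC T)
  have hs := Real.sqrt_nonneg (supNorm (coefB T) * supNorm (coefC T))
  have hs2 := Real.sq_sqrt (mul_nonneg hb hc)
  have hd : 0 ≤ disc T := Real.sqrt_nonneg _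
  have hd2 : disc T ^ 2
      = (1 - supNorm (coefA T)) ^ 2 - 4 * supNorm (coefB T) * supNorm (coefC T) := by
    apply Real.sq_sqrt
    nlinarith
  have hne : 1 - supNorm (coefA T) + disc T ≠ 0 := by linarith
  unfold boundL
  rw [div_eq_div_iff hne (by simpa using hB)]
  nlinarith

end Facts

end Lorenz

end

/-!
The graph transform is fractional linear in `ν ∘ T`, and this gives an exact formula for its
differences (`graphTransform_sub`): on `D*`,
`Γ(μ) - Γ(ν) = slope · ((μ - ν) ∘ T)`, where `slope` is the linear operator
`w ↦ (w A + (w B) Γ(ν)) / (1 - (μ ∘ T) B)`. The number `L` is a root of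
`‖B‖ L² - (1 - ‖A‖) L + ‖C‖ = 0`, which makes the ball of radius `L` invariant and gives
`‖slope‖ ≤ rate T = (‖A‖ + L ‖B‖) / (1 - L ‖B‖) < 1` (`rate_lt_one`). Hence `Γ` is a uniform
contraction of `𝒜_L`, and the existence and uniqueness of the fixed point follow.

The behaviour at `D₀` is governed by orders of vanishing in `r = |y|`. The expansion of `T` along
`D₀` shows that a derivative of order `i` costs at most a factor `r ^ (-i)`, and that, relative to
`∂ᵧG`, which is of exact order `r ^ (α - 1)`, the functions `A` and `C` are `O(r ^ (1 + γ))` while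
`B` is `O(1)` (`HasSymbolBounds`). Derivatives in the direction of `x` cost nothing, so that `∂ₓT`
keeps the order `α + γ`. Since `1 + γ > k`, the function `Γ(ν)` and its derivatives of order at most
`k` tend to `0` at `D₀`, so that `Γ` preserves functions of class `C^k` that are flat on `D₀`
(`contDiffOn_dom_of_flat`, `flatClass_graphTransform`).

For the derivatives, let `f m = Γ^m(ν)` and differentiate the exact formula `j` times. The only term
with the derivative of order `j` of `f (m + 1) - f m` comes from `slope · (w ∘ T)` with all
derivatives falling on `w`, and its coefficient is at most `rate T * ‖DT‖ ^ j`; for the maximum norm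
on `E × ℝ`, `‖DT‖ ≤ derivBound T = ‖∂ᵧG‖ max(‖A‖ + ‖B‖, ‖C‖ + 1)`. The conditions `Θ(1) < 1` and
`Θ(k) < 1` make this coefficient less than `1` at the orders `1` and `k`, hence at all orders in
between, a geometric sequence being at most the larger of its end values
(`rate_mul_derivBound_pow_lt_one`). All other terms contain a derivative of lower order of
`f (m + 1) - f m`, which is summable in `m` by induction on `j`, multiplied by an expression in
which the powers `r ^ (-i)` are absorbed by the factor `r ^ (1 + γ)` of `slope`.

The derivatives of `slope` involve those of `f m` and `f (m + 1)` up to order `j`, so a bound for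
the derivatives of order `j` along the orbit has to be obtained together with the convergence. By
weighted homogeneity the top derivative occurs at most linearly: if the derivatives of order `j` are
at most `H ^ j`, then all the functions involved have jets of inverse length scale `H / r`, so their
derivatives of order `j` are `O(H ^ j)`. With `b m` and `a m` the maxima of the norms of the
derivatives of order `j` of `f m` and of `f (m + 1) - f m`, the resulting recursion is
`b (m + 1) ≤ b m + a m`, `a (m + 1) ≤ q (a m) + ε m (1 + b m + b (m + 1))` with `q < 1` and
`∑ ε m < ∞`, and a discrete Gronwall argument (`summable_and_bounded_of_perturbed_contraction`)
shows that `a` is summable and `b` is bounded.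
-/

namespace Lorenz

/-! ### Jet bounds at a length scale -/

section Jets

variable {X Y Z W : Type*} [NormedAddCommGroup X] [NormedSpace ℝ X] [NormedAddCommGroup Y]
  [NormedSpace ℝ Y] [NormedAddCommGroup Z] [NormedSpace ℝ Z] [NormedAddCommGroup W]
  [NormedSpace ℝ W]

/-- `JetBound n S p K H f`: the derivatives of `f` at `p` (within `S`) of order `i ≤ n` are bounded
by `K H ^ i`. The parameter `H` is an inverse length scale. -/
def JetBound (n : ℕ) (S : Set X) (p : X) (K H : ℝ) (f : X → Y) : Prop :=
  ∀ i ≤ n, ‖iteratedFDerivWithin ℝ i f S p‖ ≤ K * H ^ i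

variable {n : ℕ} {S : Set X} {p : X} {K K' H H' : ℝ} {f : X → Y} {g : X → Z}

theorem JetBound.norm_le (h : JetBound n S p K H f) : ‖f p‖ ≤ K := by
  simpa using h 0 (Nat.zero_le _)

theorem JetBound.nonneg (h : JetBound n S p K H f) : 0 ≤ K := (norm_nonneg _).trans h.norm_le

theorem JetBound.of_le {m : ℕ} (h : JetBound n S p K H f) (hm : m ≤ n) : JetBound m S p K H f :=
  fun i hi => h i (hi.trans hm)

theorem JetBound.mono (h : JetBound n S p K H f) (hK : K ≤ K') (hH0 : 0 ≤ H) (hH : H ≤ H') :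
    JetBound n S p K' H' f := fun i hi =>
  (h i hi).trans (mul_le_mul hK (pow_le_pow_left₀ hH0 hH i) (by positivity)
    (h.nonneg.trans hK))

theorem JetBound.congr {f' : X → Y} (h : JetBound n S p K H f) (hp : p ∈ S) (hf : EqOn f' f S) :
    JetBound n S p K H f' := fun i hi => by
  rw [iteratedFDerivWithin_congr hf hp]; exact h i hi

theorem JetBound.const (n : ℕ) (S : Set X) (p : X) (c : Y) (hH : 0 ≤ H) :
    JetBound n S p ‖c‖ H (fun _ => c) := fun i _ => by
  rcases Nat.eq_zero_or_pos i with rfl | hi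
  · simp
  · rw [iteratedFDerivWithin_const_of_ne hi.ne']
    simp; positivity

theorem JetBound.add {f' : X → Y} (hS : UniqueDiffOn ℝ S) (hp : p ∈ S) (hf : ContDiffOn ℝ n f S)
    (hf' : ContDiffOn ℝ n f' S) (h : JetBound n S p K H f) (h' : JetBound n S p K' H f') :
    JetBound n S p (K + K') H (fun x => f x + f' x) := fun i hi => by
  have hi' : (i : WithTop ℕ∞) ≤ n := by exact_mod_cast hi
  rw [fun_iteratedFDerivWithin_add_apply ((hf.of_le hi') p hp) ((hf'.of_le hi') p hp) hS hp, add_mul]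
  exact (norm_add_le _ _).trans (add_le_add (h i hi) (h' i hi))

theorem JetBound.sub {f' : X → Y} (hS : UniqueDiffOn ℝ S) (hp : p ∈ S) (hf : ContDiffOn ℝ n f S)
    (hf' : ContDiffOn ℝ n f' S) (h : JetBound n S p K H f) (h' : JetBound n S p K' H f') :
    JetBound n S p (K + K') H (fun x => f x - f' x) := fun i hi => by
  have hi' : (i : WithTop ℕ∞) ≤ n := by exact_mod_cast hi
  rw [fun_iteratedFDerivWithin_sub_apply ((hf.of_le hi') p hp) ((hf'.of_le hi') p hp) hS hp, add_mul]
  exact (norm_sub_le _ _).trans (add_le_add (h i hi) (h' i hi))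

theorem JetBound.clm (L : Y →L[ℝ] Z) (hS : UniqueDiffOn ℝ S) (hp : p ∈ S)
    (hf : ContDiffOn ℝ n f S) (h : JetBound n S p K H f) :
    JetBound n S p (‖L‖ * K) H (fun x => L (f x)) := fun i hi => by
  have := L.norm_iteratedFDerivWithin_comp_left (hf p hp) hS hp (n := i) (by exact_mod_cast hi)
  refine (this.trans (mul_le_mul_of_nonneg_left (h i hi) (norm_nonneg _))).trans_eq ?_
  ring

/-- Leibniz: jet bounds at a common scale multiply under bilinear maps. -/
theorem JetBound.bilin (β : Y →L[ℝ] Z →L[ℝ] W) (hS : UniqueDiffOn ℝ S) (hp : p ∈ S) (hH : 0 ≤ H)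
    (hf : ContDiffOn ℝ n f S) (hg : ContDiffOn ℝ n g S) (h : JetBound n S p K H f)
    (h' : JetBound n S p K' H g) :
    JetBound n S p (‖β‖ * 2 ^ n * (K * K')) H (fun x => β (f x) (g x)) := fun i hi => by
  have := β.norm_iteratedFDerivWithin_le_of_bilinear hf hg hS hp (n := i) (by exact_mod_cast hi)
  have hK := h.nonneg
  have hK' := h'.nonneg
  calc _ ≤ _ := this
    _ ≤ ‖β‖ * ∑ a ∈ Finset.range (i + 1), (i.choose a : ℝ) * (K * K' * H ^ i) := by
        refine mul_le_mul_of_nonneg_left (Finset.sum_le_sum fun a ha => ?_) (norm_nonneg β)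
        have ha' : a ≤ i := Nat.lt_succ_iff.1 (Finset.mem_range.1 ha)
        rw [mul_assoc]
        refine mul_le_mul_of_nonneg_left ?_ (Nat.cast_nonneg _)
        calc _ ≤ (K * H ^ a) * (K' * H ^ (i - a)) := by
              gcongr
              · exact h a (ha'.trans hi)
              · exact h' _ ((Nat.sub_le _ _).trans hi)
          _ = K * K' * H ^ i := by
              rw [← Nat.add_sub_cancel' ha', pow_add]; simp; ring
    _ = ‖β‖ * 2 ^ i * (K * K' * H ^ i) := by
        rw [← Finset.sum_mul]
        have := Nat.sum_range_choose i
        rw [← Nat.cast_sum, this]; push_cast; ring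
    _ ≤ ‖β‖ * 2 ^ n * (K * K' * H ^ i) := by
        gcongr
        norm_num
    _ = _ := by ring

/-- Jet bound for the multiplicative inverse of a scalar function of size at least `c l` at `p`.
The size `l` is scaled out, so that the constant depends only on `n`, `c` and `K`. -/
theorem exists_jetBound_inv (n : ℕ) {c K : ℝ} (hc : 0 < c) : ∃ C, 0 ≤ C ∧
    ∀ {X : Type*} [NormedAddCommGroup X] [NormedSpace ℝ X] (S : Set X) (p : X) (l H : ℝ)
      (f : X → ℝ), UniqueDiffOn ℝ S → p ∈ S → 0 < l → 0 ≤ H → ContDiffOn ℝ n f S →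
      (∀ x ∈ S, f x ≠ 0) → c * l ≤ |f p| → JetBound n S p (K * l) H f →
      JetBound n S p (C * l⁻¹) H (fun x => (f x)⁻¹) := by
  -- inversion has bounded derivatives on the compact set `c ≤ |z| ≤ K`
  set t : Set ℝ := {0}ᶜ with ht
  have hto : IsOpen t := isOpen_compl_singleton
  have hinv : ContDiffOn ℝ n (fun z : ℝ => z⁻¹) t := fun z hz =>
    (contDiffAt_inv ℝ (by simpa [ht] using hz)).contDiffWithinAt
  have hcomp : IsCompact {z : ℝ | c ≤ |z| ∧ |z| ≤ K} := by
    apply Metric.isCompact_of_isClosed_isBounded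
    · exact (isClosed_le continuous_const continuous_abs).inter
        (isClosed_le continuous_abs continuous_const)
    · exact (Metric.isBounded_closedBall (x := (0 : ℝ)) (r := K)).subset
        fun z hz => by simpa using hz.2
  have key : ∀ i : ℕ, ∃ C : ℝ, 0 ≤ C ∧ (i ≤ n → ∀ z ∈ {z : ℝ | c ≤ |z| ∧ |z| ≤ K},
      ‖iteratedFDerivWithin ℝ i (fun z : ℝ => z⁻¹) t z‖ ≤ C) := by
    intro i
    by_cases hi : i ≤ n
    · have hco := hinv.continuousOn_iteratedFDerivWithin (m := i) (by exact_mod_cast hi)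
        hto.uniqueDiffOn
      obtain ⟨C, hC⟩ := hcomp.exists_bound_of_continuousOn (hco.mono (by
        rintro z ⟨h1, _⟩ h0
        simp at h0
        rw [h0] at h1; simp at h1; linarith))
      exact ⟨max C 0, le_max_right _ _, fun _ z hz => (hC z hz).trans (le_max_left _ _)⟩
    · exact ⟨0, le_rfl, fun h => absurd h hi⟩
  choose D hD0 hD using key
  set Cs := ∑ i ∈ Finset.range (n + 1), D i
  have hCs : ∀ i ≤ n, D i ≤ Cs := fun i hi =>
    Finset.single_le_sum (f := D) (fun j _ => hD0 j) (Finset.mem_range.2 (by omega))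
  have hCs0 : 0 ≤ Cs := Finset.sum_nonneg fun j _ => hD0 j
  refine ⟨n.factorial * Cs * (max K 1) ^ n, by positivity, ?_⟩
  intro X _ _ S p l H f hS hp hl hH hf hf0 hlow hb i hi
  have hi' : (i : WithTop ℕ∞) ≤ n := by exact_mod_cast hi
  -- `l⁻¹ * f` takes values in this set, and `f⁻¹ = l⁻¹ * (l⁻¹ * f)⁻¹`
  have hg : ContDiffOn ℝ n (fun x => l⁻¹ * f x) S := contDiffOn_const.mul hf
  have hgb : JetBound n S p (l⁻¹ * (K * l)) H (fun x => l⁻¹ * f x) := by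
    have := hb.clm (ContinuousLinearMap.mul ℝ ℝ l⁻¹) hS hp hf
    simp only [ContinuousLinearMap.opNorm_mul_apply, Real.norm_eq_abs, abs_of_pos (inv_pos.2 hl)] at this
    exact this
  have hKl : l⁻¹ * (K * l) = K := by field_simp
  rw [hKl] at hgb
  have hmem : l⁻¹ * f p ∈ {z : ℝ | c ≤ |z| ∧ |z| ≤ K} := by
    refine ⟨?_, by simpa using hgb.norm_le⟩
    rw [abs_mul, abs_of_pos (inv_pos.2 hl), le_inv_mul_iff₀ hl]; linarith
  have hmax : (1 : ℝ) ≤ max K 1 := le_max_right _ _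
  have hcl := norm_iteratedFDerivWithin_comp_le (n := i) (C := Cs) (D := max K 1 * H) hinv hg hi'
    hto.uniqueDiffOn hS (fun x hx => by simpa [ht] using ⟨hl.ne', hf0 x hx⟩) hp
    (fun a ha => (hD a (ha.trans hi) _ hmem).trans (hCs a (ha.trans hi)))
    (fun a ha1 ha => (hgb a (ha.trans hi)).trans (by
      rw [mul_pow]
      gcongr
      exact (le_max_left K 1).trans (le_self_pow₀ hmax (by omega))))
  have heq : EqOn (fun x => (f x)⁻¹) (fun x => l⁻¹ * ((fun z : ℝ => z⁻¹) ∘ fun x => l⁻¹ * f x) x) S := by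
    intro x hx
    have := hf0 x hx
    simp only [Function.comp]
    field_simp
  rw [iteratedFDerivWithin_congr heq hp]
  have hcd : ContDiffOn ℝ n ((fun z : ℝ => z⁻¹) ∘ fun x => l⁻¹ * f x) S :=
    hinv.comp hg (fun x hx => by simpa [ht] using ⟨hl.ne', hf0 x hx⟩)
  have h2 := (ContinuousLinearMap.mul ℝ ℝ l⁻¹).norm_iteratedFDerivWithin_comp_left (hcd p hp) hS hp hi'
  refine h2.trans ?_
  simp only [ContinuousLinearMap.opNorm_mul_apply, Real.norm_eq_abs, abs_of_pos (inv_pos.2 hl)]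
  calc _ ≤ l⁻¹ * (i.factorial * Cs * (max K 1 * H) ^ i) := by gcongr
    _ ≤ l⁻¹ * (n.factorial * Cs * (max K 1 ^ n * H ^ i)) := by
        rw [mul_pow]
        gcongr
    _ = _ := by ring

end Jets

/-! ### Derivatives of a composition -/

section Composition

universe u v

/-- The derivative of order `n` of `w ∘ T`, with the sharp coefficient `‖DT‖ ^ n` in front of the
derivative of order `n` of `w`. The other terms of the Faà di Bruno formula, which contain lower
derivatives of `w`, are bounded together, with `Q` an inverse length scale for the jet of `T`. -/
theorem exists_norm_iteratedFDerivWithin_comp_le (n : ℕ) : ∃ c : ℝ, 0 ≤ c ∧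
    ∀ {X : Type v} {Y W : Type u} [NormedAddCommGroup X] [NormedSpace ℝ X] [NormedAddCommGroup Y]
      [NormedSpace ℝ Y] [NormedAddCommGroup W] [NormedSpace ℝ W] (w : Y → W) (T : X → Y)
      (S : Set X) (t : Set Y) (p : X) (Q : ℝ),
      ContDiffOn ℝ n w t → ContDiffOn ℝ n T S → UniqueDiffOn ℝ t → UniqueDiffOn ℝ S →
      MapsTo T S t → p ∈ S → 0 ≤ Q →
      (∀ i, 1 ≤ i → i ≤ n → ‖iteratedFDerivWithin ℝ i T S p‖ ≤ Q ^ i) →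
      ‖iteratedFDerivWithin ℝ n (w ∘ T) S p‖ ≤
        ‖iteratedFDerivWithin ℝ n w t (T p)‖ * ‖fderivWithin ℝ T S p‖ ^ n +
          c * (∑ i ∈ Finset.range n, ‖iteratedFDerivWithin ℝ i w t (T p)‖) * Q ^ n := by
  induction n with
  | zero =>
    refine ⟨0, le_rfl, ?_⟩
    intro X Y W _ _ _ _ _ _ w T S t p Q hw hT ht hS hTS hp hQ hb
    simp
  | succ n ih =>
    obtain ⟨c, hc, ih⟩ := ih
    refine ⟨c + ∑ i ∈ Finset.range n, (n.choose i : ℝ) * i.factorial, by positivity, ?_⟩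
    intro X Y W _ _ _ _ _ _ w T S t p Q hw hT ht hS hTS hp hQ hb
    have hn1 : ((n : WithTop ℕ∞) + 1) ≤ ((n + 1 : ℕ) : WithTop ℕ∞) := by push_cast; exact le_rfl
    have hDw : ContDiffOn ℝ n (fderivWithin ℝ w t) t := hw.fderivWithin ht hn1
    have hDT : ContDiffOn ℝ n (fderivWithin ℝ T S) S := hT.fderivWithin hS hn1
    have hT' : ContDiffOn ℝ n T S := hT.of_le (by exact_mod_cast Nat.le_succ n)
    have hcomp : ContDiffOn ℝ n (fderivWithin ℝ w t ∘ T) S := hDw.comp hT' hTS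
    have heq : EqOn (fderivWithin ℝ (w ∘ T) S)
        (fun x => ContinuousLinearMap.compL ℝ X Y W ((fderivWithin ℝ w t ∘ T) x)
          (fderivWithin ℝ T S x)) S := fun x hx => by
      have h1 : DifferentiableWithinAt ℝ w t (T x) :=
        (hw.differentiableOn (by simp)) _ (hTS hx)
      have h2 : DifferentiableWithinAt ℝ T S x := (hT.differentiableOn (by simp)) _ hx
      simpa using fderivWithin_comp x h1 h2 hTS (hS x hx)
    rw [← norm_iteratedFDerivWithin_fderivWithin hS hp, iteratedFDerivWithin_congr heq hp]
    refine ((ContinuousLinearMap.compL ℝ X Y W).norm_iteratedFDerivWithin_le_of_bilinear_of_le_one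
      hcomp hDT hS hp le_rfl (ContinuousLinearMap.norm_compL_le ℝ X Y W)).trans ?_
    set σ := ∑ i ∈ Finset.range (n + 1), ‖iteratedFDerivWithin ℝ i w t (T p)‖ with hσ
    have hσ0 : 0 ≤ σ := Finset.sum_nonneg fun _ _ => norm_nonneg _
    have hDTQ : ∀ i ≤ n, ‖iteratedFDerivWithin ℝ i (fderivWithin ℝ T S) S p‖ ≤ Q ^ (i + 1) :=
      fun i hi => by
        rw [norm_iteratedFDerivWithin_fderivWithin hS hp]
        exact hb (i + 1) (by omega) (by omega)
    have hDT1 : ‖fderivWithin ℝ T S p‖ ≤ Q := by simpa using hDTQ 0 (Nat.zero_le _)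
    have hDwi : ∀ i, ‖iteratedFDerivWithin ℝ i (fderivWithin ℝ w t) t (T p)‖ =
        ‖iteratedFDerivWithin ℝ (i + 1) w t (T p)‖ := fun i =>
      norm_iteratedFDerivWithin_fderivWithin ht (hTS hp)
    have hDwσ : ∀ i < n, ‖iteratedFDerivWithin ℝ i (fderivWithin ℝ w t) t (T p)‖ ≤ σ :=
      fun i hi => by
        rw [hDwi]
        exact Finset.single_le_sum (f := fun i => ‖iteratedFDerivWithin ℝ i w t (T p)‖)
          (fun _ _ => norm_nonneg _) (Finset.mem_range.2 (by omega))
    -- in `D(w ∘ T) = (Dw ∘ T) DT`, only the term without derivatives of `DT` reaches order `n + 1`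
    rw [Finset.sum_range_succ]
    have htop : (n.choose n : ℝ) * ‖iteratedFDerivWithin ℝ n (fderivWithin ℝ w t ∘ T) S p‖ *
        ‖iteratedFDerivWithin ℝ (n - n) (fderivWithin ℝ T S) S p‖ ≤
        ‖iteratedFDerivWithin ℝ (n + 1) w t (T p)‖ * ‖fderivWithin ℝ T S p‖ ^ (n + 1) +
          c * σ * Q ^ (n + 1) := by
      have h1 := ih (fderivWithin ℝ w t) T S t p Q hDw hT' ht hS hTS hp hQ
        (fun i hi hi' => hb i hi (by omega))
      simp only [hDwi] at h1
      have h0 : ∀ m, m = 0 → ‖iteratedFDerivWithin ℝ m (fderivWithin ℝ T S) S p‖ =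
          ‖fderivWithin ℝ T S p‖ := by rintro _ rfl; simp
      rw [Nat.choose_self, Nat.cast_one, one_mul, h0 _ (Nat.sub_self n)]
      have h2 : ∑ i ∈ Finset.range n, ‖iteratedFDerivWithin ℝ (i + 1) w t (T p)‖ ≤ σ := by
        rw [hσ, Finset.sum_range_succ']
        exact le_add_of_nonneg_right (norm_nonneg _)
      calc _ ≤ (‖iteratedFDerivWithin ℝ (n + 1) w t (T p)‖ * ‖fderivWithin ℝ T S p‖ ^ n +
            c * σ * Q ^ n) * ‖fderivWithin ℝ T S p‖ := by
              refine mul_le_mul_of_nonneg_right (h1.trans ?_) (norm_nonneg _)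
              gcongr
        _ = ‖iteratedFDerivWithin ℝ (n + 1) w t (T p)‖ * ‖fderivWithin ℝ T S p‖ ^ (n + 1) +
            c * σ * Q ^ n * ‖fderivWithin ℝ T S p‖ := by ring
        _ ≤ ‖iteratedFDerivWithin ℝ (n + 1) w t (T p)‖ * ‖fderivWithin ℝ T S p‖ ^ (n + 1) +
            c * σ * Q ^ n * Q := by gcongr
        _ = _ := by ring
    have hlow : ∑ i ∈ Finset.range n, (n.choose i : ℝ) *
        ‖iteratedFDerivWithin ℝ i (fderivWithin ℝ w t ∘ T) S p‖ *
        ‖iteratedFDerivWithin ℝ (n - i) (fderivWithin ℝ T S) S p‖ ≤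
        ∑ i ∈ Finset.range n, (n.choose i : ℝ) * i.factorial * (σ * Q ^ (n + 1)) := by
      refine Finset.sum_le_sum fun i hi => ?_
      have hi' : i < n := Finset.mem_range.1 hi
      have h1 := norm_iteratedFDerivWithin_comp_le (n := i) (C := σ) (D := Q) hDw hT'
        (by exact_mod_cast hi'.le) ht hS hTS hp (fun a ha => hDwσ a (by omega))
        (fun a ha1 ha => hb a ha1 (by omega))
      have h2 := hDTQ (n - i) (Nat.sub_le _ _)
      rw [mul_assoc, mul_assoc]
      refine mul_le_mul_of_nonneg_left ?_ (Nat.cast_nonneg _)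
      calc _ ≤ (i.factorial * σ * Q ^ i) * Q ^ (n - i + 1) := by gcongr
        _ = i.factorial * (σ * Q ^ (n + 1)) := by
          rw [show n + 1 = i + (n - i + 1) by omega, pow_add _ i]; ring
    rw [← Finset.sum_mul] at hlow
    calc _ ≤ _ := add_le_add hlow htop
      _ = _ := by ring

end Composition

/-! ### Perturbed contractions and summable increments -/

section Sequences

theorem summable_of_le_mul_add {a ε : ℕ → ℝ} {q : ℝ} (ha : ∀ m, 0 ≤ a m) (hε : ∀ m, 0 ≤ ε m)
    (hs : Summable ε) (hq0 : 0 ≤ q) (hq1 : q < 1) (h : ∀ m, a (m + 1) ≤ q * a m + ε m) :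
    Summable a := by
  refine summable_of_sum_range_le (c := (a 0 + ∑' m, ε m) / (1 - q)) ha fun n => ?_
  have hq : 0 < 1 - q := by linarith
  have hE : 0 ≤ ∑' m, ε m := tsum_nonneg hε
  induction n with
  | zero => simp; have := ha 0; positivity
  | succ n ih =>
    rw [Finset.sum_range_succ']
    have h1 : ∑ i ∈ Finset.range n, a (i + 1) ≤
        q * ∑ i ∈ Finset.range n, a i + ∑ i ∈ Finset.range n, ε i := by
      rw [Finset.mul_sum, ← Finset.sum_add_distrib]
      exact Finset.sum_le_sum fun i _ => h i
    have h2 : ∑ i ∈ Finset.range n, ε i ≤ ∑' m, ε m := hs.sum_le_tsum _ fun i _ => hε i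
    rw [le_div_iff₀ hq] at ih ⊢
    nlinarith

/-- A discrete Gronwall argument: if `b` grows by at most `a`, and `a` contracts up to a summable
perturbation that is affine in `b`, then `a` is summable and `b` is bounded. -/
theorem summable_and_bounded_of_perturbed_contraction {a b ε : ℕ → ℝ} {q : ℝ}
    (ha : ∀ m, 0 ≤ a m) (hb : ∀ m, 0 ≤ b m) (hε : ∀ m, 0 ≤ ε m) (hs : Summable ε) (hq0 : 0 ≤ q)
    (hq1 : q < 1) (hbs : ∀ m, b (m + 1) ≤ b m + a m)
    (has : ∀ m, a (m + 1) ≤ q * a m + ε m * (1 + b m + b (m + 1))) :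
    Summable a ∧ ∃ R, ∀ m, b m ≤ R := by
  have hq : 0 < 1 - q := by linarith
  obtain ⟨κ, hκ⟩ : ∃ κ, κ = (1 - q)⁻¹ := ⟨_, rfl⟩
  have hκq : κ * (1 - q) = 1 := by rw [hκ]; field_simp
  have hκ1 : 1 ≤ κ := by rw [hκ]; exact (one_le_inv₀ hq).2 (by linarith)
  -- with `κ = 1 / (1 - q)`, the sum `b + κ a` does not grow when `ε = 0`
  set Z : ℕ → ℝ := fun m => 1 + b m + κ * a m with hZ
  have hZ0 : ∀ m, 0 ≤ Z m := fun m => by have := ha m; have := hb m; simp only [hZ]; positivity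
  have hstep : ∀ m, Z (m + 1) ≤ Z m * (1 + 2 * κ * ε m) := fun m => by
    have h1 : 1 + b m + b (m + 1) ≤ 2 * Z m := by
      have := hbs m; have := ha m
      simp only [hZ]; nlinarith
    have h2 : κ * a (m + 1) ≤ κ * (q * a m + ε m * (2 * Z m)) := by
      refine mul_le_mul_of_nonneg_left ((has m).trans ?_) (by linarith)
      have := mul_le_mul_of_nonneg_left h1 (hε m)
      linarith
    have h3 : κ * (q * a m) + a m = κ * a m := by linear_combination (-a m) * hκq
    have h4 := hbs m
    calc Z (m + 1) = 1 + b (m + 1) + κ * a (m + 1) := rfl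
      _ ≤ 1 + (b m + a m) + κ * (q * a m + ε m * (2 * Z m)) := by linarith
      _ = 1 + b m + κ * a m + 2 * κ * ε m * Z m := by linear_combination h3
      _ = _ := by simp only [hZ]; ring
  have hbound : ∀ m, Z m ≤ Z 0 * Real.exp (2 * κ * ∑' i, ε i) := by
    have h1 : ∀ m, Z m ≤ Z 0 * Real.exp (2 * κ * ∑ i ∈ Finset.range m, ε i) := by
      intro m
      induction m with
      | zero => simp
      | succ m ih =>
        rw [Finset.sum_range_succ, mul_add, Real.exp_add, ← mul_assoc]
        refine (hstep m).trans (mul_le_mul ih ?_ ?_ ?_)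
        · have := Real.add_one_le_exp (2 * κ * ε m); linarith
        · have := hε m; positivity
        · have := hZ0 0; positivity
    intro m
    refine (h1 m).trans ?_
    have h2 : ∑ i ∈ Finset.range m, ε i ≤ ∑' m, ε m := hs.sum_le_tsum _ fun i _ => hε i
    have := hZ0 0
    gcongr
  set R := Z 0 * Real.exp (2 * κ * ∑' i, ε i)
  have hbR : ∀ m, b m ≤ R := fun m => by
    have h1 := hbound m
    have := ha m
    have h2 : 0 ≤ κ * a m := by positivity
    simp only [hZ] at h1 ⊢
    linarith
  refine ⟨summable_of_le_mul_add ha (ε := fun m => ε m * (1 + R + R)) (fun m => ?_)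
    (hs.mul_right _) hq0 hq1 fun m => (has m).trans ?_, R, hbR⟩
  · have := hε m; have := (hb 0).trans (hbR 0); positivity
  · have := hbR m; have := hbR (m + 1); have := hε m
    gcongr

theorem exists_tendstoUniformlyOn_of_summable {X Y : Type*} [NormedAddCommGroup Y]
    [CompleteSpace Y] {f : ℕ → X → Y} {S : Set X} {a : ℕ → ℝ} (ha : Summable a)
    (h : ∀ m, ∀ p ∈ S, ‖f (m + 1) p - f m p‖ ≤ a m) :
    ∃ g : X → Y, TendstoUniformlyOn f g atTop S := by
  refine ⟨fun x => f 0 x + ∑' m, (f (m + 1) x - f m x), ?_⟩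
  have h1 := tendstoUniformlyOn_tsum_nat (f := fun m x => f (m + 1) x - f m x) ha (s := S)
    (fun m x hx => h m x hx)
  rw [Metric.tendstoUniformlyOn_iff] at h1 ⊢
  intro ε hε
  filter_upwards [h1 ε hε] with m hm x hx
  have h2 := hm x hx
  rw [Finset.sum_range_sub (fun m => f m x)] at h2
  rw [dist_eq_norm] at h2 ⊢
  convert h2 using 2
  abel

end Sequences

/-! ### Symmetry of iterated derivatives within a set -/

section Symmetry

variable {X Y : Type*} [NormedAddCommGroup X] [NormedSpace ℝ X] [NormedAddCommGroup Y]
  [NormedSpace ℝ Y]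

/-- Adjacent transpositions suffice for symmetry: the one of the first two arguments is the symmetry
of a second derivative, the others follow by differentiating the identity of lower order. -/
theorem iteratedFDerivWithin_comp_swap_adjacent {S : Set X} (hS : UniqueDiffOn ℝ S)
    (hcl : S ⊆ closure (interior S)) {f : X → Y} (n : ℕ) (hf : ContDiffOn ℝ (n + 1 : ℕ) f S)
    (i : Fin n) {p : X} (hp : p ∈ S) (m : Fin (n + 1) → X) :
    iteratedFDerivWithin ℝ (n + 1) f S p (m ∘ Equiv.swap i.castSucc i.succ) =
      iteratedFDerivWithin ℝ (n + 1) f S p m := by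
  induction n generalizing p with
  | zero => exact i.elim0
  | succ n ih =>
    have hd : DifferentiableWithinAt ℝ (iteratedFDerivWithin ℝ (n + 1) f S) S p :=
      (hf.differentiableOn_iteratedFDerivWithin (by exact_mod_cast Nat.lt_succ_self (n + 1)) hS) p hp
    induction i using Fin.cases with
    | zero =>
      have hsym : IsSymmSndFDerivWithinAt ℝ (iteratedFDerivWithin ℝ n f S) S p := by
        refine ContDiffWithinAt.isSymmSndFDerivWithinAt (n := 2) ?_ (by simp) hS (hcl hp) hp
        refine (hf p hp).iteratedFDerivWithin_right hS ?_ hp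
        push_cast
        rw [add_comm, add_assoc]
        norm_num
      have key : ∀ u : Fin (n + 1 + 1) → X, iteratedFDerivWithin ℝ (n + 1 + 1) f S p u =
          fderivWithin ℝ (fderivWithin ℝ (iteratedFDerivWithin ℝ n f S) S) S p (u 0) (u 1)
            (fun j => u j.succ.succ) := by
        intro u
        have h1 := (continuousMultilinearCurryLeftEquiv ℝ
          (fun _ : Fin (n + 1) => X) Y).symm.comp_fderivWithin
          (f := fderivWithin ℝ (iteratedFDerivWithin ℝ n f S) S) (hS p hp)
        rw [iteratedFDerivWithin_succ_apply_left, iteratedFDerivWithin_succ_eq_comp_left]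
        refine (congrArg (fun L => L (u 0) (Fin.tail u)) h1).trans ?_
        rfl
      rw [key, key, hsym.eq]
      congr 1
    | succ i =>
      rw [iteratedFDerivWithin_succ_apply_left, iteratedFDerivWithin_succ_apply_left]
      have h0 : (m ∘ Equiv.swap i.succ.castSucc i.succ.succ) 0 = m 0 := by
        simp only [Function.comp]
        rw [Equiv.swap_apply_of_ne_of_ne] <;> simp [Fin.ext_iff]
      have ht : Fin.tail (m ∘ Equiv.swap i.succ.castSucc i.succ.succ) =
          Fin.tail m ∘ Equiv.swap i.castSucc i.succ := by
        funext j
        simp only [Fin.tail, Function.comp]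
        congr 1
        simp only [Equiv.swap_apply_def, Fin.ext_iff, Fin.val_succ, Fin.val_castSucc]
        split_ifs <;> simp_all
      rw [h0, ht]
      have e1 := hd.hasFDerivWithinAt.continuousMultilinear_apply_const
        (Fin.tail m ∘ Equiv.swap i.castSucc i.succ)
      have e2 := hd.hasFDerivWithinAt.continuousMultilinear_apply_const (Fin.tail m)
      have e3 := e1.congr (fun y hy => (ih (hf.of_le (by exact_mod_cast Nat.le_succ _)) i hy
        (Fin.tail m)).symm) (ih (hf.of_le (by exact_mod_cast Nat.le_succ _)) i hp (Fin.tail m)).symm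
      have e4 := (hS p hp).eq e3 e2
      exact congrArg (fun L => L (m 0)) e4

theorem iteratedFDerivWithin_comp_perm {S : Set X} (hS : UniqueDiffOn ℝ S)
    (hcl : S ⊆ closure (interior S)) {f : X → Y} {n : ℕ} (hf : ContDiffOn ℝ n f S)
    (σ : Equiv.Perm (Fin n)) {p : X} (hp : p ∈ S) (m : Fin n → X) :
    iteratedFDerivWithin ℝ n f S p (m ∘ σ) = iteratedFDerivWithin ℝ n f S p m := by
  cases n with
  | zero => congr 1; ext i; exact i.elim0
  | succ n =>
    have hσ : σ ∈ Submonoid.closure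
        (Set.range fun i : Fin n => Equiv.swap i.castSucc i.succ) := by
      rw [Equiv.Perm.mclosure_swap_castSucc_succ]; trivial
    induction hσ using Submonoid.closure_induction generalizing m with
    | mem σ h =>
      obtain ⟨i, rfl⟩ := h
      exact iteratedFDerivWithin_comp_swap_adjacent hS hcl n hf i hp m
    | one => rfl
    | mul σ τ _ _ h1 h2 =>
      rw [Equiv.Perm.coe_mul, ← Function.comp_assoc, h2, h1]

end Symmetry

/-! ### From mixed partial derivatives to jets -/

section Mixed

variable {E : Type*} [NormedAddCommGroup E] [NormedSpace ℝ E] {X : Type*} [NormedAddCommGroup X]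
  [NormedSpace ℝ X] {k : ℕ} {S : Set (E × ℝ)} {γ K : ℝ} {f : E × ℝ → X}

/-- By symmetry, the bound on the mixed partial derivatives holds wherever the `y`-directions are
inserted. -/
theorem MixedBound.norm_piecewise_le (hS : UniqueDiffOn ℝ S) (hcl : S ⊆ closure (interior S))
    (hf : ContDiffOn ℝ (k + 1) f S) (h : MixedBound k S γ K f) {n : ℕ} (hn : n ≤ k + 1)
    {p : E × ℝ} (hp : p ∈ S) (s : Finset (Fin n)) (v : Fin n → E) :
    ‖iteratedFDerivWithin ℝ n f S p
        (s.piecewise (fun i => (v i, (0 : ℝ))) (fun _ => ((0 : E), (1 : ℝ))))‖ ≤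
      K * |p.2| ^ (γ - (sᶜ.card : ℝ)) * ∏ i ∈ s, ‖v i‖ := by
  -- the permutation that moves the `x`-slots to the front
  obtain ⟨l, hl⟩ : ∃ l, s.card = l := ⟨_, rfl⟩
  obtain ⟨m, hm⟩ : ∃ m, sᶜ.card = m := ⟨_, rfl⟩
  obtain rfl : n = l + m := by
    have := s.card_add_card_compl
    rw [hl, hm, Fintype.card_fin] at this; exact this.symm
  set σ : Equiv.Perm (Fin (l + m)) := finSumFinEquiv.symm.trans (finSumEquivOfFinset hl hm) with hσ
  have hσl : ∀ i : Fin l, σ (Fin.castAdd m i) = s.orderEmbOfFin hl i := fun i => by simp [hσ]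
  have hσr : ∀ i : Fin m, σ (Fin.natAdd l i) = sᶜ.orderEmbOfFin hm i := fun i => by simp [hσ]
  have hf' : ContDiffOn ℝ (l + m : ℕ) f S := hf.of_le (by exact_mod_cast hn)
  rw [← iteratedFDerivWithin_comp_perm hS hcl hf' σ hp]
  have heq : (s.piecewise (fun i => (v i, (0 : ℝ))) (fun _ => ((0 : E), (1 : ℝ)))) ∘ σ =
      Fin.append (fun i => (v (s.orderEmbOfFin hl i), (0 : ℝ)))
        (fun _ : Fin m => ((0 : E), (1 : ℝ))) := by
    funext i
    refine Fin.addCases (fun i => ?_) (fun i => ?_) i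
    · rw [Fin.append_left]
      change s.piecewise _ _ (σ (Fin.castAdd m i)) = _
      rw [hσl, Finset.piecewise_eq_of_mem _ _ _ (s.orderEmbOfFin_mem hl i)]
    · rw [Fin.append_right]
      change s.piecewise _ _ (σ (Fin.natAdd l i)) = _
      rw [hσr, Finset.piecewise_eq_of_notMem _ _ _
        (Finset.mem_compl.1 (sᶜ.orderEmbOfFin_mem hm i))]
  rw [heq, hm]
  refine (h l m hn p hp _).trans_eq ?_
  congr 1
  exact ((s.orderIsoOfFin hl).toEquiv.prod_comp (fun i : s => ‖v i‖)).trans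
    (Finset.prod_coe_sort s fun i => ‖v i‖)

/-- The mixed partial derivatives bound the full derivatives: only the slots whose argument has a
`y`-component cost a power of `|y|`. -/
theorem MixedBound.norm_apply_le (hS : UniqueDiffOn ℝ S) (hcl : S ⊆ closure (interior S))
    (hf : ContDiffOn ℝ (k + 1) f S) (hK : 0 ≤ K) (h : MixedBound k S γ K f) {n : ℕ}
    (hn : n ≤ k + 1) {p : E × ℝ} (hp : p ∈ S) (hp0 : p.2 ≠ 0) (hp1 : |p.2| ≤ 1)
    (u : Fin n → E × ℝ) {j : ℕ} (hj : (Finset.univ.filter fun i => (u i).2 ≠ 0).card ≤ j) :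
    ‖iteratedFDerivWithin ℝ n f S p u‖ ≤ 2 ^ n * K * |p.2| ^ (γ - (j : ℝ)) * ∏ i, ‖u i‖ := by
  set M := iteratedFDerivWithin ℝ n f S p
  have hu : u = (fun i => ((u i).1, (0 : ℝ))) + fun i => ((0 : E), (u i).2) := by
    funext i; simp
  -- expand over the slots whose `x`-component is taken
  have hexp : M u = ∑ s : Finset (Fin n), M (s.piecewise (fun i => ((u i).1, (0 : ℝ)))
      fun i => ((0 : E), (u i).2)) := by
    conv_lhs => rw [hu]
    exact M.map_add_univ _ _
  rw [hexp]
  refine (norm_sum_le _ _).trans ?_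
  have hterm : ∀ s ∈ (Finset.univ : Finset (Finset (Fin n))), ‖M (s.piecewise
      (fun i => ((u i).1, (0 : ℝ))) fun i => ((0 : E), (u i).2))‖ ≤
      K * |p.2| ^ (γ - (j : ℝ)) * ∏ i, ‖u i‖ := by
    intro s _
    have hpw : s.piecewise (fun i => ((u i).1, (0 : ℝ))) (fun i => ((0 : E), (u i).2)) =
        sᶜ.piecewise (fun i => (u i).2 • s.piecewise (fun i => ((u i).1, (0 : ℝ)))
          (fun _ => ((0 : E), (1 : ℝ))) i)
          (s.piecewise (fun i => ((u i).1, (0 : ℝ))) (fun _ => ((0 : E), (1 : ℝ)))) := by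
      funext i
      by_cases hi : i ∈ s
      · simp [hi]
      · simp [hi]
    rw [hpw, M.map_piecewise_smul, norm_smul, norm_prod]
    have hprod : 0 ≤ ∏ i, ‖u i‖ := Finset.prod_nonneg fun _ _ => norm_nonneg _
    -- a term vanishes unless all its `y`-slots are among the at most `j` with a `y`-component
    by_cases hs : ∃ i ∈ sᶜ, (u i).2 = 0
    · obtain ⟨i, hi, hi0⟩ := hs
      rw [Finset.prod_eq_zero hi (by simpa using hi0), zero_mul]
      positivity
    · push Not at hs
      have hcard : sᶜ.card ≤ j :=
        (Finset.card_le_card fun i hi => Finset.mem_filter.2 ⟨Finset.mem_univ _, hs i hi⟩).trans hj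
      have h1 := h.norm_piecewise_le hS hcl hf hn hp s fun i => (u i).1
      have h2 : |p.2| ^ (γ - (sᶜ.card : ℝ)) ≤ |p.2| ^ (γ - (j : ℝ)) := by
        apply Real.rpow_le_rpow_of_exponent_ge (abs_pos.2 hp0) hp1
        have : (sᶜ.card : ℝ) ≤ j := by exact_mod_cast hcard
        linarith
      have h3 : (∏ i ∈ sᶜ, ‖(u i).2‖) ≤ ∏ i ∈ sᶜ, ‖u i‖ :=
        Finset.prod_le_prod (fun _ _ => norm_nonneg _) fun i _ => norm_snd_le _
      have h4 : (∏ i ∈ s, ‖(u i).1‖) ≤ ∏ i ∈ s, ‖u i‖ :=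
        Finset.prod_le_prod (fun _ _ => norm_nonneg _) fun i _ => norm_fst_le _
      have h5 : 0 ≤ ∏ i ∈ s, ‖(u i).1‖ := Finset.prod_nonneg fun _ _ => norm_nonneg _
      have h6 : 0 ≤ ∏ i ∈ sᶜ, ‖u i‖ := Finset.prod_nonneg fun _ _ => norm_nonneg _
      calc _ ≤ (∏ i ∈ sᶜ, ‖u i‖) * (K * |p.2| ^ (γ - (j : ℝ)) * ∏ i ∈ s, ‖u i‖) := by
            refine mul_le_mul h3 (h1.trans ?_) (norm_nonneg _) h6
            gcongr
        _ = K * |p.2| ^ (γ - (j : ℝ)) * ((∏ i ∈ s, ‖u i‖) * ∏ i ∈ sᶜ, ‖u i‖) := by ring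
        _ = _ := by rw [Finset.prod_mul_prod_compl]
  refine (Finset.sum_le_sum hterm).trans_eq ?_
  rw [Finset.sum_const, Finset.card_univ, Fintype.card_finset, Fintype.card_fin, nsmul_eq_mul]
  push_cast; ring

theorem rpow_sub_natCast_eq {y : ℝ} (hy : y ≠ 0) (s : ℝ) (i : ℕ) :
    |y| ^ (s - (i : ℝ)) = |y| ^ s * (|y|⁻¹) ^ i := by
  rw [Real.rpow_sub_natCast (abs_pos.2 hy).ne', div_eq_mul_inv, inv_pow]

theorem MixedBound.jetBound (hS : UniqueDiffOn ℝ S) (hcl : S ⊆ closure (interior S))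
    (hf : ContDiffOn ℝ (k + 1) f S) (hK : 0 ≤ K) (h : MixedBound k S γ K f)
    {p : E × ℝ} (hp : p ∈ S) (hp0 : p.2 ≠ 0) (hp1 : |p.2| ≤ 1) :
    JetBound (k + 1) S p (2 ^ (k + 1) * K * |p.2| ^ γ) |p.2|⁻¹ f := fun i hi => by
  refine ContinuousMultilinearMap.opNorm_le_bound (by positivity) fun u => ?_
  refine (h.norm_apply_le hS hcl hf hK hi hp hp0 hp1 u (j := i)
    ((Finset.card_le_univ _).trans_eq (Fintype.card_fin i))).trans ?_
  rw [rpow_sub_natCast_eq hp0]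
  have hprod : 0 ≤ ∏ i, ‖u i‖ := Finset.prod_nonneg fun _ _ => norm_nonneg _
  have h2 : (2 : ℝ) ^ i ≤ 2 ^ (k + 1) := pow_le_pow_right₀ (by norm_num) hi
  calc _ = 2 ^ i * (K * (|p.2| ^ γ * |p.2|⁻¹ ^ i) * ∏ i, ‖u i‖) := by ring
    _ ≤ 2 ^ (k + 1) * (K * (|p.2| ^ γ * |p.2|⁻¹ ^ i) * ∏ i, ‖u i‖) := by gcongr
    _ = _ := by ring

/-- The derivative in the `x`-direction satisfies the same bounds as the function: it does not
lose a power of `|y|`. -/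
theorem MixedBound.jetBound_dx (hS : UniqueDiffOn ℝ S) (hcl : S ⊆ closure (interior S))
    (hf : ContDiffOn ℝ (k + 1) f S) (hK : 0 ≤ K) (h : MixedBound k S γ K f)
    {p : E × ℝ} (hp : p ∈ S) (hp0 : p.2 ≠ 0) (hp1 : |p.2| ≤ 1) :
    JetBound k S p (2 ^ (k + 1) * K * |p.2| ^ γ) |p.2|⁻¹
      (fun p => (fderivWithin ℝ f S p).comp (ContinuousLinearMap.inl ℝ E ℝ)) := fun i hi => by
  have hDf : ContDiffOn ℝ k (fderivWithin ℝ f S) S := hf.fderivWithin hS le_rfl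
  have e1 := ((ContinuousLinearMap.compL ℝ E (E × ℝ) X).flip
    (ContinuousLinearMap.inl ℝ E ℝ)).iteratedFDerivWithin_comp_left (hDf p hp) hS hp (i := i)
    (by exact_mod_cast hi)
  have e2 : (fun p => (fderivWithin ℝ f S p).comp (ContinuousLinearMap.inl ℝ E ℝ)) =
      ((ContinuousLinearMap.compL ℝ E (E × ℝ) X).flip (ContinuousLinearMap.inl ℝ E ℝ)) ∘
        fderivWithin ℝ f S := rfl
  rw [e2, e1]
  refine ContinuousMultilinearMap.opNorm_le_bound (by positivity) fun u => ?_
  have hprod : 0 ≤ ∏ i, ‖u i‖ := Finset.prod_nonneg fun _ _ => norm_nonneg _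
  refine ContinuousLinearMap.opNorm_le_bound _ (by positivity) fun x => ?_
  have e3 := iteratedFDerivWithin_succ_apply_right (f := f) hS hp (n := i)
    (Fin.snoc u ((x, 0) : E × ℝ))
  rw [Fin.init_snoc, Fin.snoc_last] at e3
  have e4 : (((ContinuousLinearMap.compL ℝ E (E × ℝ) X).flip
      (ContinuousLinearMap.inl ℝ E ℝ)).compContinuousMultilinearMap
      (iteratedFDerivWithin ℝ i (fderivWithin ℝ f S) S p)) u x =
      iteratedFDerivWithin ℝ i (fderivWithin ℝ f S) S p u (x, 0) := rfl
  rw [e4, ← e3]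
  -- the last slot holds `(x, 0)`, so at most `i` of the `i + 1` slots have a `y`-component
  have hcard : (Finset.univ.filter fun a : Fin (i + 1) =>
      ((Fin.snoc u ((x, 0) : E × ℝ) : Fin (i + 1) → E × ℝ) a).2 ≠ 0).card ≤ i := by
    have hsub : (Finset.univ.filter fun a : Fin (i + 1) =>
        ((Fin.snoc u ((x, 0) : E × ℝ) : Fin (i + 1) → E × ℝ) a).2 ≠ 0) ⊆
        Finset.univ.erase (Fin.last i) := by
      intro a ha
      rw [Finset.mem_filter] at ha
      refine Finset.mem_erase.2 ⟨?_, Finset.mem_univ _⟩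
      rintro rfl
      exact ha.2 (by simp)
    refine (Finset.card_le_card hsub).trans_eq ?_
    rw [Finset.card_erase_of_mem (Finset.mem_univ _)]; simp
  refine (h.norm_apply_le hS hcl hf hK (by omega) hp hp0 hp1 _ hcard).trans ?_
  rw [rpow_sub_natCast_eq hp0, Fin.prod_univ_castSucc]
  simp only [Fin.snoc_castSucc, Fin.snoc_last]
  have hx : ‖((x, 0) : E × ℝ)‖ = ‖x‖ := by simp [Prod.norm_def]
  rw [hx]
  have h2 : (2 : ℝ) ^ (i + 1) ≤ 2 ^ (k + 1) := pow_le_pow_right₀ (by norm_num) (by omega)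
  calc _ = 2 ^ (i + 1) * (K * (|p.2| ^ γ * |p.2|⁻¹ ^ i) * ((∏ i, ‖u i‖) * ‖x‖)) := by ring
    _ ≤ 2 ^ (k + 1) * (K * (|p.2| ^ γ * |p.2|⁻¹ ^ i) * ((∏ i, ‖u i‖) * ‖x‖)) := by gcongr
    _ = _ := by ring

end Mixed

/-! ### The domain, and flat extension across `D₀` -/

section Geometry

variable (E : Type*) [NormedAddCommGroup E]

theorem dom_eq_closedBall : dom E = Metric.closedBall (0 : E × ℝ) 1 := by
  ext p
  simp [dom, Prod.norm_def]

theorem domStar_eq : domStar E = dom E ∩ {p | p.2 ≠ 0} := by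
  ext p
  simp only [domStar, domNeg, domPos, mem_union, mem_ofPred_eq, mem_inter_iff]
  constructor
  · rintro (⟨h, h'⟩ | ⟨h, h'⟩)
    · exact ⟨h, h'.ne⟩
    · exact ⟨h, h'.ne'⟩
  · rintro ⟨h, h'⟩
    rcases lt_or_gt_of_ne h' with h1 | h1
    · exact Or.inl ⟨h, h1⟩
    · exact Or.inr ⟨h, h1⟩

theorem isOpen_snd_ne_zero : IsOpen {p : E × ℝ | p.2 ≠ 0} :=
  isOpen_ne_fun continuous_snd continuous_const

theorem domStar_subset_dom : domStar E ⊆ dom E := by rw [domStar_eq]; exact inter_subset_left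

variable {E}

theorem isCompact_dom [NormedSpace ℝ E] [FiniteDimensional ℝ E] : IsCompact (dom E) := by
  rw [dom_eq_closedBall]
  exact isCompact_closedBall _ _

theorem snd_ne_zero_of_mem_domStar {p : E × ℝ} (hp : p ∈ domStar E) : p.2 ≠ 0 := by
  rw [domStar_eq] at hp; exact hp.2

theorem abs_snd_le_one_of_mem_domStar {p : E × ℝ} (hp : p ∈ domStar E) : |p.2| ≤ 1 :=
  (domStar_subset_dom E hp).2

theorem mem_domStar_iff {p : E × ℝ} (hp : p ∈ dom E) : p ∈ domStar E ↔ p.2 ≠ 0 := by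
  rw [domStar_eq]; exact ⟨fun h => h.2, fun h => ⟨hp, h⟩⟩

theorem domStar_mem_nhdsWithin {p : E × ℝ} (hp : p ∈ domStar E) : domStar E ∈ 𝓝[dom E] p := by
  rw [domStar_eq]
  exact inter_mem self_mem_nhdsWithin
    (mem_nhdsWithin_of_mem_nhds ((isOpen_snd_ne_zero E).mem_nhds (snd_ne_zero_of_mem_domStar hp)))

variable [NormedSpace ℝ E]

theorem dom_inter_subset_closure_interior {U : Set (E × ℝ)} (hU : IsOpen U) :
    dom E ∩ U ⊆ closure (interior (dom E ∩ U)) := by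
  have h1 : dom E ⊆ closure (interior (dom E)) := by
    rw [dom_eq_closedBall, interior_closedBall (0 : E × ℝ) one_ne_zero,
      closure_ball (0 : E × ℝ) one_ne_zero]
  rw [interior_inter, hU.interior_eq]
  exact (inter_subset_inter_left _ h1).trans (hU.closure_inter)

theorem uniqueDiffOn_dom : UniqueDiffOn ℝ (dom E) := by
  rw [dom_eq_closedBall]
  exact uniqueDiffOn_convex (convex_closedBall _ _) (by
    rw [interior_closedBall (0 : E × ℝ) one_ne_zero]
    exact ⟨0, Metric.mem_ball_self one_pos⟩)

theorem uniqueDiffOn_domStar : UniqueDiffOn ℝ (domStar E) := by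
  rw [domStar_eq]
  exact uniqueDiffOn_dom.inter (isOpen_snd_ne_zero E)

variable {X : Type*} [NormedAddCommGroup X] [NormedSpace ℝ X]

theorem iteratedFDerivWithin_dom_eq {f : E × ℝ → X} {p : E × ℝ} (hp : p ∈ domStar E) (n : ℕ) :
    iteratedFDerivWithin ℝ n f (dom E) p = iteratedFDerivWithin ℝ n f (domStar E) p := by
  rw [domStar_eq, iteratedFDerivWithin_inter_open (isOpen_snd_ne_zero E)
    (snd_ne_zero_of_mem_domStar hp)]

/-- A function that is `C^k` on `D*`, vanishes on `D₀`, and whose derivatives of order `i ≤ k` are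
`O(|y| ^ (s - i))` with `s > k` is `C^k` on `D`, and flat on `D₀`. -/
theorem contDiffOn_dom_of_flat {k : ℕ} {f : E × ℝ → X} {C s : ℝ} (hs : (k : ℝ) < s)
    (hf : ContDiffOn ℝ k f (domStar E)) (h0 : ∀ p ∈ domZero E, f p = 0)
    (hb : ∀ p ∈ domStar E, ∀ i ≤ k,
      ‖iteratedFDerivWithin ℝ i f (domStar E) p‖ ≤ C * |p.2| ^ (s - (i : ℝ))) :
    ContDiffOn ℝ k f (dom E) ∧
      ∀ i ≤ k, ∀ p ∈ domZero E, iteratedFDerivWithin ℝ i f (dom E) p = 0 := by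
  -- the Taylor series on `D*`, extended by `0`, is a Taylor series on `D`
  set P : E × ℝ → FormalMultilinearSeries ℝ (E × ℝ) X := fun p i =>
    if p.2 = 0 then 0 else iteratedFDerivWithin ℝ i f (domStar E) p with hP
  have hP0 : ∀ p : E × ℝ, p.2 = 0 → ∀ i, P p i = 0 := fun p hp i => by simp [hP, hp]
  have hPs : ∀ p ∈ domStar E, ∀ i, P p i = iteratedFDerivWithin ℝ i f (domStar E) p :=
    fun p hp i => by simp [hP, snd_ne_zero_of_mem_domStar hp]
  have hC : 0 ≤ C := by
    have h1 : ((0, 1) : E × ℝ) ∈ domStar E := Or.inr ⟨by simp [dom], by simp⟩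
    have := (norm_nonneg _).trans (hb _ h1 0 (Nat.zero_le _))
    simpa using this
  have hPb : ∀ p ∈ dom E, ∀ i ≤ k, ‖P p i‖ ≤ C * |p.2| ^ (s - (i : ℝ)) := by
    intro p hp i hi
    by_cases h : p.2 = 0
    · rw [hP0 p h]; simp; positivity
    · have := (mem_domStar_iff hp).2 h
      rw [hPs p this]
      exact hb p this i hi
  have hTS := hf.ftaylorSeriesWithin uniqueDiffOn_domStar
  have hev : ∀ x ∈ domStar E, ∀ i, ∀ᶠ y in 𝓝[dom E] x,
      P y i = ftaylorSeriesWithin ℝ f (domStar E) y i := fun x hx i => by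
    filter_upwards [domStar_mem_nhdsWithin hx] with y hy using hPs y hy i
  have htend : ∀ x : E × ℝ, x.2 = 0 → ∀ e : ℝ, 0 < e →
      Tendsto (fun y : E × ℝ => C * |y.2| ^ e) (𝓝[dom E] x) (𝓝 0) := fun x hx e he => by
    have hc : Continuous fun y : E × ℝ => C * |y.2| ^ e :=
      continuous_const.mul ((continuous_abs.comp continuous_snd).rpow_const fun _ => Or.inr he.le)
    have := (hc.tendsto x).mono_left (nhdsWithin_le_nhds (s := dom E))
    simpa [hx, Real.zero_rpow he.ne'] using this
  have hT : HasFTaylorSeriesUpToOn k f P (dom E) := by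
    refine ⟨fun x hx => ?_, fun m hm x hx => ?_, fun m hm x hx => ?_⟩
    · by_cases h : x.2 = 0
      · rw [hP0 x h, h0 x ⟨hx, h⟩]; rfl
      · have := (mem_domStar_iff hx).2 h
        rw [hPs x this]; exact hTS.zero_eq x this
    · have hm' : m < k := by exact_mod_cast hm
      by_cases h : x.2 = 0
      · rw [hP0 x h]
        -- `P y m = O(|y| ^ (s - m))` is `o(‖y - x‖)`, since `s - m > 1`
        have he : 0 < s - m - 1 := by
          have : (m : ℝ) + 1 ≤ k := by exact_mod_cast hm'
          linarith
        refine HasFDerivWithinAt.of_isLittleO ?_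
        have hO : (fun y : E × ℝ => P y m - P x m -
            (0 : E × ℝ →L[ℝ] ContinuousMultilinearMap ℝ (fun _ : Fin m => E × ℝ) X) (y - x))
            =O[𝓝[dom E] x] fun y => (C * |y.2| ^ (s - m - 1)) * ‖y - x‖ := by
          refine Asymptotics.IsBigO.of_bound 1 ?_
          filter_upwards [self_mem_nhdsWithin] with y hy
          rw [hP0 x h, sub_zero, _root_.zero_apply, sub_zero, one_mul]
          have h1 := hPb y hy m hm'.le
          have h2 : |y.2| ^ (s - (m : ℝ)) = |y.2| ^ (s - m - 1) * |y.2| := by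
            rcases eq_or_ne y.2 0 with h3 | h3
            · rw [h3, abs_zero, Real.zero_rpow (by linarith), mul_zero]
            · rw [← Real.rpow_add_one (abs_pos.2 h3).ne']; ring_nf
          have h3 : |y.2| ≤ ‖y - x‖ := by
            have := norm_snd_le (y - x)
            simpa [h] using this
          rw [Real.norm_of_nonneg (by positivity)]
          refine h1.trans ?_
          rw [h2, ← mul_assoc]
          gcongr
        have hlo : (fun y : E × ℝ => (C * |y.2| ^ (s - m - 1)) * ‖y - x‖) =o[𝓝[dom E] x]
            fun y => (1 : ℝ) * ‖y - x‖ :=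
          ((Asymptotics.isLittleO_one_iff ℝ).2 (htend x h _ he)).mul_isBigO
            (Asymptotics.isBigO_refl _ _)
        simp only [one_mul] at hlo
        exact (hO.trans_isLittleO hlo).of_norm_right
      · have hxs := (mem_domStar_iff hx).2 h
        rw [hPs x hxs]
        exact ((hTS.fderivWithin m hm x hxs).mono_of_mem_nhdsWithin
          (domStar_mem_nhdsWithin hxs)).congr_of_eventuallyEq (hev x hxs m) (hPs x hxs m)
    · have hm' : m ≤ k := by exact_mod_cast hm
      by_cases h : x.2 = 0
      · have he : 0 < s - m := by
          have : (m : ℝ) ≤ k := by exact_mod_cast hm'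
          linarith
        rw [ContinuousWithinAt, hP0 x h]
        refine squeeze_zero_norm' ?_ (htend x h _ he)
        filter_upwards [self_mem_nhdsWithin] with y hy using hPb y hy m hm'
      · have hxs := (mem_domStar_iff hx).2 h
        exact ((hTS.cont m hm x hxs).mono_of_mem_nhdsWithin
          (domStar_mem_nhdsWithin hxs)).congr_of_eventuallyEq (hev x hxs m) (hPs x hxs m)
  refine ⟨hT.contDiffOn, fun i hi p hp => ?_⟩
  rw [← hT.eq_iteratedFDerivWithin_of_uniqueDiffOn (by exact_mod_cast hi) uniqueDiffOn_dom hp.1]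
  exact hP0 p hp.2 i

end Geometry

/-! ### Jets of `|y| ^ α` -/

section Local

variable {E : Type*} [NormedAddCommGroup E] [NormedSpace ℝ E] {X : Type*} [NormedAddCommGroup X]
  [NormedSpace ℝ X]

theorem JetBound.fderivWithin {Y : Type*} [NormedAddCommGroup Y] [NormedSpace ℝ Y] {n : ℕ}
    {S : Set X} {p : X} {K H : ℝ} {f : X → Y} (hS : UniqueDiffOn ℝ S) (hp : p ∈ S)
    (h : JetBound (n + 1) S p K H f) : JetBound n S p (K * H) H (fderivWithin ℝ f S) :=
  fun i hi => by
    rw [norm_iteratedFDerivWithin_fderivWithin hS hp]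
    refine (h (i + 1) (by omega)).trans_eq (by ring)

theorem jetBound_inter_iff {Y : Type*} [NormedAddCommGroup Y] [NormedSpace ℝ Y] {n : ℕ}
    {S U : Set X} {p : X} {K H : ℝ} {f : X → Y} (hU : IsOpen U) (hp : p ∈ U) :
    JetBound n (S ∩ U) p K H f ↔ JetBound n S p K H f := by
  simp only [JetBound, iteratedFDerivWithin_inter_open hU hp]

theorem norm_iteratedFDerivWithin_clm_le (L : X →L[ℝ] ℝ) {S : Set X} (hS : UniqueDiffOn ℝ S)
    {p : X} (hp : p ∈ S) {i : ℕ} (hi : 1 ≤ i) :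
    ‖iteratedFDerivWithin ℝ i L S p‖ ≤ ‖L‖ ^ i := by
  obtain ⟨i, rfl⟩ : ∃ j, i = j + 1 := ⟨i - 1, by omega⟩
  rw [← norm_iteratedFDerivWithin_fderivWithin hS hp,
    iteratedFDerivWithin_congr (f := fun _ => L) (fun x hx => L.fderivWithin (hS x hx)) hp]
  rcases Nat.eq_zero_or_pos i with rfl | hi
  · simp
  · rw [iteratedFDerivWithin_const_of_ne hi.ne']; simp

/-- The function `|y| ^ α` on one side of `y = 0` is homogeneous, so its jets at `p` are those at
`y = 1` rescaled by `|y|`. -/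
theorem exists_jetBound_abs_rpow (E : Type*) [NormedAddCommGroup E] [NormedSpace ℝ E] (n : ℕ)
    (α : ℝ) : ∃ C, 0 ≤ C ∧ ∀ (σ : ℝ) (S : Set (E × ℝ)), |σ| = 1 → UniqueDiffOn ℝ S →
      (∀ x ∈ S, 0 < σ * x.2) → ContDiffOn ℝ n (fun x : E × ℝ => |x.2| ^ α) S ∧ ∀ p ∈ S,
      JetBound n S p (C * |p.2| ^ α) |p.2|⁻¹ (fun x : E × ℝ => |x.2| ^ α) := by
  set h : ℝ → ℝ := fun t => t ^ α with hh
  have hcd : ContDiffOn ℝ n h (Ioi 0) := fun t ht =>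
    (Real.contDiffAt_rpow_const_of_ne (ne_of_gt ht)).contDiffWithinAt
  set C := ∑ i ∈ Finset.range (n + 1), ‖iteratedFDerivWithin ℝ i h (Ioi 0) 1‖
  have hC0 : 0 ≤ C := Finset.sum_nonneg fun _ _ => norm_nonneg _
  refine ⟨n.factorial * C, by positivity, fun σ S hσ hS hpos => ?_⟩
  have habs : ∀ x ∈ S, |x.2| = σ * x.2 := fun x hx => by
    have h1 := abs_of_pos (hpos x hx)
    rwa [abs_mul, hσ, one_mul] at h1
  have hcdS : ContDiffOn ℝ n (fun x : E × ℝ => |x.2| ^ α) S := by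
    have h1 : ContDiffOn ℝ n (h ∘ fun x : E × ℝ => σ * x.2) S :=
      hcd.comp (contDiff_const.mul contDiff_snd).contDiffOn fun x hx => hpos x hx
    exact h1.congr fun x hx => by simp only [hh, Function.comp, habs x hx]
  refine ⟨hcdS, fun p hp i hi => ?_⟩
  have hi' : (i : WithTop ℕ∞) ≤ n := by exact_mod_cast hi
  have hr : 0 < |p.2| := by rw [habs p hp]; exact hpos p hp
  set ℓ : E × ℝ →L[ℝ] ℝ := (|p.2|⁻¹ * σ) • ContinuousLinearMap.snd ℝ E ℝ with hℓ
  have hℓx : ∀ x, ℓ x = |p.2|⁻¹ * (σ * x.2) := fun x => by simp [hℓ, mul_assoc]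
  have hℓmaps : MapsTo ℓ S (Ioi 0) := fun x hx => by
    rw [hℓx]; exact mul_pos (inv_pos.2 hr) (hpos x hx)
  have hℓp : ℓ p = 1 := by
    rw [hℓx, ← habs p hp]; exact inv_mul_cancel₀ hr.ne'
  have hℓn : ‖ℓ‖ ≤ |p.2|⁻¹ := by
    rw [hℓ, norm_smul, norm_mul, Real.norm_eq_abs σ, hσ, mul_one, Real.norm_eq_abs,
      abs_of_pos (inv_pos.2 hr)]
    exact mul_le_of_le_one_right (inv_pos.2 hr).le (ContinuousLinearMap.norm_snd_le ℝ E ℝ)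
  have heq : EqOn (fun x : E × ℝ => |x.2| ^ α) (fun x => |p.2| ^ α • (h ∘ ℓ) x) S := by
    intro x hx
    have hx0 := hℓmaps hx
    simp only [hh, Function.comp, smul_eq_mul]
    rw [← Real.mul_rpow hr.le (le_of_lt hx0), hℓx, mul_inv_cancel_left₀ hr.ne', habs x hx]
  have hcomp := norm_iteratedFDerivWithin_comp_le (n := i) (C := C) (D := |p.2|⁻¹) hcd
    ℓ.contDiff.contDiffOn hi' isOpen_Ioi.uniqueDiffOn hS hℓmaps hp
    (fun a ha => by
      rw [hℓp]
      exact Finset.single_le_sum (f := fun i => ‖iteratedFDerivWithin ℝ i h (Ioi 0) 1‖)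
        (fun _ _ => norm_nonneg _) (Finset.mem_range.2 (by omega)))
    (fun a ha1 _ => (norm_iteratedFDerivWithin_clm_le ℓ hS hp ha1).trans
      (pow_le_pow_left₀ (norm_nonneg _) hℓn a))
  have hcdℓ : ContDiffOn ℝ i (h ∘ ℓ) S :=
    (hcd.of_le hi').comp ℓ.contDiff.contDiffOn hℓmaps
  rw [iteratedFDerivWithin_congr heq hp]
  have e := iteratedFDerivWithin_const_smul_apply (a := |p.2| ^ α) (hcdℓ p hp) hS hp
  have e2 : (fun x => |p.2| ^ α • (h ∘ ℓ) x) = |p.2| ^ α • (h ∘ ℓ) := rfl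
  rw [e2, e, norm_smul, Real.norm_of_nonneg (by positivity)]
  calc _ ≤ |p.2| ^ α * (i.factorial * C * |p.2|⁻¹ ^ i) := by gcongr
    _ ≤ |p.2| ^ α * (n.factorial * C * |p.2|⁻¹ ^ i) := by gcongr
    _ = _ := by ring

theorem hasFDerivWithinAt_abs_rpow {σ α : ℝ} {S : Set (E × ℝ)} (hσ : |σ| = 1)
    (hpos : ∀ x ∈ S, 0 < σ * x.2) {p : E × ℝ} (hp : p ∈ S) :
    HasFDerivWithinAt (fun x : E × ℝ => |x.2| ^ α)
      ((α * |p.2| ^ (α - 1) * σ) • ContinuousLinearMap.snd ℝ E ℝ) S p := by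
  have habs : ∀ x ∈ S, |x.2| = σ * x.2 := fun x hx => by
    have h1 := abs_of_pos (hpos x hx)
    rwa [abs_mul, hσ, one_mul] at h1
  have h1 : HasFDerivAt (fun x : E × ℝ => σ * x.2) (σ • ContinuousLinearMap.snd ℝ E ℝ) p :=
    (ContinuousLinearMap.snd ℝ E ℝ).hasFDerivAt.const_mul σ
  have h2 := (h1.rpow_const (p := α) (Or.inl (hpos p hp).ne')).hasFDerivWithinAt (s := S)
  refine (h2.congr (fun x hx => by rw [habs x hx]) (by rw [habs p hp])).congr_fderiv ?_
  rw [habs p hp, smul_smul]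

theorem MixedBound.prodMk {Y : Type*} [NormedAddCommGroup Y] [NormedSpace ℝ Y] {k : ℕ}
    {S : Set (E × ℝ)} {γ K : ℝ} {f : E × ℝ → X} {g : E × ℝ → Y} (hS : UniqueDiffOn ℝ S)
    (hf : ContDiffOn ℝ (k + 1) f S) (hg : ContDiffOn ℝ (k + 1) g S) (h : MixedBound k S γ K f)
    (h' : MixedBound k S γ K g) : MixedBound k S γ K (fun p => (f p, g p)) := by
  intro l m hlm p hp v
  rw [iteratedFDerivWithin_prodMk (hf p hp) (hg p hp) hS hp (by exact_mod_cast hlm)]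
  exact max_le (h l m hlm p hp v) (h' l m hlm p hp v)

end Local

/-! ### The derivative of `T` near `D₀` -/

section LocalCoefficients

variable {E : Type*} [NormedAddCommGroup E] [NormedSpace ℝ E]

/-- The partial derivative of `T` in the direction of `x`, with values in `E × ℝ`. -/
noncomputable def dx (T : E × ℝ → E × ℝ) (p : E × ℝ) : E →L[ℝ] E × ℝ :=
  (fderivWithin ℝ T (domStar E) p).comp (ContinuousLinearMap.inl ℝ E ℝ)

/-- The partial derivative of `T` in the direction of `y`, with values in `E × ℝ`. -/
noncomputable def dy (T : E × ℝ → E × ℝ) (p : E × ℝ) : E × ℝ :=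
  fderivWithin ℝ T (domStar E) p (0, 1)

theorem contDiffOn_dx {k : ℕ} {T : E × ℝ → E × ℝ} (hT : ContDiffOn ℝ (k + 1) T (domStar E)) :
    ContDiffOn ℝ k (dx T) (domStar E) :=
  ((ContinuousLinearMap.compL ℝ E (E × ℝ) (E × ℝ)).flip
    (ContinuousLinearMap.inl ℝ E ℝ)).contDiff.comp_contDiffOn
      (hT.fderivWithin uniqueDiffOn_domStar le_rfl)

theorem contDiffOn_dy {k : ℕ} {T : E × ℝ → E × ℝ} (hT : ContDiffOn ℝ (k + 1) T (domStar E)) :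
    ContDiffOn ℝ k (dy T) (domStar E) :=
  (ContinuousLinearMap.apply ℝ (E × ℝ) ((0, 1) : E × ℝ)).contDiff.comp_contDiffOn
      (hT.fderivWithin uniqueDiffOn_domStar le_rfl)

/-- Near one side of `D₀`, with `r = |y|`: the jets of `∂ₓT` are of order `α + γ`, those of `∂ᵧT` of
order `α - 1`, and `∂ᵧG` is at least of this size. The sign `σ` selects the side. -/
theorem HasForm.exists_jetBound {k : ℕ} {T : E × ℝ → E × ℝ} {α γ K δ σ : ℝ} (hσ : |σ| = 1)
    (hα : 0 < α) (hγ : 0 < γ) (hK : 0 < K) (hδ : 0 < δ)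
    (h : HasForm k T (dom E ∩ {p | 0 < σ * p.2 ∧ |p.2| < δ}) α γ K) :
    ∃ C c δ' : ℝ, 0 ≤ C ∧ 0 < c ∧ 0 < δ' ∧ ∀ p ∈ dom E, 0 < σ * p.2 → |p.2| < δ' →
      JetBound (k + 1) (domStar E) p C |p.2|⁻¹ T ∧
      JetBound k (domStar E) p (C * |p.2| ^ (α + γ)) |p.2|⁻¹ (dx T) ∧
      JetBound k (domStar E) p (C * |p.2| ^ (α - 1)) |p.2|⁻¹ (dy T) ∧
      c * |p.2| ^ (α - 1) ≤ |(dy T p).2| := by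
  set U : Set (E × ℝ) := {p | 0 < σ * p.2 ∧ |p.2| < δ} with hU
  have hUo : IsOpen U := (isOpen_lt continuous_const (continuous_const.mul continuous_snd)).inter
    (isOpen_lt (continuous_abs.comp continuous_snd) continuous_const)
  have hUne : ∀ p ∈ U, p.2 ≠ 0 := fun p hp h0 => by
    have := hp.1; rw [h0, mul_zero] at this; exact lt_irrefl _ this
  set S : Set (E × ℝ) := dom E ∩ U with hSdef
  have hS : UniqueDiffOn ℝ S := uniqueDiffOn_dom.inter hUo
  have hcl : S ⊆ closure (interior S) := dom_inter_subset_closure_interior hUo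
  have hSstar : S = domStar E ∩ U := by
    ext p
    constructor
    · rintro ⟨h1, h2⟩; exact ⟨(mem_domStar_iff h1).2 (hUne p h2), h2⟩
    · rintro ⟨h1, h2⟩; exact ⟨domStar_subset_dom E h1, h2⟩
  obtain ⟨xs, Bs, ys, As, φ, ψ, hAs, hφ, hψ, hφb, hψb, hform⟩ := h
  set Φ : E × ℝ → E × ℝ := fun p => (φ p, ψ p) with hΦdef
  have hΦ : ContDiffOn ℝ (k + 1) Φ S := hφ.prodMk hψ
  have hΦb : MixedBound k S γ K Φ := hφb.prodMk hS hφ hψ hψb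
  set ρ : E × ℝ → ℝ := fun p => |p.2| ^ α with hρdef
  set Ψ : E × ℝ → E × ℝ := fun p => (Bs, As) + Φ p with hΨdef
  have hΨ : ContDiffOn ℝ (k + 1) Ψ S := contDiffOn_const.add hΦ
  -- `T` is a constant plus `g = |y| ^ α ((B*, A*) + (φ, ψ))`
  set g : E × ℝ → E × ℝ := fun p => ρ p • Ψ p with hgdef
  have hTg : EqOn T (fun p => (xs, ys) + g p) S := fun p hp => by
    rw [hform p hp]; rfl
  have hpos : ∀ x ∈ S, 0 < σ * x.2 := fun x hx => hx.2.1
  obtain ⟨Cρ, hCρ, hρ⟩ := exists_jetBound_abs_rpow E (k + 1) α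
  obtain ⟨hρc, hρb⟩ := hρ σ S hσ hS hpos
  have hΨd : ∀ p ∈ S, HasFDerivWithinAt Ψ (fderivWithin ℝ Φ S p) S p := fun p hp =>
    ((hΦ.differentiableOn (by simp)) p hp).hasFDerivWithinAt.const_add _
  have hgd : ∀ p ∈ S, HasFDerivWithinAt g (ρ p • fderivWithin ℝ Φ S p +
      ((α * |p.2| ^ (α - 1) * σ) • ContinuousLinearMap.snd ℝ E ℝ).smulRight (Ψ p)) S p :=
    fun p hp => (hasFDerivWithinAt_abs_rpow hσ hpos hp).smul (hΨd p hp)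
  have hDT : ∀ p ∈ S, fderivWithin ℝ T (domStar E) p = ρ p • fderivWithin ℝ Φ S p +
      ((α * |p.2| ^ (α - 1) * σ) • ContinuousLinearMap.snd ℝ E ℝ).smulRight (Ψ p) := fun p hp => by
    have h1 : HasFDerivWithinAt T (ρ p • fderivWithin ℝ Φ S p +
      ((α * |p.2| ^ (α - 1) * σ) • ContinuousLinearMap.snd ℝ E ℝ).smulRight (Ψ p)) S p :=
      ((hgd p hp).const_add (xs, ys)).congr hTg (hTg hp)
    rw [← h1.fderivWithin (hS p hp), hSstar, fderivWithin_inter (hUo.mem_nhds hp.2)]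
  have hdxS : EqOn (dx T) (fun p => ρ p • (fderivWithin ℝ Φ S p).comp
      (ContinuousLinearMap.inl ℝ E ℝ)) S := fun p hp => by
    ext x <;> simp [dx, hDT p hp]
  have hdyS : EqOn (dy T) (fun p => fderivWithin ℝ g S p (0, 1)) S := fun p hp => by
    simp only [dy]
    rw [hDT p hp, (hgd p hp).fderivWithin (hS p hp)]
  set N := ‖(ContinuousLinearMap.lsmul ℝ ℝ : ℝ →L[ℝ] (E × ℝ) →L[ℝ] (E × ℝ))‖
  set N' := ‖(ContinuousLinearMap.lsmul ℝ ℝ : ℝ →L[ℝ] (E →L[ℝ] E × ℝ) →L[ℝ] (E →L[ℝ] E × ℝ))‖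
  set N'' := ‖ContinuousLinearMap.apply ℝ (E × ℝ) ((0, 1) : E × ℝ)‖
  set K₂ := 2 ^ (k + 1) * K with hK₂
  have hK₂0 : 0 < K₂ := by positivity
  set Kg := N * 2 ^ (k + 1) * (Cρ * (‖(Bs, As)‖ + K₂)) with hKg
  have hKg0 : 0 ≤ Kg := by positivity
  set Kx := N' * 2 ^ k * (Cρ * K₂) with hKx
  have hKx0 : 0 ≤ Kx := by positivity
  -- so close to `D₀`, the terms of `∂ᵧG` with `ψ` are at most half of the term with `A*`
  obtain ⟨δ₁, hδ₁, hsmall⟩ : ∃ δ₁ > 0, ∀ r : ℝ, 0 < r → r < δ₁ →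
      (α + 1) * K₂ * r ^ γ ≤ α * |As| / 2 := by
    have hc : Continuous fun r : ℝ => (α + 1) * K₂ * r ^ γ :=
      continuous_const.mul (continuous_id.rpow_const fun _ => Or.inr hγ.le)
    have ht := hc.tendsto 0
    simp only [Real.zero_rpow hγ.ne', mul_zero] at ht
    have hp : 0 < α * |As| / 2 := by have := abs_pos.2 hAs; positivity
    obtain ⟨δ₁, hδ₁, hb⟩ := Metric.eventually_nhds_iff.1 (ht.eventually (gt_mem_nhds hp))
    exact ⟨δ₁, hδ₁, fun r hr0 hr => (hb (by simpa [abs_of_pos hr0] using hr)).le⟩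
  refine ⟨‖(xs, ys)‖ + Kg + Kx + N'' * Kg, α * |As| / 2, min δ δ₁, by positivity,
    by have := abs_pos.2 hAs; positivity, lt_min hδ hδ₁, ?_⟩
  intro p hp hσp hpδ
  have hpU : p ∈ U := ⟨hσp, hpδ.trans_le (min_le_left _ _)⟩
  have hpS : p ∈ S := ⟨hp, hpU⟩
  have hp0 : p.2 ≠ 0 := hUne p hpU
  have hr : 0 < |p.2| := abs_pos.2 hp0
  have hr1 : |p.2| ≤ 1 := hp.2
  have hH : 0 ≤ |p.2|⁻¹ := (inv_pos.2 hr).le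
  have hrγ : |p.2| ^ γ ≤ 1 := Real.rpow_le_one hr.le hr1 hγ.le
  have hrα : |p.2| ^ α ≤ 1 := Real.rpow_le_one hr.le hr1 hα.le
  have hΦj := hΦb.jetBound hS hcl hΦ hK.le hpS hp0 hr1
  have hΦx := hΦb.jetBound_dx hS hcl hΦ hK.le hpS hp0 hr1
  have hΨj : JetBound (k + 1) S p (‖(Bs, As)‖ + K₂) |p.2|⁻¹ Ψ :=
    JetBound.add hS hpS contDiffOn_const (by exact_mod_cast hΦ)
      (JetBound.const _ _ _ _ hH) (hΦj.mono (mul_le_of_le_one_right hK₂0.le hrγ) hH le_rfl)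
  have hgj : JetBound (k + 1) S p (Kg * |p.2| ^ α) |p.2|⁻¹ g := by
    have := JetBound.bilin (ContinuousLinearMap.lsmul ℝ ℝ : ℝ →L[ℝ] (E × ℝ) →L[ℝ] (E × ℝ)) hS hpS hH
      hρc (by exact_mod_cast hΨ) (hρb p hpS) hΨj
    exact this.mono (le_of_eq (by rw [hKg]; ring)) hH le_rfl
  have hDΦc : ContDiffOn ℝ k (fun p => (fderivWithin ℝ Φ S p).comp
      (ContinuousLinearMap.inl ℝ E ℝ)) S :=
    ((ContinuousLinearMap.compL ℝ E (E × ℝ) (E × ℝ)).flip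
      (ContinuousLinearMap.inl ℝ E ℝ)).contDiff.comp_contDiffOn (hΦ.fderivWithin hS le_rfl)
  have hgc : ContDiffOn ℝ (k + 1) g S := by
    have : ContDiffOn ℝ (k + 1) ρ S := by exact_mod_cast hρc
    exact this.smul hΨ
  have hTj : JetBound (k + 1) S p (‖(xs, ys)‖ + Kg) |p.2|⁻¹ T :=
    (JetBound.add hS hpS contDiffOn_const (by exact_mod_cast hgc)
      (JetBound.const _ _ _ _ hH) (hgj.mono (mul_le_of_le_one_right hKg0 hrα) hH le_rfl)).congr
        hpS hTg
  have hxj : JetBound k S p (Kx * |p.2| ^ (α + γ)) |p.2|⁻¹ (dx T) := by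
    have := JetBound.bilin (ContinuousLinearMap.lsmul ℝ ℝ :
      ℝ →L[ℝ] (E →L[ℝ] E × ℝ) →L[ℝ] (E →L[ℝ] E × ℝ)) hS hpS hH
      (hρc.of_le (by exact_mod_cast Nat.le_succ k)) hDΦc ((hρb p hpS).of_le (Nat.le_succ k)) hΦx
    refine (this.congr hpS hdxS).mono (le_of_eq ?_) hH le_rfl
    rw [hKx, Real.rpow_add hr]; ring
  have hyj : JetBound k S p (N'' * Kg * |p.2| ^ (α - 1)) |p.2|⁻¹ (dy T) := by
    have := JetBound.clm (ContinuousLinearMap.apply ℝ (E × ℝ) ((0, 1) : E × ℝ)) hS hpS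
      (hgc.fderivWithin hS le_rfl) (hgj.fderivWithin hS hpS)
    refine (this.congr hpS hdyS).mono (le_of_eq ?_) hH le_rfl
    rw [Real.rpow_sub_one hr.ne']; ring
  have hN0 : 0 ≤ N'' * Kg := by positivity
  have hN1 : 0 ≤ ‖(xs, ys)‖ := norm_nonneg _
  refine ⟨?_, ?_, ?_, ?_⟩
  · rw [hSstar] at hTj
    exact ((jetBound_inter_iff hUo hpU).1 hTj).mono (by linarith) hH le_rfl
  · rw [hSstar] at hxj
    exact ((jetBound_inter_iff hUo hpU).1 hxj).mono
      (mul_le_mul_of_nonneg_right (by linarith) (by positivity)) hH le_rfl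
  · rw [hSstar] at hyj
    exact ((jetBound_inter_iff hUo hpU).1 hyj).mono
      (mul_le_mul_of_nonneg_right (by linarith) (by positivity)) hH le_rfl
  · have h1 : dy T p = ρ p • fderivWithin ℝ Φ S p (0, 1) + (α * |p.2| ^ (α - 1) * σ) • Ψ p := by
      simp only [dy]; rw [hDT p hpS]; simp
    have h2 : (dy T p).2 = |p.2| ^ α * (fderivWithin ℝ Φ S p (0, 1)).2 +
        α * |p.2| ^ (α - 1) * σ * (As + ψ p) := by rw [h1]; simp [hρdef, hΨdef, hΦdef]
    have h3 : |(fderivWithin ℝ Φ S p (0, 1)).2| ≤ K₂ * |p.2| ^ γ * |p.2|⁻¹ := by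
      have e1 := (hΦj.fderivWithin hS hpS).norm_le
      have e2 := (fderivWithin ℝ Φ S p).le_opNorm ((0, 1) : E × ℝ)
      have e3 : ‖((0, 1) : E × ℝ)‖ = 1 := by simp [Prod.norm_def]
      rw [e3, mul_one] at e2
      exact ((norm_snd_le _).trans e2).trans e1
    have h4 : |ψ p| ≤ K₂ * |p.2| ^ γ := (norm_snd_le (Φ p)).trans hΦj.norm_le
    have h5 : |p.2| ^ α = |p.2| ^ (α - 1) * |p.2| := by
      rw [← Real.rpow_add_one hr.ne']; ring_nf
    have h6 := hsmall |p.2| hr (hpδ.trans_le (min_le_right _ _))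
    have h7 : 0 < |p.2| ^ (α - 1) := by positivity
    have h8 : |p.2| ^ α * |(fderivWithin ℝ Φ S p (0, 1)).2| ≤
        |p.2| ^ (α - 1) * (K₂ * |p.2| ^ γ) := by
      rw [h5, mul_assoc]
      refine mul_le_mul_of_nonneg_left ?_ h7.le
      calc |p.2| * |(fderivWithin ℝ Φ S p (0, 1)).2| ≤ |p.2| * (K₂ * |p.2| ^ γ * |p.2|⁻¹) := by
            gcongr
        _ = _ := by field_simp
    have h9 : |α * |p.2| ^ (α - 1) * σ * (As + ψ p)| = |p.2| ^ (α - 1) * (α * |As + ψ p|) := by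
      rw [abs_mul, abs_mul, abs_mul, hσ, abs_of_pos hα, abs_of_pos h7]; ring
    have h10 : |As| - K₂ * |p.2| ^ γ ≤ |As + ψ p| := by
      have := abs_sub_abs_le_abs_sub As (-ψ p)
      rw [abs_neg, sub_neg_eq_add] at this
      linarith
    have h11 : |α * |p.2| ^ (α - 1) * σ * (As + ψ p)| - |p.2| ^ α *
        |(fderivWithin ℝ Φ S p (0, 1)).2| ≤ |(dy T p).2| := by
      have := abs_sub_abs_le_abs_sub (α * |p.2| ^ (α - 1) * σ * (As + ψ p))
        (-(|p.2| ^ α * (fderivWithin ℝ Φ S p (0, 1)).2))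
      rw [abs_neg, sub_neg_eq_add, abs_mul (|p.2| ^ α), abs_of_nonneg (a := |p.2| ^ α)
        (by positivity)] at this
      rw [h2, add_comm (|p.2| ^ α * _)]; exact this
    refine le_trans ?_ h11
    rw [h9]
    have h12 : α * (|As| - K₂ * |p.2| ^ γ) ≤ α * |As + ψ p| :=
      mul_le_mul_of_nonneg_left h10 hα.le
    have h13 : α * |As| / 2 ≤ α * |As + ψ p| - K₂ * |p.2| ^ γ := by linarith
    calc _ ≤ (α * |As + ψ p| - K₂ * |p.2| ^ γ) * |p.2| ^ (α - 1) :=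
          mul_le_mul_of_nonneg_right h13 h7.le
      _ ≤ _ := by linarith

end LocalCoefficients

/-! ### Bounds for `T`, `A`, `B` and `C` on `D*` -/

section GlobalCoefficients

variable {E : Type*} [NormedAddCommGroup E] [NormedSpace ℝ E]

/-- Jet bounds near `D₀` extend to `D*`, since the rest of `D` is compact. -/
theorem exists_jetBound_of_near_zero [FiniteDimensional ℝ E] {X : Type*} [NormedAddCommGroup X]
    [NormedSpace ℝ X] {k : ℕ} {f : E × ℝ → X} {e C δ : ℝ} (he : 0 ≤ e) (hC : 0 ≤ C) (hδ : 0 < δ)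
    (hf : ContDiffOn ℝ k f (domStar E))
    (h : ∀ p ∈ domStar E, |p.2| < δ → JetBound k (domStar E) p (C * |p.2| ^ e) |p.2|⁻¹ f) :
    ∃ C', 0 ≤ C' ∧ ∀ p ∈ domStar E, JetBound k (domStar E) p (C' * |p.2| ^ e) |p.2|⁻¹ f := by
  set Q : Set (E × ℝ) := dom E ∩ {p | δ ≤ |p.2|} with hQ
  have hQc : IsCompact Q :=
    isCompact_dom.inter_right (isClosed_le continuous_const (continuous_abs.comp continuous_snd))
  have hQs : Q ⊆ domStar E := fun p hp => (mem_domStar_iff hp.1).2 fun h0 => by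
    have := hp.2
    simp only [mem_ofPred_eq, h0, abs_zero] at this
    linarith
  have key : ∀ i : ℕ, ∃ M : ℝ, 0 ≤ M ∧ (i ≤ k → ∀ p ∈ Q,
      ‖iteratedFDerivWithin ℝ i f (domStar E) p‖ ≤ M) := by
    intro i
    by_cases hi : i ≤ k
    · have hco := hf.continuousOn_iteratedFDerivWithin (m := i) (by exact_mod_cast hi)
        uniqueDiffOn_domStar
      obtain ⟨M, hM⟩ := hQc.exists_bound_of_continuousOn (hco.mono hQs)
      exact ⟨max M 0, le_max_right _ _, fun _ z hz => (hM z hz).trans (le_max_left _ _)⟩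
    · exact ⟨0, le_rfl, fun h => absurd h hi⟩
  choose M hM0 hM using key
  set Ms := ∑ i ∈ Finset.range (k + 1), M i
  have hMs : ∀ i ≤ k, M i ≤ Ms := fun i hi =>
    Finset.single_le_sum (f := M) (fun j _ => hM0 j) (Finset.mem_range.2 (by omega))
  have hMs0 : 0 ≤ Ms := Finset.sum_nonneg fun j _ => hM0 j
  have hδe : 0 < δ ^ e := by positivity
  refine ⟨C + Ms * (δ ^ e)⁻¹, by positivity, fun p hp => ?_⟩
  have hr : 0 < |p.2| := abs_pos.2 (snd_ne_zero_of_mem_domStar hp)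
  have hinv : 1 ≤ |p.2|⁻¹ := (one_le_inv₀ hr).2 (abs_snd_le_one_of_mem_domStar hp)
  by_cases hpδ : |p.2| < δ
  · refine (h p hp hpδ).mono ?_ (by positivity) le_rfl
    gcongr
    have : 0 ≤ Ms * (δ ^ e)⁻¹ := by positivity
    linarith
  · push Not at hpδ
    intro i hi
    have h1 := (hM i hi p ⟨domStar_subset_dom E hp, hpδ⟩).trans (hMs i hi)
    have h2 : δ ^ e ≤ |p.2| ^ e := Real.rpow_le_rpow hδ.le hpδ he
    have h3 : 1 ≤ |p.2|⁻¹ ^ i := one_le_pow₀ hinv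
    calc _ ≤ Ms := h1
      _ = Ms * (δ ^ e)⁻¹ * δ ^ e * 1 := by field_simp
      _ ≤ (C + Ms * (δ ^ e)⁻¹) * |p.2| ^ e * |p.2|⁻¹ ^ i := by
        gcongr
        linarith

theorem contDiffOn_coefA {k : ℕ} {T : E × ℝ → E × ℝ} (hT : ContDiffOn ℝ (k + 1) T (domStar E))
    (h0 : ∀ p ∈ domStar E, dyG T p ≠ 0) : ContDiffOn ℝ k (coefA T) (domStar E) := by
  have h1 : ContDiffOn ℝ k (dyG T) (domStar E) := (contDiffOn_dy hT).snd
  exact (h1.inv h0).smul ((ContinuousLinearMap.compL ℝ E (E × ℝ) E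
    (ContinuousLinearMap.fst ℝ E ℝ)).contDiff.comp_contDiffOn (contDiffOn_dx hT))

theorem contDiffOn_coefB {k : ℕ} {T : E × ℝ → E × ℝ} (hT : ContDiffOn ℝ (k + 1) T (domStar E))
    (h0 : ∀ p ∈ domStar E, dyG T p ≠ 0) : ContDiffOn ℝ k (coefB T) (domStar E) := by
  have h1 : ContDiffOn ℝ k (dyG T) (domStar E) := (contDiffOn_dy hT).snd
  exact (h1.inv h0).smul (contDiffOn_dy hT).fst

theorem contDiffOn_coefC {k : ℕ} {T : E × ℝ → E × ℝ} (hT : ContDiffOn ℝ (k + 1) T (domStar E))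
    (h0 : ∀ p ∈ domStar E, dyG T p ≠ 0) : ContDiffOn ℝ k (coefC T) (domStar E) := by
  have h1 : ContDiffOn ℝ k (dyG T) (domStar E) := (contDiffOn_dy hT).snd
  exact (h1.inv h0).smul ((ContinuousLinearMap.compL ℝ E (E × ℝ) ℝ
    (ContinuousLinearMap.snd ℝ E ℝ)).contDiff.comp_contDiffOn (contDiffOn_dx hT))

/-- The regularity of `T` and of its coefficients that the graph transform needs: with `r = |y|`,
derivatives of order `i` of `T` and `B` are `O(r ^ (-i))`, those of `A` and `C` are
`O(r ^ (s - i))`, where `s > k`. In particular `A`, `B` and `C` are bounded on `D*`, so that their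
supremum norms are not junk values. -/
structure HasSymbolBounds (k : ℕ) (T : E × ℝ → E × ℝ) (s K : ℝ) : Prop where
  lt : (k : ℝ) < s
  nonneg : 0 ≤ K
  jetT : ∀ p ∈ domStar E, JetBound k (domStar E) p K |p.2|⁻¹ T
  jetA : ∀ p ∈ domStar E, JetBound k (domStar E) p (K * |p.2| ^ s) |p.2|⁻¹ (coefA T)
  jetB : ∀ p ∈ domStar E, JetBound k (domStar E) p K |p.2|⁻¹ (coefB T)
  jetC : ∀ p ∈ domStar E, JetBound k (domStar E) p (K * |p.2| ^ s) |p.2|⁻¹ (coefC T)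

/-- Near one side of `D₀`, dividing by `∂ᵧG` gives the orders `1 + γ` for `A`, `C` and `0` for `B`. -/
theorem HasForm.exists_jetBound_coef {k : ℕ} {T : E × ℝ → E × ℝ} {α γ K δ σ : ℝ} (hσ : |σ| = 1)
    (hα : 0 < α) (hγ : 0 < γ) (hK : 0 < K) (hδ : 0 < δ)
    (hT : ContDiffOn ℝ (k + 1) T (domStar E)) (h0 : ∀ p ∈ domStar E, dyG T p ≠ 0)
    (h : HasForm k T (dom E ∩ {p | 0 < σ * p.2 ∧ |p.2| < δ}) α γ K) :
    ∃ C δ' : ℝ, 0 ≤ C ∧ 0 < δ' ∧ ∀ p ∈ dom E, 0 < σ * p.2 → |p.2| < δ' →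
      JetBound k (domStar E) p C |p.2|⁻¹ T ∧
      JetBound k (domStar E) p (C * |p.2| ^ (1 + γ)) |p.2|⁻¹ (coefA T) ∧
      JetBound k (domStar E) p C |p.2|⁻¹ (coefB T) ∧
      JetBound k (domStar E) p (C * |p.2| ^ (1 + γ)) |p.2|⁻¹ (coefC T) := by
  obtain ⟨C, c, δ', hC, hc, hδ', hb⟩ := h.exists_jetBound hσ hα hγ hK hδ
  obtain ⟨Ci, hCi, hinv⟩ := exists_jetBound_inv k (c := c) (K := C) hc
  have hS : UniqueDiffOn ℝ (domStar E) := uniqueDiffOn_domStar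
  have hdyG : ContDiffOn ℝ k (dyG T) (domStar E) := (contDiffOn_dy hT).snd
  have hdyF : ContDiffOn ℝ k (dyF T) (domStar E) := (contDiffOn_dy hT).fst
  have hdxF : ContDiffOn ℝ k (dxF T) (domStar E) :=
    (ContinuousLinearMap.compL ℝ E (E × ℝ) E
      (ContinuousLinearMap.fst ℝ E ℝ)).contDiff.comp_contDiffOn (contDiffOn_dx hT)
  have hdxG : ContDiffOn ℝ k (dxG T) (domStar E) :=
    (ContinuousLinearMap.compL ℝ E (E × ℝ) ℝ
      (ContinuousLinearMap.snd ℝ E ℝ)).contDiff.comp_contDiffOn (contDiffOn_dx hT)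
  set nf := ‖ContinuousLinearMap.compL ℝ E (E × ℝ) E (ContinuousLinearMap.fst ℝ E ℝ)‖
  set ng := ‖ContinuousLinearMap.compL ℝ E (E × ℝ) ℝ (ContinuousLinearMap.snd ℝ E ℝ)‖
  set NA := ‖(ContinuousLinearMap.lsmul ℝ ℝ : ℝ →L[ℝ] (E →L[ℝ] E) →L[ℝ] (E →L[ℝ] E))‖
  set NB := ‖(ContinuousLinearMap.lsmul ℝ ℝ : ℝ →L[ℝ] E →L[ℝ] E)‖
  set NC := ‖(ContinuousLinearMap.lsmul ℝ ℝ : ℝ →L[ℝ] (E →L[ℝ] ℝ) →L[ℝ] (E →L[ℝ] ℝ))‖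
  set KA := NA * 2 ^ k * (Ci * (nf * C))
  set KB := NB * 2 ^ k * (Ci * C)
  set KC := NC * 2 ^ k * (Ci * (ng * C))
  have hKA : 0 ≤ KA := by positivity
  have hKB : 0 ≤ KB := by positivity
  have hKC : 0 ≤ KC := by positivity
  refine ⟨C + KA + KB + KC, δ', by positivity, hδ', fun p hp hσp hpδ => ?_⟩
  obtain ⟨hTj, hxj, hyj, hlow⟩ := hb p hp hσp hpδ
  have hp0 : p.2 ≠ 0 := fun h => by rw [h, mul_zero] at hσp; exact lt_irrefl _ hσp
  have hps : p ∈ domStar E := (mem_domStar_iff hp).2 hp0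
  have hr : 0 < |p.2| := abs_pos.2 hp0
  have hH : 0 ≤ |p.2|⁻¹ := (inv_pos.2 hr).le
  have hl : 0 < |p.2| ^ (α - 1) := by positivity
  have hyn : 0 ≤ C * |p.2| ^ (α - 1) := by positivity
  have hGj : JetBound k (domStar E) p (C * |p.2| ^ (α - 1)) |p.2|⁻¹ (dyG T) :=
    (hyj.clm (ContinuousLinearMap.snd ℝ E ℝ) hS hps (contDiffOn_dy hT)).mono
      (mul_le_of_le_one_left hyn (ContinuousLinearMap.norm_snd_le ℝ E ℝ)) hH le_rfl
  have hFj : JetBound k (domStar E) p (C * |p.2| ^ (α - 1)) |p.2|⁻¹ (dyF T) :=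
    (hyj.clm (ContinuousLinearMap.fst ℝ E ℝ) hS hps (contDiffOn_dy hT)).mono
      (mul_le_of_le_one_left hyn (ContinuousLinearMap.norm_fst_le ℝ E ℝ)) hH le_rfl
  have hxF : JetBound k (domStar E) p (nf * (C * |p.2| ^ (α + γ))) |p.2|⁻¹ (dxF T) :=
    hxj.clm (ContinuousLinearMap.compL ℝ E (E × ℝ) E (ContinuousLinearMap.fst ℝ E ℝ)) hS hps
      (contDiffOn_dx hT)
  have hxG : JetBound k (domStar E) p (ng * (C * |p.2| ^ (α + γ))) |p.2|⁻¹ (dxG T) :=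
    hxj.clm (ContinuousLinearMap.compL ℝ E (E × ℝ) ℝ (ContinuousLinearMap.snd ℝ E ℝ)) hS hps
      (contDiffOn_dx hT)
  have hI := hinv (domStar E) p _ _ (dyG T) hS hps hl hH hdyG h0 hlow hGj
  have hIc : ContDiffOn ℝ k (fun x => (dyG T x)⁻¹) (domStar E) := hdyG.inv h0
  -- the exponent `α - 1` of `∂ᵧG` cancels
  have hexp : |p.2| ^ (α + γ) = |p.2| ^ (α - 1) * |p.2| ^ (1 + γ) := by
    rw [← Real.rpow_add hr]; ring_nf
  refine ⟨(hTj.of_le (Nat.le_succ k)).mono (by linarith) hH le_rfl, ?_, ?_, ?_⟩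
  · refine (JetBound.bilin (ContinuousLinearMap.lsmul ℝ ℝ :
      ℝ →L[ℝ] (E →L[ℝ] E) →L[ℝ] (E →L[ℝ] E)) hS hps hH hIc hdxF hI hxF).mono ?_ hH le_rfl
    calc _ = KA * |p.2| ^ (1 + γ) := by rw [hexp]; field_simp; simp only [KA]; ring
      _ ≤ _ := mul_le_mul_of_nonneg_right (by linarith) (by positivity)
  · refine (JetBound.bilin (ContinuousLinearMap.lsmul ℝ ℝ :
      ℝ →L[ℝ] E →L[ℝ] E) hS hps hH hIc hdyF hI hFj).mono ?_ hH le_rfl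
    calc _ = KB := by field_simp; simp only [KB]; ring
      _ ≤ _ := by linarith
  · refine (JetBound.bilin (ContinuousLinearMap.lsmul ℝ ℝ :
      ℝ →L[ℝ] (E →L[ℝ] ℝ) →L[ℝ] (E →L[ℝ] ℝ)) hS hps hH hIc hdxG hI hxG).mono ?_ hH le_rfl
    calc _ = KC * |p.2| ^ (1 + γ) := by rw [hexp]; field_simp; simp only [KC]; ring
      _ ≤ _ := mul_le_mul_of_nonneg_right (by linarith) (by positivity)

theorem IsLorenzMap.exists_hasSymbolBounds [FiniteDimensional ℝ E] {k : ℕ} (hk : 1 ≤ k)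
    {T : E × ℝ → E × ℝ} (hT : IsLorenzMap k T) : ∃ s K, HasSymbolBounds k T s K := by
  obtain ⟨α, γ, K, δ, hα, hγ, hK, hδ, hpos, hneg⟩ := hT.form
  have hγ0 : 0 < γ := by
    have : (1 : ℝ) ≤ k := by exact_mod_cast hk
    linarith
  have hset : ∀ p : E × ℝ, p ∈ domPos E ∧ |p.2| < δ ↔
      p ∈ dom E ∩ {p : E × ℝ | 0 < (1 : ℝ) * p.2 ∧ |p.2| < δ} := fun p => by
    simp [domPos, and_assoc]
  have hset' : ∀ p : E × ℝ, p ∈ domNeg E ∧ |p.2| < δ ↔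
      p ∈ dom E ∩ {p : E × ℝ | 0 < (-1 : ℝ) * p.2 ∧ |p.2| < δ} := fun p => by
    simp [domNeg, and_assoc]
  rw [show {p : E × ℝ | p ∈ domPos E ∧ |p.2| < δ} = _ from Set.ext hset] at hpos
  rw [show {p : E × ℝ | p ∈ domNeg E ∧ |p.2| < δ} = _ from Set.ext hset'] at hneg
  obtain ⟨C₁, δ₁, hC₁, hδ₁, h₁⟩ := hpos.exists_jetBound_coef (σ := 1) (by simp) hα hγ0 hK hδ
    hT.contDiffOn hT.dyG_ne_zero
  obtain ⟨C₂, δ₂, hC₂, hδ₂, h₂⟩ := hneg.exists_jetBound_coef (σ := -1) (by simp) hα hγ0 hK hδ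
    hT.contDiffOn hT.dyG_ne_zero
  set C := C₁ + C₂
  have hC : 0 ≤ C := by positivity
  have hδm : 0 < min δ₁ δ₂ := lt_min hδ₁ hδ₂
  have hnear : ∀ p ∈ domStar E, |p.2| < min δ₁ δ₂ →
      JetBound k (domStar E) p C |p.2|⁻¹ T ∧
      JetBound k (domStar E) p (C * |p.2| ^ (1 + γ)) |p.2|⁻¹ (coefA T) ∧
      JetBound k (domStar E) p C |p.2|⁻¹ (coefB T) ∧
      JetBound k (domStar E) p (C * |p.2| ^ (1 + γ)) |p.2|⁻¹ (coefC T) := by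
    intro p hp hpδ
    have hH : 0 ≤ |p.2|⁻¹ := by positivity
    have hr : 0 ≤ |p.2| ^ (1 + γ) := by positivity
    have hle₁ : C₁ ≤ C := le_add_of_nonneg_right hC₂
    have hle₂ : C₂ ≤ C := le_add_of_nonneg_left hC₁
    have hle₁' := mul_le_mul_of_nonneg_right hle₁ hr
    have hle₂' := mul_le_mul_of_nonneg_right hle₂ hr
    rcases lt_or_gt_of_ne (snd_ne_zero_of_mem_domStar hp) with hn | hn
    · obtain ⟨a, b, c, d⟩ := h₂ p (domStar_subset_dom E hp) (by linarith)
        (hpδ.trans_le (min_le_right _ _))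
      exact ⟨a.mono hle₂ hH le_rfl, b.mono hle₂' hH le_rfl, c.mono hle₂ hH le_rfl,
        d.mono hle₂' hH le_rfl⟩
    · obtain ⟨a, b, c, d⟩ := h₁ p (domStar_subset_dom E hp) (by linarith)
        (hpδ.trans_le (min_le_left _ _))
      exact ⟨a.mono hle₁ hH le_rfl, b.mono hle₁' hH le_rfl, c.mono hle₁ hH le_rfl,
        d.mono hle₁' hH le_rfl⟩
  have hTk : ContDiffOn ℝ k T (domStar E) := hT.contDiffOn.of_le (by exact_mod_cast Nat.le_succ k)
  obtain ⟨KT, hKT, hT'⟩ := exists_jetBound_of_near_zero le_rfl hC hδm hTk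
    fun p hp hpδ => by simpa using (hnear p hp hpδ).1
  obtain ⟨KA, hKA, hA'⟩ := exists_jetBound_of_near_zero (e := 1 + γ) (by positivity) hC hδm
    (contDiffOn_coefA hT.contDiffOn hT.dyG_ne_zero) fun p hp hpδ => (hnear p hp hpδ).2.1
  obtain ⟨KB, hKB, hB'⟩ := exists_jetBound_of_near_zero le_rfl hC hδm
    (contDiffOn_coefB hT.contDiffOn hT.dyG_ne_zero)
    fun p hp hpδ => by simpa using (hnear p hp hpδ).2.2.1
  obtain ⟨KC, hKC, hC'⟩ := exists_jetBound_of_near_zero (e := 1 + γ) (by positivity) hC hδm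
    (contDiffOn_coefC hT.contDiffOn hT.dyG_ne_zero) fun p hp hpδ => (hnear p hp hpδ).2.2.2
  simp only [Real.rpow_zero, mul_one] at hT' hB'
  refine ⟨1 + γ, KT + KA + KB + KC, by linarith, by positivity, fun p hp => ?_, fun p hp => ?_,
    fun p hp => ?_, fun p hp => ?_⟩
  · exact (hT' p hp).mono (by linarith) (by positivity) le_rfl
  · exact (hA' p hp).mono (mul_le_mul_of_nonneg_right (by linarith) (by positivity))
      (by positivity) le_rfl
  · exact (hB' p hp).mono (by linarith) (by positivity) le_rfl
  · exact (hC' p hp).mono (mul_le_mul_of_nonneg_right (by linarith) (by positivity))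
      (by positivity) le_rfl

end GlobalCoefficients

/-! ### The contraction constants -/

section Constants

theorem norm_le_supNorm {E X : Type*} [NormedAddCommGroup E] [NormedAddCommGroup X] {f : E × ℝ → X}
    (h : BddAbove ((fun p => ‖f p‖) '' domStar E)) {p : E × ℝ} (hp : p ∈ domStar E) :
    ‖f p‖ ≤ supNorm f :=
  le_csSup h ⟨p, hp, rfl⟩

variable {E : Type*} [NormedAddCommGroup E] [NormedSpace ℝ E]

/-- The contraction rate of the graph transform in the uniform norm. -/
noncomputable def rate (T : E × ℝ → E × ℝ) : ℝ :=
  (supNorm (coefA T) + boundL T * supNorm (coefB T)) / (1 - boundL T * supNorm (coefB T))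

/-- A bound for `‖DT‖` on `D*`, for the maximum norm on `E × ℝ`. -/
noncomputable def derivBound (T : E × ℝ → E × ℝ) : ℝ :=
  supNorm (dyG T) * max (supNorm (coefA T) + supNorm (coefB T)) (supNorm (coefC T) + 1)

variable {k : ℕ} {T : E × ℝ → E × ℝ}

namespace HasSymbolBounds

variable {s K : ℝ} (h : HasSymbolBounds k T s K) {p : E × ℝ}
include h

theorem pos : 0 < s := (Nat.cast_nonneg k).trans_lt h.lt

theorem mul_rpow_le (hp : p ∈ domStar E) : K * |p.2| ^ s ≤ K :=
  mul_le_of_le_one_right h.nonneg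
    (Real.rpow_le_one (abs_nonneg _) (abs_snd_le_one_of_mem_domStar hp) h.pos.le)

theorem norm_coefA_le (hp : p ∈ domStar E) : ‖coefA T p‖ ≤ supNorm (coefA T) := by
  refine norm_le_supNorm ⟨K, ?_⟩ hp
  rintro _ ⟨x, hx, rfl⟩
  exact (h.jetA x hx).norm_le.trans (h.mul_rpow_le hx)

theorem norm_coefB_le (hp : p ∈ domStar E) : ‖coefB T p‖ ≤ supNorm (coefB T) := by
  refine norm_le_supNorm ⟨K, ?_⟩ hp
  rintro _ ⟨x, hx, rfl⟩
  exact (h.jetB x hx).norm_le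

theorem norm_coefC_le (hp : p ∈ domStar E) : ‖coefC T p‖ ≤ supNorm (coefC T) := by
  refine norm_le_supNorm ⟨K, ?_⟩ hp
  rintro _ ⟨x, hx, rfl⟩
  exact (h.jetC x hx).norm_le.trans (h.mul_rpow_le hx)

end HasSymbolBounds

namespace IsLorenzMap

variable (hT : IsLorenzMap k T)
include hT

theorem disc_sq : disc T ^ 2 =
    (1 - supNorm (coefA T)) ^ 2 - 4 * supNorm (coefB T) * supNorm (coefC T) := by
  have hb := supNorm_nonneg (coefB T)
  have hc := supNorm_nonneg (coefC T)
  have hs := Real.sqrt_nonneg (supNorm (coefB T) * supNorm (coefC T))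
  have hs2 := Real.sq_sqrt (mul_nonneg hb hc)
  have hdom := hT.dominated
  apply Real.sq_sqrt
  nlinarith

theorem disc_pos : 0 < disc T := by
  have hb := supNorm_nonneg (coefB T)
  have hc := supNorm_nonneg (coefC T)
  have hs := Real.sqrt_nonneg (supNorm (coefB T) * supNorm (coefC T))
  have hs2 := Real.sq_sqrt (mul_nonneg hb hc)
  have hdom := hT.dominated
  apply Real.sqrt_pos.2
  nlinarith

theorem supNorm_coefA_lt : supNorm (coefA T) < 1 := by
  have hs := Real.sqrt_nonneg (supNorm (coefB T) * supNorm (coefC T))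
  linarith [hT.dominated]

theorem boundL_nonneg : 0 ≤ boundL T := by
  have := hT.disc_pos
  have := hT.supNorm_coefA_lt
  exact div_nonneg (mul_nonneg zero_le_two (supNorm_nonneg _)) (by linarith)

theorem two_mul_boundL_mul : 2 * (boundL T * supNorm (coefB T)) =
    1 - supNorm (coefA T) - disc T := by
  have h1 := hT.disc_pos
  have h2 := hT.supNorm_coefA_lt
  have h3 := hT.disc_sq
  have hne : 1 - supNorm (coefA T) + disc T ≠ 0 := by linarith
  unfold boundL
  field_simp
  linarith

/-- `L` is a root of the quadratic equation that makes the ball of radius `L` invariant. -/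
theorem boundL_mul_add : boundL T * supNorm (coefA T) + supNorm (coefC T) =
    boundL T * (1 - boundL T * supNorm (coefB T)) := by
  have h1 := hT.disc_pos
  have h2 := hT.supNorm_coefA_lt
  have hL : boundL T * (1 - supNorm (coefA T) + disc T) = 2 * supNorm (coefC T) := by
    have hne : 1 - supNorm (coefA T) + disc T ≠ 0 := by linarith
    unfold boundL
    field_simp
  linear_combination (-1 / 2) * hL + (1 / 2) * boundL T * hT.two_mul_boundL_mul

theorem half_lt_one_sub : 1 / 2 < 1 - boundL T * supNorm (coefB T) := by
  linarith [hT.two_mul_boundL_mul, hT.disc_pos, supNorm_nonneg (coefA T)]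

theorem rate_nonneg : 0 ≤ rate T := by
  have := supNorm_nonneg (coefA T)
  have := mul_nonneg hT.boundL_nonneg (supNorm_nonneg (coefB T))
  have := hT.half_lt_one_sub
  exact div_nonneg (by linarith) (by linarith)

theorem rate_lt_one : rate T < 1 := by
  have := hT.half_lt_one_sub
  rw [rate, div_lt_one (by linarith)]
  linarith [hT.two_mul_boundL_mul, hT.disc_pos]

/-- The rate in the form in which it occurs in `theta`. -/
theorem rate_eq : rate T = 4 * (supNorm (coefA T) + supNorm (coefC T) * supNorm (coefB T)) /
    (1 + supNorm (coefA T) + disc T) ^ 2 := by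
  have h1 := hT.half_lt_one_sub
  have h2 := hT.boundL_mul_add
  have h3 : 1 + supNorm (coefA T) + disc T = 2 * (1 - boundL T * supNorm (coefB T)) := by
    linarith [hT.two_mul_boundL_mul]
  have hne : 1 - boundL T * supNorm (coefB T) ≠ 0 := by linarith
  rw [h3, rate, div_eq_div_iff hne (by positivity)]
  linear_combination (-4 * (1 - boundL T * supNorm (coefB T)) * supNorm (coefB T)) * h2

theorem norm_dyG_le {p : E × ℝ} (hp : p ∈ domStar E) : ‖dyG T p‖ ≤ supNorm (dyG T) :=
  norm_le_supNorm hT.dyG_bdd hp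

theorem supNorm_dyG_pos : 0 < supNorm (dyG T) := by
  have h1 : ((0, 1) : E × ℝ) ∈ domStar E := Or.inr ⟨by simp [dom], by simp⟩
  exact (norm_pos_iff.2 (hT.dyG_ne_zero _ h1)).trans_le (hT.norm_dyG_le h1)

theorem derivBound_nonneg : 0 ≤ derivBound T :=
  mul_nonneg hT.supNorm_dyG_pos.le (le_max_of_le_right (by linarith [supNorm_nonneg (coefC T)]))

theorem rate_mul_derivBound_pow_le_theta (i : ℕ) : rate T * derivBound T ^ i ≤ theta T i := by
  have ha := supNorm_nonneg (coefA T)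
  have hb := supNorm_nonneg (coefB T)
  have hc := supNorm_nonneg (coefC T)
  have hd := hT.supNorm_dyG_pos
  have hD := hT.disc_pos
  have hmax : max (supNorm (coefA T) + supNorm (coefB T)) (supNorm (coefC T) + 1) ^ i ≤
      maxProd T i := by
    unfold maxProd
    rcases le_total (supNorm (coefA T) + supNorm (coefB T)) (supNorm (coefC T) + 1) with h | h
    · rw [max_eq_right h]
      have := Finset.le_sup' (s := Finset.HasAntidiagonal.antidiagonal i) (fun q : ℕ × ℕ =>
        (supNorm (coefA T) + supNorm (coefB T)) ^ q.1 * (supNorm (coefC T) + 1) ^ q.2)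
        (b := (0, i)) (by simp)
      simpa using this
    · rw [max_eq_left h]
      have := Finset.le_sup' (s := Finset.HasAntidiagonal.antidiagonal i) (fun q : ℕ × ℕ =>
        (supNorm (coefA T) + supNorm (coefB T)) ^ q.1 * (supNorm (coefC T) + 1) ^ q.2)
        (b := (i, 0)) (by simp)
      simpa using this
  have hmax0 : 0 ≤ maxProd T i := le_trans (by positivity) hmax
  have hfac : (1 : ℝ) ≤ (i.factorial : ℝ) := by exact_mod_cast i.factorial_pos
  have hfac2 : (4 : ℝ) ≤ (2 * (i.factorial : ℝ)) ^ 2 := by nlinarith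
  rw [hT.rate_eq, derivBound, theta, mul_pow]
  have hpos : 0 < 1 + supNorm (coefA T) + disc T := by linarith
  calc _ = 4 * (supNorm (coefA T) + supNorm (coefC T) * supNorm (coefB T)) *
        max (supNorm (coefA T) + supNorm (coefB T)) (supNorm (coefC T) + 1) ^ i /
        ((supNorm (dyG T))⁻¹ ^ i * (1 + supNorm (coefA T) + disc T) ^ 2) := by
        rw [inv_pow]
        field_simp
    _ ≤ _ := by gcongr

/-- The derivative of order `j` of the graph transform contracts at rate `rate T * ‖DT‖ ^ j`. The
conditions at `1` and `k` suffice for the intermediate orders because a power of a fixed number is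
monotone in the exponent. -/
theorem rate_mul_derivBound_pow_lt_one {j : ℕ} (hj1 : 1 ≤ j) (hjk : j ≤ k) :
    rate T * derivBound T ^ j < 1 := by
  have hq := hT.rate_nonneg
  have hM := hT.derivBound_nonneg
  rcases le_total (derivBound T) 1 with h | h
  · have h1 : derivBound T ^ j ≤ derivBound T ^ 1 := pow_le_pow_of_le_one hM h hj1
    exact (mul_le_mul_of_nonneg_left h1 hq).trans_lt
      ((hT.rate_mul_derivBound_pow_le_theta 1).trans_lt hT.theta_one)
  · have h1 : derivBound T ^ j ≤ derivBound T ^ k := pow_le_pow_right₀ h hjk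
    refine (mul_le_mul_of_nonneg_left h1 hq).trans_lt
      ((hT.rate_mul_derivBound_pow_le_theta k).trans_lt ?_)
    rcases Nat.lt_or_ge k 2 with hk | hk
    · obtain rfl : k = 1 := by omega
      exact hT.theta_one
    · exact hT.theta_k hk

/-- `DT (x, y) = ∂ᵧG · (A x + y B, C x + y)`, so that `derivBound T` bounds `‖DT‖`. -/
theorem norm_fderivWithin_le {s K : ℝ} (h : HasSymbolBounds k T s K) {p : E × ℝ}
    (hp : p ∈ domStar E) : ‖fderivWithin ℝ T (domStar E) p‖ ≤ derivBound T := by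
  refine ContinuousLinearMap.opNorm_le_bound _ hT.derivBound_nonneg fun v => ?_
  have h0 := hT.dyG_ne_zero p hp
  have hd := hT.norm_dyG_le hp
  have hA := h.norm_coefA_le hp
  have hB := h.norm_coefB_le hp
  have hC := h.norm_coefC_le hp
  have hv1 : ‖v.1‖ ≤ ‖v‖ := norm_fst_le v
  have hv2 : |v.2| ≤ ‖v‖ := norm_snd_le v
  have ha0 := supNorm_nonneg (coefA T)
  have hb0 := supNorm_nonneg (coefB T)
  have hc0 := supNorm_nonneg (coefC T)
  have hd0 := hT.supNorm_dyG_pos.le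
  have hsplit : fderivWithin ℝ T (domStar E) p v = fderivWithin ℝ T (domStar E) p (v.1, 0) +
      v.2 • fderivWithin ℝ T (domStar E) p (0, 1) := by
    rw [← map_smul, ← map_add]; simp
  have h1 : (fderivWithin ℝ T (domStar E) p v).1 =
      dyG T p • (coefA T p v.1 + v.2 • coefB T p) := by
    rw [hsplit]
    simp [coefA, coefB, dxF, dyF, smul_smul, h0, mul_left_comm (dyG T p)]
  have h2 : (fderivWithin ℝ T (domStar E) p v).2 = dyG T p * (coefC T p v.1 + v.2) := by
    rw [hsplit]
    have : dyG T p = (fderivWithin ℝ T (domStar E) p (0, 1)).2 := rfl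
    simp [coefC, dxG, ← this, mul_add, h0, mul_comm]
  rw [Prod.norm_def]
  refine max_le ?_ ?_
  · rw [h1, norm_smul, derivBound, mul_assoc]
    refine mul_le_mul hd ?_ (norm_nonneg _) hd0
    calc _ ≤ ‖coefA T p‖ * ‖v.1‖ + |v.2| * ‖coefB T p‖ := by
          refine (norm_add_le _ _).trans (add_le_add ((coefA T p).le_opNorm _) ?_)
          rw [norm_smul, Real.norm_eq_abs]
      _ ≤ supNorm (coefA T) * ‖v‖ + ‖v‖ * supNorm (coefB T) := by gcongr
      _ = (supNorm (coefA T) + supNorm (coefB T)) * ‖v‖ := by ring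
      _ ≤ _ := by gcongr; exact le_max_left _ _
  · rw [h2, norm_mul, derivBound, mul_assoc]
    refine mul_le_mul hd ?_ (norm_nonneg _) hd0
    calc _ ≤ ‖coefC T p‖ * ‖v.1‖ + |v.2| :=
          (norm_add_le _ _).trans (add_le_add ((coefC T p).le_opNorm _) le_rfl)
      _ ≤ supNorm (coefC T) * ‖v‖ + ‖v‖ := by gcongr
      _ = (supNorm (coefC T) + 1) * ‖v‖ := by ring
      _ ≤ _ := by gcongr; exact le_max_right _ _

end IsLorenzMap

end Constants

/-! ### The graph transform in the uniform norm -/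

section Transform

universe u

variable {E : Type u} [NormedAddCommGroup E] [NormedSpace ℝ E] {k : ℕ} {T : E × ℝ → E × ℝ}

theorem graphTransform_of_mem_domStar (ν : E × ℝ → E →L[ℝ] ℝ) {p : E × ℝ} (hp : p ∈ domStar E) :
    graphTransform T ν p =
      (1 - ν (T p) (coefB T p))⁻¹ • ((ν (T p)).comp (coefA T p) - coefC T p) :=
  if_neg (snd_ne_zero_of_mem_domStar hp)

/-- The linear operator through which the difference of two graph transforms depends on the
difference of the arguments, see `graphTransform_sub`. -/
noncomputable def slope (T : E × ℝ → E × ℝ) (μ ν : E × ℝ → E →L[ℝ] ℝ) (p : E × ℝ) :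
    (E →L[ℝ] ℝ) →L[ℝ] (E →L[ℝ] ℝ) :=
  (1 - μ (T p) (coefB T p))⁻¹ •
    ((ContinuousLinearMap.compL ℝ E E ℝ).flip (coefA T p) +
      ContinuousLinearMap.smulRightL ℝ (E →L[ℝ] ℝ) (E →L[ℝ] ℝ)
        (ContinuousLinearMap.apply ℝ ℝ (coefB T p)) (graphTransform T ν p))

theorem slope_apply (μ ν : E × ℝ → E →L[ℝ] ℝ) (p : E × ℝ) (w : E →L[ℝ] ℝ) :
    slope T μ ν p w = (1 - μ (T p) (coefB T p))⁻¹ •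
      (w.comp (coefA T p) + w (coefB T p) • graphTransform T ν p) := by
  simp [slope]

/-- The graph transform is fractional linear in `ν`, so its differences are exactly linear in the
difference of the arguments. -/
theorem graphTransform_sub {μ ν : E × ℝ → E →L[ℝ] ℝ} {p : E × ℝ} (hp : p ∈ domStar E)
    (hμ : 1 - μ (T p) (coefB T p) ≠ 0) (hν : 1 - ν (T p) (coefB T p) ≠ 0) :
    graphTransform T μ p - graphTransform T ν p = slope T μ ν p (μ (T p) - ν (T p)) := by
  rw [slope_apply, graphTransform_of_mem_domStar μ hp, graphTransform_of_mem_domStar ν hp]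
  ext e
  simp only [_root_.sub_apply, _root_.smul_apply,
    _root_.add_apply, ContinuousLinearMap.comp_apply, smul_eq_mul]
  field_simp
  ring

namespace IsLorenzMap

variable (hT : IsLorenzMap k T) {s K : ℝ} (h : HasSymbolBounds k T s K)
include hT

include h in
theorem norm_apply_coefB_le {x : E →L[ℝ] ℝ} (hx : ‖x‖ ≤ boundL T) {p : E × ℝ}
    (hp : p ∈ domStar E) : |x (coefB T p)| ≤ boundL T * supNorm (coefB T) :=
  (x.le_opNorm _).trans (mul_le_mul hx (h.norm_coefB_le hp) (norm_nonneg _) hT.boundL_nonneg)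

include h in
theorem one_sub_le {ν : E × ℝ → E →L[ℝ] ℝ} (hν : ∀ p ∈ dom E, ‖ν p‖ ≤ boundL T) {p : E × ℝ}
    (hp : p ∈ domStar E) :
    1 - boundL T * supNorm (coefB T) ≤ 1 - ν (T p) (coefB T p) := by
  have := hT.norm_apply_coefB_le h (hν _ (hT.mapsTo hp)) hp
  linarith [le_abs_self (ν (T p) (coefB T p))]

include h in
theorem half_le_one_sub {ν : E × ℝ → E →L[ℝ] ℝ} (hν : ∀ p ∈ dom E, ‖ν p‖ ≤ boundL T) {p : E × ℝ}
    (hp : p ∈ domStar E) : 1 / 2 ≤ 1 - ν (T p) (coefB T p) :=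
  hT.half_lt_one_sub.le.trans (hT.one_sub_le h hν hp)

include h in
theorem one_sub_ne_zero {ν : E × ℝ → E →L[ℝ] ℝ} (hν : ∀ p ∈ dom E, ‖ν p‖ ≤ boundL T) {p : E × ℝ}
    (hp : p ∈ domStar E) : 1 - ν (T p) (coefB T p) ≠ 0 := by
  have := hT.half_le_one_sub h hν hp
  intro h0
  rw [h0] at this
  norm_num at this

include h in
theorem abs_inv_one_sub_le {ν : E × ℝ → E →L[ℝ] ℝ} (hν : ∀ p ∈ dom E, ‖ν p‖ ≤ boundL T)
    {p : E × ℝ} (hp : p ∈ domStar E) :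
    ‖(1 - ν (T p) (coefB T p))⁻¹‖ ≤ (1 - boundL T * supNorm (coefB T))⁻¹ := by
  have h1 := hT.half_lt_one_sub
  have h2 := hT.one_sub_le h hν hp
  rw [norm_inv, Real.norm_of_nonneg (by linarith)]
  exact inv_anti₀ (by linarith) h2

include h in
theorem norm_graphTransform_le {ν : E × ℝ → E →L[ℝ] ℝ} (hν : ∀ p ∈ dom E, ‖ν p‖ ≤ boundL T)
    {p : E × ℝ} (hp : p ∈ dom E) : ‖graphTransform T ν p‖ ≤ boundL T := by
  by_cases h0 : p.2 = 0
  · rw [graphTransform, if_pos h0, norm_zero]; exact hT.boundL_nonneg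
  · have hps := (mem_domStar_iff hp).2 h0
    have h1 := hT.half_lt_one_sub
    have h2 := hT.boundL_mul_add
    rw [graphTransform_of_mem_domStar ν hps, norm_smul]
    calc _ ≤ (1 - boundL T * supNorm (coefB T))⁻¹ *
          (boundL T * supNorm (coefA T) + supNorm (coefC T)) := by
          refine mul_le_mul (hT.abs_inv_one_sub_le h hν hps) ?_ (norm_nonneg _)
            (inv_nonneg.2 (by linarith))
          refine (norm_sub_le _ _).trans (add_le_add ?_ (h.norm_coefC_le hps))
          exact (ContinuousLinearMap.opNorm_comp_le _ _).trans
            (mul_le_mul (hν _ (hT.mapsTo hps)) (h.norm_coefA_le hps) (norm_nonneg _)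
              hT.boundL_nonneg)
      _ = boundL T := by
          rw [h2]; field_simp [show 1 - boundL T * supNorm (coefB T) ≠ 0 by linarith]

include h in
theorem norm_slope_le {μ ν : E × ℝ → E →L[ℝ] ℝ} (hμ : ∀ p ∈ dom E, ‖μ p‖ ≤ boundL T)
    (hν : ∀ p ∈ dom E, ‖ν p‖ ≤ boundL T) {p : E × ℝ} (hp : p ∈ domStar E) :
    ‖slope T μ ν p‖ ≤ rate T := by
  refine ContinuousLinearMap.opNorm_le_bound _ hT.rate_nonneg fun w => ?_
  have h1 := hT.half_lt_one_sub
  have hL := hT.boundL_nonneg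
  rw [slope_apply, norm_smul]
  calc _ ≤ (1 - boundL T * supNorm (coefB T))⁻¹ *
        (‖w‖ * supNorm (coefA T) + ‖w‖ * supNorm (coefB T) * boundL T) := by
        refine mul_le_mul (hT.abs_inv_one_sub_le h hμ hp) ?_ (norm_nonneg _)
          (inv_nonneg.2 (by linarith))
        refine (norm_add_le _ _).trans (add_le_add ?_ ?_)
        · exact (ContinuousLinearMap.opNorm_comp_le _ _).trans
            (mul_le_mul_of_nonneg_left (h.norm_coefA_le hp) (norm_nonneg _))
        · rw [norm_smul]
          refine mul_le_mul ?_ (hT.norm_graphTransform_le h hν (domStar_subset_dom E hp))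
            (norm_nonneg _) (mul_nonneg (norm_nonneg _) (supNorm_nonneg _))
          exact (w.le_opNorm _).trans
            (mul_le_mul_of_nonneg_left (h.norm_coefB_le hp) (norm_nonneg _))
    _ = rate T * ‖w‖ := by rw [rate]; ring

/-- The graph transform contracts the uniform distance. -/
theorem norm_graphTransform_sub_le (h : HasSymbolBounds k T s K) {μ ν : E × ℝ → E →L[ℝ] ℝ}
    (hμ : ∀ p ∈ dom E, ‖μ p‖ ≤ boundL T) (hν : ∀ p ∈ dom E, ‖ν p‖ ≤ boundL T) {d : ℝ}
    (hd : ∀ p ∈ dom E, ‖μ p - ν p‖ ≤ d) {p : E × ℝ} (hp : p ∈ dom E) :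
    ‖graphTransform T μ p - graphTransform T ν p‖ ≤ rate T * d := by
  have hd0 : 0 ≤ d := (norm_nonneg _).trans (hd p hp)
  by_cases h0 : p.2 = 0
  · simp only [graphTransform, if_pos h0, sub_zero, norm_zero]
    exact mul_nonneg hT.rate_nonneg hd0
  · have hps := (mem_domStar_iff hp).2 h0
    rw [graphTransform_sub hps (hT.one_sub_ne_zero h hμ hps) (hT.one_sub_ne_zero h hν hps)]
    exact ((slope T μ ν p).le_opNorm _).trans (mul_le_mul (hT.norm_slope_le h hμ hν hps)
      (hd _ (hT.mapsTo hps)) (norm_nonneg _) hT.rate_nonneg)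

theorem mapsTo_graphTransform (hk : HasSymbolBounds k T s K) :
    MapsTo (graphTransform T) (classA E (boundL T)) (classA E (boundL T)) := by
  intro ν hν
  refine ⟨?_, fun p hp => hT.norm_graphTransform_le hk hν.2.1 hp, fun p hp => if_pos hp.2⟩
  have hAc := (contDiffOn_coefA hT.contDiffOn hT.dyG_ne_zero).continuousOn
  have hBc := (contDiffOn_coefB hT.contDiffOn hT.dyG_ne_zero).continuousOn
  have hCc := (contDiffOn_coefC hT.contDiffOn hT.dyG_ne_zero).continuousOn
  have huc : ContinuousOn (fun p => ν (T p)) (domStar E) :=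
    hν.1.comp hT.contDiffOn.continuousOn hT.mapsTo
  have hcs : ContinuousOn (graphTransform T ν) (domStar E) := by
    have h1 : ContinuousOn (fun p => (1 - ν (T p) (coefB T p))⁻¹ •
        ((ν (T p)).comp (coefA T p) - coefC T p)) (domStar E) :=
      ((continuousOn_const.sub (huc.clm_apply hBc)).inv₀
        fun p hp => hT.one_sub_ne_zero hk hν.2.1 hp).smul ((huc.clm_comp hAc).sub hCc)
    exact h1.congr fun p hp => graphTransform_of_mem_domStar ν hp
  -- continuity at `D₀`: the numerator is `O(|y| ^ s)`
  intro p hp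
  by_cases h0 : p.2 = 0
  · have hz : graphTransform T ν p = 0 := if_pos h0
    rw [ContinuousWithinAt, hz]
    have hc : Continuous fun y : E × ℝ =>
        (1 - boundL T * supNorm (coefB T))⁻¹ * ((boundL T + 1) * (K * |y.2| ^ s)) :=
      continuous_const.mul (continuous_const.mul (continuous_const.mul
        ((continuous_abs.comp continuous_snd).rpow_const fun _ => Or.inr hk.pos.le)))
    have ht := (hc.tendsto p).mono_left (nhdsWithin_le_nhds (s := dom E))
    simp only [h0, abs_zero, Real.zero_rpow hk.pos.ne', mul_zero] at ht
    refine squeeze_zero_norm' ?_ ht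
    filter_upwards [self_mem_nhdsWithin] with y hy
    have h1 := hT.half_lt_one_sub
    have hi : 0 ≤ (1 - boundL T * supNorm (coefB T))⁻¹ := inv_nonneg.2 (by linarith)
    have hL := hT.boundL_nonneg
    have hK := hk.nonneg
    by_cases hy0 : y.2 = 0
    · rw [graphTransform, if_pos hy0, norm_zero]
      positivity
    · have hys := (mem_domStar_iff hy).2 hy0
      rw [graphTransform_of_mem_domStar ν hys, norm_smul]
      refine mul_le_mul (hT.abs_inv_one_sub_le hk hν.2.1 hys) ?_ (norm_nonneg _) hi
      have hA := (hk.jetA y hys).norm_le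
      have hC := (hk.jetC y hys).norm_le
      calc _ ≤ ‖ν (T y)‖ * ‖coefA T y‖ + ‖coefC T y‖ :=
            (norm_sub_le _ _).trans
              (add_le_add (ContinuousLinearMap.opNorm_comp_le _ _) le_rfl)
        _ ≤ boundL T * (K * |y.2| ^ s) + K * |y.2| ^ s := by
            gcongr
            exact hν.2.1 _ (hT.mapsTo hys)
        _ = _ := by ring
  · have hps := (mem_domStar_iff hp).2 h0
    exact (hcs p hps).mono_of_mem_nhdsWithin (domStar_mem_nhdsWithin hps)

end IsLorenzMap

end Transform

/-! ### Jets of the graph transform and of its slope -/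

section TransformJets

set_option maxSynthPendingDepth 3

universe u

variable {E : Type u} [NormedAddCommGroup E] [NormedSpace ℝ E] {k : ℕ} {T : E × ℝ → E × ℝ}

namespace IsLorenzMap

variable (hT : IsLorenzMap k T) {s K : ℝ} (h : HasSymbolBounds k T s K)
include hT

theorem contDiffOn_self : ContDiffOn ℝ k T (domStar E) :=
  hT.contDiffOn.of_le (by exact_mod_cast Nat.le_succ k)

theorem contDiffOn_comp {ν : E × ℝ → E →L[ℝ] ℝ} (hν : ContDiffOn ℝ k ν (dom E)) :
    ContDiffOn ℝ k (ν ∘ T) (domStar E) :=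
  hν.comp hT.contDiffOn_self hT.mapsTo

/-- Derivatives of `w ∘ T`: the top order has the sharp coefficient `‖DT‖ ^ j`, the others are
controlled by the lower derivatives of `w`. -/
theorem exists_comp_bound (h : HasSymbolBounds k T s K) {j : ℕ} (hj : j ≤ k) : ∃ c, 0 ≤ c ∧
    ∀ (w : E × ℝ → E →L[ℝ] ℝ) (σ : ℝ), 0 ≤ σ → ContDiffOn ℝ k w (dom E) →
      (∀ i < j, ∀ p ∈ dom E, ‖iteratedFDerivWithin ℝ i w (dom E) p‖ ≤ σ) →
      ∀ p ∈ domStar E,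
        (∀ i < j, ‖iteratedFDerivWithin ℝ i (w ∘ T) (domStar E) p‖ ≤
          c * σ * (max K 1 * |p.2|⁻¹) ^ i) ∧
        ‖iteratedFDerivWithin ℝ j (w ∘ T) (domStar E) p‖ ≤
          ‖iteratedFDerivWithin ℝ j w (dom E) (T p)‖ * derivBound T ^ j +
            c * σ * (max K 1 * |p.2|⁻¹) ^ j := by
  choose c hc hcb using exists_norm_iteratedFDerivWithin_comp_le.{u, u}
  have hM := hT.derivBound_nonneg
  set D : ℕ → ℝ := fun i => derivBound T ^ i + c i * i with hD
  have hD0 : ∀ i, 0 ≤ D i := fun i => by have := hc i; simp only [hD]; positivity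
  refine ⟨∑ i ∈ Finset.range (j + 1), D i, Finset.sum_nonneg fun i _ => hD0 i, ?_⟩
  have hDle : ∀ i ≤ j, D i ≤ ∑ i ∈ Finset.range (j + 1), D i := fun i hi =>
    Finset.single_le_sum (f := D) (fun j _ => hD0 j) (Finset.mem_range.2 (by omega))
  intro w σ hσ0 hw hσ p hp
  set Q := max K 1 * |p.2|⁻¹ with hQ
  have hr : 0 < |p.2| := abs_pos.2 (snd_ne_zero_of_mem_domStar hp)
  have hinv : 1 ≤ |p.2|⁻¹ := (one_le_inv₀ hr).2 (abs_snd_le_one_of_mem_domStar hp)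
  have hQ1 : 1 ≤ Q := one_le_mul_of_one_le_of_one_le (le_max_right _ _) hinv
  have hTb : ∀ i, 1 ≤ i → i ≤ k → ‖iteratedFDerivWithin ℝ i T (domStar E) p‖ ≤ Q ^ i := by
    intro i hi1 hi
    refine (h.jetT p hp i hi).trans ?_
    rw [hQ, mul_pow]
    gcongr
    exact (le_max_left K 1).trans (le_self_pow₀ (le_max_right _ _) (by omega))
  have hTp := hT.mapsTo hp
  have hmain : ∀ i ≤ j, ‖iteratedFDerivWithin ℝ i (w ∘ T) (domStar E) p‖ ≤
      ‖iteratedFDerivWithin ℝ i w (dom E) (T p)‖ * derivBound T ^ i + c i * (i * σ) * Q ^ i := by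
    intro i hi
    have hik : (i : WithTop ℕ∞) ≤ k := by exact_mod_cast hi.trans hj
    have h1 := hcb i w T (domStar E) (dom E) p Q (hw.of_le hik) (hT.contDiffOn_self.of_le hik)
      uniqueDiffOn_dom uniqueDiffOn_domStar hT.mapsTo hp (by positivity)
      (fun a ha1 ha => hTb a ha1 (ha.trans (hi.trans hj)))
    have h2 : ∑ a ∈ Finset.range i, ‖iteratedFDerivWithin ℝ a w (dom E) (T p)‖ ≤ i * σ := by
      refine (Finset.sum_le_sum fun a ha => hσ a ?_ _ hTp).trans_eq (by simp)
      exact (Finset.mem_range.1 ha).trans_le hi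
    have := hc i
    refine h1.trans ?_
    gcongr
    exact hT.norm_fderivWithin_le h hp
  refine ⟨fun i hi => (hmain i hi.le).trans ?_, (hmain j le_rfl).trans ?_⟩
  · have h1 := hσ i hi _ hTp
    have h2 : 1 ≤ Q ^ i := one_le_pow₀ hQ1
    have h3 : 0 ≤ derivBound T ^ i := by positivity
    calc _ ≤ σ * derivBound T ^ i * Q ^ i + c i * (i * σ) * Q ^ i := by
          refine add_le_add ((mul_le_mul_of_nonneg_right h1 h3).trans
            (le_mul_of_one_le_right (mul_nonneg hσ0 h3) h2)) le_rfl
      _ = D i * (σ * Q ^ i) := by simp only [hD]; ring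
      _ ≤ _ := by rw [mul_assoc]; exact mul_le_mul_of_nonneg_right (hDle i hi.le) (by positivity)
  · have h3 : 0 ≤ derivBound T ^ j := by positivity
    have h4 : c j * (j * σ) * Q ^ j ≤
        (∑ i ∈ Finset.range (j + 1), D i) * σ * Q ^ j := by
      calc _ = (c j * j) * (σ * Q ^ j) := by ring
        _ ≤ D j * (σ * Q ^ j) := mul_le_mul_of_nonneg_right (by simp only [hD]; linarith)
            (by positivity)
        _ ≤ _ := by rw [mul_assoc]; exact mul_le_mul_of_nonneg_right (hDle j le_rfl) (by positivity)
    linarith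

include h in
theorem contDiffOn_inv_one_sub {ν : E × ℝ → E →L[ℝ] ℝ} (hν : ∀ p ∈ dom E, ‖ν p‖ ≤ boundL T)
    (hνc : ContDiffOn ℝ k ν (dom E)) :
    ContDiffOn ℝ k (fun p => (1 - ν (T p) (coefB T p))⁻¹) (domStar E) :=
  (contDiffOn_const.sub ((hT.contDiffOn_comp hνc).clm_apply
    (contDiffOn_coefB hT.contDiffOn hT.dyG_ne_zero))).inv fun _ hp => hT.one_sub_ne_zero h hν hp

include h in
theorem contDiffOn_graphTransform {ν : E × ℝ → E →L[ℝ] ℝ} (hν : ∀ p ∈ dom E, ‖ν p‖ ≤ boundL T)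
    (hνc : ContDiffOn ℝ k ν (dom E)) : ContDiffOn ℝ k (graphTransform T ν) (domStar E) := by
  have h1 : ContDiffOn ℝ k (fun p => (1 - ν (T p) (coefB T p))⁻¹ •
      ((ν (T p)).comp (coefA T p) - coefC T p)) (domStar E) :=
    (hT.contDiffOn_inv_one_sub h hν hνc).smul (((hT.contDiffOn_comp hνc).clm_comp
      (contDiffOn_coefA hT.contDiffOn hT.dyG_ne_zero)).sub
        (contDiffOn_coefC hT.contDiffOn hT.dyG_ne_zero))
  exact h1.congr fun p hp => graphTransform_of_mem_domStar ν hp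

theorem contDiffOn_slopeNumerator {f : E × ℝ → E →L[ℝ] ℝ} (hf : ContDiffOn ℝ k f (domStar E)) :
    ContDiffOn ℝ k (fun p => (ContinuousLinearMap.compL ℝ E E ℝ).flip (coefA T p) +
      ContinuousLinearMap.smulRightL ℝ (E →L[ℝ] ℝ) (E →L[ℝ] ℝ)
        (ContinuousLinearMap.apply ℝ ℝ (coefB T p)) (f p)) (domStar E) := by
  have h1 : ContDiffOn ℝ k (fun p => (ContinuousLinearMap.compL ℝ E E ℝ).flip (coefA T p))
      (domStar E) := ((ContinuousLinearMap.compL ℝ E E ℝ).flip).contDiff.comp_contDiffOn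
        (contDiffOn_coefA hT.contDiffOn hT.dyG_ne_zero)
  have h2 : ContDiffOn ℝ k (fun p => ContinuousLinearMap.smulRightL ℝ (E →L[ℝ] ℝ) (E →L[ℝ] ℝ)
      (ContinuousLinearMap.apply ℝ ℝ (coefB T p))) (domStar E) :=
    ((ContinuousLinearMap.smulRightL ℝ (E →L[ℝ] ℝ) (E →L[ℝ] ℝ)).comp
      (ContinuousLinearMap.apply ℝ ℝ)).contDiff.comp_contDiffOn
        (contDiffOn_coefB hT.contDiffOn hT.dyG_ne_zero)
  exact h1.add (h2.clm_apply hf)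

include h in
theorem contDiffOn_slope {μ ν : E × ℝ → E →L[ℝ] ℝ} (hμ : ∀ p ∈ dom E, ‖μ p‖ ≤ boundL T)
    (hμc : ContDiffOn ℝ k μ (dom E)) (hν : ∀ p ∈ dom E, ‖ν p‖ ≤ boundL T)
    (hνc : ContDiffOn ℝ k ν (dom E)) : ContDiffOn ℝ k (slope T μ ν) (domStar E) :=
  (hT.contDiffOn_inv_one_sub h hμ hμc).smul
    (hT.contDiffOn_slopeNumerator (hT.contDiffOn_graphTransform h hν hνc))

end IsLorenzMap

/-- `ν` is bounded by `L` and `C ^ k`, its derivatives of order `i < j` are bounded by `R`, and that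
of order `j` by `H ^ j`. The last bound has the form of a power so that `H` can serve as a factor of
an inverse length scale. -/
structure Controlled (k : ℕ) (T : E × ℝ → E × ℝ) (j : ℕ) (R H : ℝ) (ν : E × ℝ → E →L[ℝ] ℝ) :
    Prop where
  le : ∀ p ∈ dom E, ‖ν p‖ ≤ boundL T
  contDiffOn : ContDiffOn ℝ k ν (dom E)
  lower : ∀ i < j, ∀ p ∈ dom E, ‖iteratedFDerivWithin ℝ i ν (dom E) p‖ ≤ R
  top : ∀ p ∈ dom E, ‖iteratedFDerivWithin ℝ j ν (dom E) p‖ ≤ H ^ j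

namespace IsLorenzMap

variable (hT : IsLorenzMap k T) {s K : ℝ}
include hT

/-- Jet bounds for `(1 - (ν ∘ T) B)⁻¹` and the graph transform. The inverse length scale at `p` is
`H / |y|`, up to a constant; with this scale the bound at order `j` is proportional to the bound
`H ^ j` for the derivative of order `j` of `ν`. -/
theorem exists_jetBound_graphTransform (h : HasSymbolBounds k T s K) {j : ℕ} (hj : j ≤ k) {R : ℝ}
    (hR : 0 ≤ R) : ∃ C, 0 ≤ C ∧ ∀ (H : ℝ) (ν : E × ℝ → E →L[ℝ] ℝ), 1 ≤ H →
      Controlled k T j R H ν → ∀ p ∈ domStar E,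
        JetBound j (domStar E) p C (H * (max K 1 * |p.2|⁻¹))
          (fun p => (1 - ν (T p) (coefB T p))⁻¹) ∧
        JetBound j (domStar E) p (C * |p.2| ^ s) (H * (max K 1 * |p.2|⁻¹)) (graphTransform T ν) := by
  obtain ⟨c, hc, hcb⟩ := hT.exists_comp_bound h hj
  have hM := hT.derivBound_nonneg
  have hK := h.nonneg
  set Cu := derivBound T ^ j + c * R with hCu
  have hCu0 : 0 ≤ Cu := by positivity
  set βe := ContinuousLinearMap.id ℝ (E →L[ℝ] ℝ)
  set Cz := ‖(1 : ℝ)‖ + ‖βe‖ * 2 ^ j * (Cu * K) with hCz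
  obtain ⟨Ci, hCi, hinv⟩ := exists_jetBound_inv j (c := 1 / 2) (K := Cz) (by norm_num)
  set βc := ContinuousLinearMap.compL ℝ E E ℝ
  set Cn := ‖βc‖ * 2 ^ j * (Cu * K) + K with hCn
  have hCn0 : 0 ≤ Cn := by positivity
  set βs := (ContinuousLinearMap.lsmul ℝ ℝ : ℝ →L[ℝ] (E →L[ℝ] ℝ) →L[ℝ] (E →L[ℝ] ℝ))
  set CΓ := ‖βs‖ * 2 ^ j * (Ci * Cn) with hCΓ
  have hCΓ0 : 0 ≤ CΓ := by positivity
  refine ⟨Ci + CΓ, by positivity, fun H ν hH hν p hp => ?_⟩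
  have hS : UniqueDiffOn ℝ (domStar E) := uniqueDiffOn_domStar
  have hr : 0 < |p.2| := abs_pos.2 (snd_ne_zero_of_mem_domStar hp)
  have hinv1 : 1 ≤ |p.2|⁻¹ := (one_le_inv₀ hr).2 (abs_snd_le_one_of_mem_domStar hp)
  set Q := max K 1 * |p.2|⁻¹ with hQ
  have hm1 : 1 ≤ max K 1 := le_max_right _ _
  have hQ1 : 1 ≤ Q := one_le_mul_of_one_le_of_one_le hm1 hinv1
  have hrQ : |p.2|⁻¹ ≤ Q := le_mul_of_one_le_left (by positivity) hm1
  have hQH : Q ≤ H * Q := le_mul_of_one_le_left (by positivity) hH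
  have hrH : |p.2|⁻¹ ≤ H * Q := hrQ.trans hQH
  have hHQ0 : 0 ≤ H * Q := by positivity
  have hjk : (j : WithTop ℕ∞) ≤ k := by exact_mod_cast hj
  have hAc : ContDiffOn ℝ j (coefA T) (domStar E) :=
    (contDiffOn_coefA hT.contDiffOn hT.dyG_ne_zero).of_le hjk
  have hBc : ContDiffOn ℝ j (coefB T) (domStar E) :=
    (contDiffOn_coefB hT.contDiffOn hT.dyG_ne_zero).of_le hjk
  have hCc : ContDiffOn ℝ j (coefC T) (domStar E) :=
    (contDiffOn_coefC hT.contDiffOn hT.dyG_ne_zero).of_le hjk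
  have huc : ContDiffOn ℝ j (ν ∘ T) (domStar E) := (hT.contDiffOn_comp hν.contDiffOn).of_le hjk
  have hgc := (hT.contDiffOn_inv_one_sub h hν.le hν.contDiffOn).of_le hjk
  have hAj := ((h.jetA p hp).of_le hj).mono le_rfl (by positivity) hrH
  have hBj := ((h.jetB p hp).of_le hj).mono le_rfl (by positivity) hrH
  have hCj := ((h.jetC p hp).of_le hj).mono le_rfl (by positivity) hrH
  have huj : JetBound j (domStar E) p Cu (H * Q) (ν ∘ T) := by
    obtain ⟨h1, h2⟩ := hcb ν R hR hν.contDiffOn hν.lower p hp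
    intro i hi
    rcases hi.lt_or_eq with hij | rfl
    · refine (h1 i hij).trans ?_
      have : 0 ≤ derivBound T ^ j := by positivity
      gcongr
      linarith
    · refine h2.trans ?_
      have h3 := hν.top _ (hT.mapsTo hp)
      have h4 : H ^ i ≤ (H * Q) ^ i :=
        pow_le_pow_left₀ (by linarith) (le_mul_of_one_le_right (by linarith) hQ1) i
      have h5 : Q ^ i ≤ (H * Q) ^ i := pow_le_pow_left₀ (by positivity) hQH i
      calc _ ≤ (H * Q) ^ i * derivBound T ^ i + c * R * (H * Q) ^ i := by
            gcongr
            exact h3.trans h4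
        _ = _ := by rw [hCu]; ring
  have hzj : JetBound j (domStar E) p Cz (H * Q) (fun p => 1 - ν (T p) (coefB T p)) :=
    JetBound.sub hS hp contDiffOn_const (huc.clm_apply hBc) (JetBound.const _ _ _ _ hHQ0)
      (JetBound.bilin βe hS hp hHQ0 huc hBc huj hBj)
  have hgj : JetBound j (domStar E) p Ci (H * Q) (fun p => (1 - ν (T p) (coefB T p))⁻¹) := by
    have := hinv (domStar E) p 1 (H * Q) _ hS hp one_pos hHQ0
      (contDiffOn_const.sub (huc.clm_apply hBc)) (fun x hx => hT.one_sub_ne_zero h hν.le hx)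
      (by rw [mul_one]; exact (hT.half_le_one_sub h hν.le hp).trans (le_abs_self _))
      (by rw [mul_one]; exact hzj)
    simpa using this
  have hnj : JetBound j (domStar E) p (Cn * |p.2| ^ s) (H * Q)
      (fun p => (ν (T p)).comp (coefA T p) - coefC T p) :=
    (JetBound.sub hS hp (huc.clm_comp hAc) hCc (JetBound.bilin βc hS hp hHQ0 huc hAc huj hAj)
      hCj).mono (le_of_eq (by rw [hCn]; ring)) hHQ0 le_rfl
  have hΓj : JetBound j (domStar E) p (CΓ * |p.2| ^ s) (H * Q) (graphTransform T ν) :=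
    ((JetBound.bilin βs hS hp hHQ0 hgc ((huc.clm_comp hAc).sub hCc) hgj hnj).congr hp
      fun x hx => graphTransform_of_mem_domStar ν hx).mono
        (le_of_eq (by rw [hCΓ]; ring)) hHQ0 le_rfl
  exact ⟨hgj.mono (by linarith) hHQ0 le_rfl, hΓj.mono
    (mul_le_mul_of_nonneg_right (by linarith) (by positivity)) hHQ0 le_rfl⟩

theorem exists_jetBound_slope (h : HasSymbolBounds k T s K) {j : ℕ} (hj : j ≤ k) {R : ℝ}
    (hR : 0 ≤ R) : ∃ C, 0 ≤ C ∧ ∀ (H : ℝ) (μ ν : E × ℝ → E →L[ℝ] ℝ), 1 ≤ H →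
      Controlled k T j R H μ → Controlled k T j R H ν → ∀ p ∈ domStar E,
        JetBound j (domStar E) p (C * |p.2| ^ s) (H * (max K 1 * |p.2|⁻¹)) (slope T μ ν) := by
  obtain ⟨CΓ, hCΓ, hΓ⟩ := hT.exists_jetBound_graphTransform h hj hR
  have hK := h.nonneg
  set L₁ := (ContinuousLinearMap.compL ℝ E E ℝ).flip
  set L₂ := ContinuousLinearMap.apply (E := E) ℝ ℝ
  set βr := (ContinuousLinearMap.smulRightL ℝ (E →L[ℝ] ℝ) (E →L[ℝ] ℝ)).comp L₂
  set βs := (ContinuousLinearMap.lsmul ℝ ℝ :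
    ℝ →L[ℝ] ((E →L[ℝ] ℝ) →L[ℝ] (E →L[ℝ] ℝ)) →L[ℝ] ((E →L[ℝ] ℝ) →L[ℝ] (E →L[ℝ] ℝ)))
  set Cn := ‖L₁‖ * K + ‖βr‖ * 2 ^ j * (K * CΓ) with hCn
  refine ⟨‖βs‖ * 2 ^ j * (CΓ * Cn), by positivity, fun H μ ν hH hμ hν p hp => ?_⟩
  have hS : UniqueDiffOn ℝ (domStar E) := uniqueDiffOn_domStar
  have hr : 0 < |p.2| := abs_pos.2 (snd_ne_zero_of_mem_domStar hp)
  have hinv1 : 1 ≤ |p.2|⁻¹ := (one_le_inv₀ hr).2 (abs_snd_le_one_of_mem_domStar hp)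
  have hm1 : 1 ≤ max K 1 := le_max_right _ _
  set Q := max K 1 * |p.2|⁻¹ with hQ
  have hrQ : |p.2|⁻¹ ≤ Q := le_mul_of_one_le_left (by positivity) hm1
  have hrH : |p.2|⁻¹ ≤ H * Q := hrQ.trans (le_mul_of_one_le_left (by positivity) hH)
  have hHQ0 : 0 ≤ H * Q := by positivity
  have hjk : (j : WithTop ℕ∞) ≤ k := by exact_mod_cast hj
  have hAc : ContDiffOn ℝ j (coefA T) (domStar E) :=
    (contDiffOn_coefA hT.contDiffOn hT.dyG_ne_zero).of_le hjk
  have hBc : ContDiffOn ℝ j (coefB T) (domStar E) :=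
    (contDiffOn_coefB hT.contDiffOn hT.dyG_ne_zero).of_le hjk
  have hAj := ((h.jetA p hp).of_le hj).mono le_rfl (by positivity) hrH
  have hBj := ((h.jetB p hp).of_le hj).mono le_rfl (by positivity) hrH
  have hΓc := (hT.contDiffOn_graphTransform h hν.le hν.contDiffOn)
  have hgc := (hT.contDiffOn_inv_one_sub h hμ.le hμ.contDiffOn).of_le hjk
  have hnj : JetBound j (domStar E) p (Cn * |p.2| ^ s) (H * Q)
      (fun p => L₁ (coefA T p) + βr (coefB T p) (graphTransform T ν p)) :=
    (JetBound.add hS hp (L₁.contDiff.comp_contDiffOn hAc)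
      ((βr.contDiff.comp_contDiffOn hBc).clm_apply (hΓc.of_le hjk)) (hAj.clm L₁ hS hp hAc)
      (JetBound.bilin βr hS hp hHQ0 hBc (hΓc.of_le hjk) hBj (hΓ H ν hH hν p hp).2)).mono
        (le_of_eq (by rw [hCn]; ring)) hHQ0 le_rfl
  exact (JetBound.bilin βs hS hp hHQ0 hgc ((hT.contDiffOn_slopeNumerator hΓc).of_le hjk)
    (hΓ H μ hH hμ p hp).1 hnj).mono (le_of_eq (by ring)) hHQ0 le_rfl

end IsLorenzMap

end TransformJets

/-! ### Contraction of derivatives -/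

section DerivativeContraction

set_option maxSynthPendingDepth 3

universe u

variable {E : Type u} [NormedAddCommGroup E] [NormedSpace ℝ E] {k : ℕ} {T : E × ℝ → E × ℝ}
  {s K : ℝ}

/-- The order `s` of vanishing of `slope` at `D₀` absorbs the loss of up to `k` derivatives. -/
theorem HasSymbolBounds.rpow_mul_pow_le (h : HasSymbolBounds k T s K) {j : ℕ} (hj : j ≤ k)
    {p : E × ℝ} (hp : p ∈ domStar E) :
    |p.2| ^ s * (max K 1 * |p.2|⁻¹) ^ j ≤ max K 1 ^ j := by
  have hp0 := snd_ne_zero_of_mem_domStar hp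
  have hjs : (j : ℝ) ≤ s := by
    have : (j : ℝ) ≤ k := by exact_mod_cast hj
    linarith [h.lt]
  have h1 : |p.2| ^ s * |p.2|⁻¹ ^ j ≤ 1 := by
    rw [← rpow_sub_natCast_eq hp0]
    exact Real.rpow_le_one (abs_nonneg _) (abs_snd_le_one_of_mem_domStar hp) (by linarith)
  have h2 : 0 ≤ max K 1 ^ j := by positivity
  calc _ = max K 1 ^ j * (|p.2| ^ s * |p.2|⁻¹ ^ j) := by rw [mul_pow]; ring
    _ ≤ _ := mul_le_of_le_one_right h2 h1

/-- The derivative of order `j` of a difference of graph transforms: the derivative of order `j` of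
the difference of the arguments enters with the factor `rate T * derivBound T ^ j`, those of lower
order with a factor that is affine in the bound `H ^ j` on the derivatives of order `j`. -/
theorem IsLorenzMap.exists_iteratedFDerivWithin_sub_bound (hT : IsLorenzMap k T)
    (h : HasSymbolBounds k T s K) {j : ℕ} (hj : j ≤ k) {R : ℝ} (hR : 0 ≤ R) :
    ∃ C, 0 ≤ C ∧ ∀ (H σ a : ℝ) (μ ν : E × ℝ → E →L[ℝ] ℝ), 1 ≤ H → 0 ≤ σ →
      Controlled k T j R H μ → Controlled k T j R H ν →
      (∀ i < j, ∀ p ∈ dom E, ‖iteratedFDerivWithin ℝ i μ (dom E) p -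
        iteratedFDerivWithin ℝ i ν (dom E) p‖ ≤ σ) →
      (∀ p ∈ dom E, ‖iteratedFDerivWithin ℝ j μ (dom E) p -
        iteratedFDerivWithin ℝ j ν (dom E) p‖ ≤ a) →
      ∀ p ∈ domStar E, ‖iteratedFDerivWithin ℝ j (graphTransform T μ) (domStar E) p -
        iteratedFDerivWithin ℝ j (graphTransform T ν) (domStar E) p‖ ≤
          rate T * derivBound T ^ j * a + C * σ * H ^ j := by
  obtain ⟨c, hc, hcb⟩ := hT.exists_comp_bound h hj
  obtain ⟨Cs, hCs, hsl⟩ := hT.exists_jetBound_slope h hj hR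
  set κ := max K 1 ^ j with hκ
  have hκ0 : 0 ≤ κ := by positivity
  set b := ∑ i ∈ Finset.range j, (j.choose (i + 1) : ℝ) with hb
  have hb0 : 0 ≤ b := Finset.sum_nonneg fun i _ => Nat.cast_nonneg _
  refine ⟨(b + 1) * (Cs * c * κ), by positivity, ?_⟩
  intro H σ a μ ν hH hσ0 hμ hν hσ ha p hp
  have hS : UniqueDiffOn ℝ (domStar E) := uniqueDiffOn_domStar
  have hjk : (j : WithTop ℕ∞) ≤ k := by exact_mod_cast hj
  have hM := hT.derivBound_nonneg
  set w : E × ℝ → E →L[ℝ] ℝ := fun x => μ x - ν x with hw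
  have hwc : ContDiffOn ℝ k w (dom E) := hμ.contDiffOn.sub hν.contDiffOn
  have hwi : ∀ i ≤ j, ∀ x ∈ dom E, iteratedFDerivWithin ℝ i w (dom E) x =
      iteratedFDerivWithin ℝ i μ (dom E) x - iteratedFDerivWithin ℝ i ν (dom E) x :=
    fun i hi x hx => by
      have hik : (i : WithTop ℕ∞) ≤ k := by exact_mod_cast hi.trans hj
      exact fun_iteratedFDerivWithin_sub_apply ((hμ.contDiffOn.of_le hik) x hx)
        ((hν.contDiffOn.of_le hik) x hx) uniqueDiffOn_dom hx
  obtain ⟨hlow, htop⟩ := hcb w σ hσ0 hwc (fun i hi x hx => by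
    rw [hwi i hi.le x hx]; exact hσ i hi x hx) p hp
  have hwj : ‖iteratedFDerivWithin ℝ j w (dom E) (T p)‖ ≤ a := by
    rw [hwi j le_rfl _ (hT.mapsTo hp)]; exact ha _ (hT.mapsTo hp)
  have hsj := hsl H μ ν hH hμ hν p hp
  have hr : 0 < |p.2| := abs_pos.2 (snd_ne_zero_of_mem_domStar hp)
  set Q := max K 1 * |p.2|⁻¹ with hQ
  have hQ0 : 0 ≤ Q := by positivity
  have hrQ : |p.2| ^ s * Q ^ j ≤ κ := h.rpow_mul_pow_le hj hp
  have hrs : 0 ≤ |p.2| ^ s := by positivity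
  have hHj : 1 ≤ H ^ j := one_le_pow₀ hH
  set e := ContinuousLinearMap.id ℝ ((E →L[ℝ] ℝ) →L[ℝ] (E →L[ℝ] ℝ))
  have hslc : ContDiffOn ℝ j (slope T μ ν) (domStar E) :=
    (hT.contDiffOn_slope h hμ.le hμ.contDiffOn hν.le hν.contDiffOn).of_le hjk
  have huc : ContDiffOn ℝ j (w ∘ T) (domStar E) := (hT.contDiffOn_comp hwc).of_le hjk
  have hΓμ := (hT.contDiffOn_graphTransform h hμ.le hμ.contDiffOn).of_le hjk
  have hΓν := (hT.contDiffOn_graphTransform h hν.le hν.contDiffOn).of_le hjk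
  have heq : EqOn (fun x => graphTransform T μ x - graphTransform T ν x)
      (fun x => e (slope T μ ν x) ((w ∘ T) x)) (domStar E) := fun x hx =>
    graphTransform_sub hx (hT.one_sub_ne_zero h hμ.le hx) (hT.one_sub_ne_zero h hν.le hx)
  rw [← fun_iteratedFDerivWithin_sub_apply (hΓμ p hp) (hΓν p hp) hS hp,
    iteratedFDerivWithin_congr heq hp]
  refine (e.norm_iteratedFDerivWithin_le_of_bilinear_of_le_one hslc huc hS hp le_rfl
    ContinuousLinearMap.norm_id_le).trans ?_
  rw [Finset.sum_range_succ']
  -- no derivative falls on `slope`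
  have hzero : ((j.choose 0 : ℕ) : ℝ) * ‖iteratedFDerivWithin ℝ 0 (slope T μ ν) (domStar E) p‖ *
      ‖iteratedFDerivWithin ℝ (j - 0) (w ∘ T) (domStar E) p‖ ≤
      rate T * derivBound T ^ j * a + Cs * c * κ * σ * H ^ j := by
    rw [Nat.choose_zero_right, Nat.cast_one, one_mul, norm_iteratedFDerivWithin_zero]
    have h1 := hT.norm_slope_le h hμ.le hν.le hp
    have h2 := hsj.norm_le
    have hMj : 0 ≤ derivBound T ^ j := by positivity
    have ha0 : 0 ≤ a := (norm_nonneg _).trans hwj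
    calc _ ≤ ‖slope T μ ν p‖ * (a * derivBound T ^ j + c * σ * Q ^ j) := by
          refine mul_le_mul_of_nonneg_left (htop.trans ?_) (norm_nonneg _)
          gcongr
      _ = ‖slope T μ ν p‖ * (a * derivBound T ^ j) + ‖slope T μ ν p‖ * (c * σ * Q ^ j) := by ring
      _ ≤ rate T * (a * derivBound T ^ j) + (Cs * |p.2| ^ s) * (c * σ * Q ^ j) := by gcongr
      _ = rate T * derivBound T ^ j * a + Cs * c * (|p.2| ^ s * Q ^ j) * σ * 1 := by ring
      _ ≤ _ := by gcongr
  -- at least one derivative falls on `slope`, so at most `j - 1` fall on `w ∘ T`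
  have hrest : ∑ i ∈ Finset.range j, ((j.choose (i + 1) : ℕ) : ℝ) *
      ‖iteratedFDerivWithin ℝ (i + 1) (slope T μ ν) (domStar E) p‖ *
      ‖iteratedFDerivWithin ℝ (j - (i + 1)) (w ∘ T) (domStar E) p‖ ≤
      ∑ i ∈ Finset.range j, ((j.choose (i + 1) : ℕ) : ℝ) * (Cs * c * κ * σ * H ^ j) := by
    refine Finset.sum_le_sum fun i hi => ?_
    have hij : i + 1 ≤ j := Finset.mem_range.1 hi
    rw [mul_assoc]
    refine mul_le_mul_of_nonneg_left ?_ (Nat.cast_nonneg _)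
    have h1 := hsj (i + 1) hij
    have h2 := hlow (j - (i + 1)) (by omega)
    have h3 : H ^ (i + 1) ≤ H ^ j := pow_le_pow_right₀ hH hij
    calc _ ≤ (Cs * |p.2| ^ s * (H * Q) ^ (i + 1)) * (c * σ * Q ^ (j - (i + 1))) := by gcongr
      _ = Cs * c * (|p.2| ^ s * (Q ^ (i + 1) * Q ^ (j - (i + 1)))) * σ * H ^ (i + 1) := by
          rw [mul_pow]; ring
      _ = Cs * c * (|p.2| ^ s * Q ^ j) * σ * H ^ (i + 1) := by
          rw [← pow_add, Nat.add_sub_cancel' hij]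
      _ ≤ _ := by gcongr
  rw [← Finset.sum_mul] at hrest
  calc _ ≤ _ := add_le_add hrest hzero
    _ = _ := by ring

end DerivativeContraction

/-! ### Iteration -/

section Iteration

set_option maxSynthPendingDepth 3

universe u

variable {E : Type u} [NormedAddCommGroup E] [NormedSpace ℝ E] {k : ℕ} {T : E × ℝ → E × ℝ}
  {s K : ℝ}

theorem zero_mem_dom (E : Type*) [NormedAddCommGroup E] : (0 : E × ℝ) ∈ dom E := by simp [dom]

/-- Members of `𝒜_L` of class `C ^ k` that are flat on `D₀`. -/
structure FlatClass (k : ℕ) (T : E × ℝ → E × ℝ) (ν : E × ℝ → E →L[ℝ] ℝ) : Prop where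
  mem : ν ∈ classA E (boundL T)
  contDiffOn : ContDiffOn ℝ k ν (dom E)
  flat : ∀ i ≤ k, ∀ p ∈ domZero E, iteratedFDerivWithin ℝ i ν (dom E) p = 0

namespace IsLorenzMap

variable (hT : IsLorenzMap k T) (h : HasSymbolBounds k T s K)
include hT

theorem flatClass_graphTransform [FiniteDimensional ℝ E] (h : HasSymbolBounds k T s K)
    (hk : 1 ≤ k) {ν : E × ℝ → E →L[ℝ] ℝ} (hν : FlatClass k T ν) :
    FlatClass k T (graphTransform T ν) := by
  have key : ∀ i : ℕ, ∃ M : ℝ, 0 ≤ M ∧ (i ≤ k → ∀ p ∈ dom E,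
      ‖iteratedFDerivWithin ℝ i ν (dom E) p‖ ≤ M) := by
    intro i
    by_cases hi : i ≤ k
    · obtain ⟨M, hM⟩ := isCompact_dom.exists_bound_of_continuousOn
        (hν.contDiffOn.continuousOn_iteratedFDerivWithin (m := i) (by exact_mod_cast hi)
          uniqueDiffOn_dom)
      exact ⟨max M 0, le_max_right _ _, fun _ z hz => (hM z hz).trans (le_max_left _ _)⟩
    · exact ⟨0, le_rfl, fun h => absurd h hi⟩
  choose M hM0 hM using key
  set R := 1 + ∑ i ∈ Finset.range (k + 1), M i with hRdef
  have hMR : ∀ i ≤ k, M i ≤ R := fun i hi => by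
    have h1 : M i ≤ ∑ i ∈ Finset.range (k + 1), M i :=
      Finset.single_le_sum (f := M) (fun j _ => hM0 j) (Finset.mem_range.2 (by omega))
    linarith
  have hR1 : 1 ≤ R := by
    have : 0 ≤ ∑ i ∈ Finset.range (k + 1), M i := Finset.sum_nonneg fun j _ => hM0 j
    linarith
  -- `R ≥ 1` bounds all derivatives of order at most `k`, so it also serves as the scale
  have hctl : Controlled k T k R R ν :=
    ⟨hν.mem.2.1, hν.contDiffOn, fun i hi p hp => (hM i hi.le p hp).trans (hMR i hi.le),
      fun p hp => ((hM k le_rfl p hp).trans (hMR k le_rfl)).trans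
        (le_self_pow₀ hR1 (by omega))⟩
  obtain ⟨C, hC, hj⟩ := hT.exists_jetBound_graphTransform h le_rfl (zero_le_one.trans hR1)
  have hRm : 1 ≤ R * max K 1 := one_le_mul_of_one_le_of_one_le hR1 (le_max_right _ _)
  have hext := contDiffOn_dom_of_flat (f := graphTransform T ν) (C := C * (R * max K 1) ^ k) h.lt
    (hT.contDiffOn_graphTransform h hν.mem.2.1 hν.contDiffOn) (fun p hp => if_pos hp.2)
    fun p hp i hi => by
      have hp0 := snd_ne_zero_of_mem_domStar hp
      have hr : 0 < |p.2| := abs_pos.2 hp0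
      rw [rpow_sub_natCast_eq hp0]
      calc _ ≤ C * |p.2| ^ s * (R * (max K 1 * |p.2|⁻¹)) ^ i := (hj R ν hR1 hctl p hp).2 i hi
        _ = C * (R * max K 1) ^ i * (|p.2| ^ s * |p.2|⁻¹ ^ i) := by
          rw [← mul_assoc R, mul_pow (R * max K 1)]; ring
        _ ≤ _ := by gcongr
  exact ⟨hT.mapsTo_graphTransform h hν.mem, hext.1, hext.2⟩

include h in
/-- Two orbits of the graph transform in `𝒜_L` approach each other geometrically. -/
theorem norm_orbit_sub_le {f g : ℕ → E × ℝ → E →L[ℝ] ℝ} (hf : ∀ m, f m ∈ classA E (boundL T))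
    (hg : ∀ m, g m ∈ classA E (boundL T))
    (hfs : ∀ m, EqOn (f (m + 1)) (graphTransform T (f m)) (dom E))
    (hgs : ∀ m, EqOn (g (m + 1)) (graphTransform T (g m)) (dom E)) (m : ℕ) :
    ∀ p ∈ dom E, ‖f m p - g m p‖ ≤ rate T ^ m * (2 * boundL T) := by
  induction m with
  | zero =>
    intro p hp
    rw [pow_zero, one_mul, two_mul]
    exact (norm_sub_le _ _).trans (add_le_add ((hf 0).2.1 p hp) ((hg 0).2.1 p hp))
  | succ m ih =>
    intro p hp
    rw [hfs m hp, hgs m hp, pow_succ', mul_assoc]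
    exact hT.norm_graphTransform_sub_le h (hf m).2.1 (hg m).2.1 ih hp

include h in
theorem iterate_mem_classA {ν : E × ℝ → E →L[ℝ] ℝ} (hν : ν ∈ classA E (boundL T)) (m : ℕ) :
    (graphTransform T)^[m] ν ∈ classA E (boundL T) :=
  (hT.mapsTo_graphTransform h).iterate m hν

include h in
theorem norm_iterate_succ_sub_le {ν : E × ℝ → E →L[ℝ] ℝ} (hν : ν ∈ classA E (boundL T)) (m : ℕ) :
    ∀ p ∈ dom E, ‖(graphTransform T)^[m + 1] ν p - (graphTransform T)^[m] ν p‖ ≤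
      rate T ^ m * (2 * boundL T) :=
  hT.norm_orbit_sub_le h (f := fun m => (graphTransform T)^[m + 1] ν)
    (g := fun m => (graphTransform T)^[m] ν) (fun m => hT.iterate_mem_classA h hν (m + 1))
    (hT.iterate_mem_classA h hν)
    (fun m p _ => by rw [Function.iterate_succ_apply'])
    (fun m p _ => by rw [Function.iterate_succ_apply']) m

theorem summable_rate_pow : Summable fun m : ℕ => rate T ^ m * (2 * boundL T) :=
  (summable_geometric_of_lt_one hT.rate_nonneg hT.rate_lt_one).mul_right _

theorem exists_fixedPoint (h : HasSymbolBounds k T s K) :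
    ∃ νs ∈ classA E (boundL T), EqOn (graphTransform T νs) νs (dom E) := by
  have h0 : (fun _ => 0 : E × ℝ → E →L[ℝ] ℝ) ∈ classA E (boundL T) :=
    ⟨continuousOn_const, fun p _ => by simpa using hT.boundL_nonneg, fun p _ => rfl⟩
  set f : ℕ → E × ℝ → E →L[ℝ] ℝ := fun m => (graphTransform T)^[m] (fun _ => 0) with hf
  have hmem : ∀ m, f m ∈ classA E (boundL T) := hT.iterate_mem_classA h h0
  obtain ⟨νs, hlim⟩ := exists_tendstoUniformlyOn_of_summable (f := f) (S := dom E)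
    hT.summable_rate_pow (hT.norm_iterate_succ_sub_le h h0)
  have hpt : ∀ p ∈ dom E, Tendsto (fun m => f m p) atTop (𝓝 (νs p)) := fun p hp =>
    hlim.tendsto_at hp
  have hs : νs ∈ classA E (boundL T) :=
    ⟨hlim.continuousOn (Frequently.of_forall fun m => (hmem m).1),
      fun p hp => le_of_tendsto (hpt p hp).norm (Eventually.of_forall fun m => (hmem m).2.1 p hp),
      fun p hp => tendsto_nhds_unique (hpt p hp.1) (by
        exact tendsto_const_nhds.congr fun m => ((hmem m).2.2 p hp).symm)⟩
  refine ⟨νs, hs, fun p hp => ?_⟩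
  refine tendsto_nhds_unique (f := fun m => f (m + 1) p) ?_
    ((hpt p hp).comp (tendsto_add_atTop_nat 1))
  rw [Metric.tendsto_nhds]
  intro ε hε
  rw [Metric.tendstoUniformlyOn_iff] at hlim
  filter_upwards [hlim ε hε] with m hm
  have h1 : f (m + 1) = graphTransform T (f m) := Function.iterate_succ_apply' _ _ _
  rw [h1, dist_eq_norm]
  refine (hT.norm_graphTransform_sub_le h (hmem m).2.1 hs.2.1 (d := ε) (fun q hq => ?_) hp).trans_lt ?_
  · have := hm q hq
    rw [dist_comm, dist_eq_norm] at this
    exact this.le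
  · exact mul_lt_of_lt_one_left hε hT.rate_lt_one

/-- All derivatives of order `j ≤ k` along the orbit are bounded, and their successive differences
are summable, uniformly on `D`. -/
theorem exists_summable_derivative_differences [FiniteDimensional ℝ E]
    (h : HasSymbolBounds k T s K) (hk : 1 ≤ k) {ν : E × ℝ → E →L[ℝ] ℝ} (hν : FlatClass k T ν)
    (j : ℕ) : ∃ (a : ℕ → ℝ) (R : ℝ), j ≤ k → Summable a ∧ ∀ m, ∀ p ∈ dom E,
      ‖iteratedFDerivWithin ℝ j ((graphTransform T)^[m + 1] ν) (dom E) p -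
        iteratedFDerivWithin ℝ j ((graphTransform T)^[m] ν) (dom E) p‖ ≤ a m ∧
      ‖iteratedFDerivWithin ℝ j ((graphTransform T)^[m] ν) (dom E) p‖ ≤ R := by
  set f : ℕ → E × ℝ → E →L[ℝ] ℝ := fun m => (graphTransform T)^[m] ν with hf
  have hsucc : ∀ m, f (m + 1) = graphTransform T (f m) := fun m =>
    Function.iterate_succ_apply' _ _ _
  have hflat : ∀ m, FlatClass k T (f m) := by
    intro m
    induction m with
    | zero => exact hν
    | succ m ih => rw [hsucc]; exact hT.flatClass_graphTransform h hk ih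
  induction j using Nat.strong_induction_on with
  | _ j ih =>
  rcases Nat.eq_zero_or_pos j with rfl | hj0
  · refine ⟨fun m => rate T ^ m * (2 * boundL T), boundL T,
      fun _ => ⟨hT.summable_rate_pow, fun m p hp => ⟨?_, ?_⟩⟩⟩
    · rw [← dist_eq_norm, dist_iteratedFDerivWithin_zero, dist_eq_norm]
      exact hT.norm_iterate_succ_sub_le h hν.mem m p hp
    · rw [norm_iteratedFDerivWithin_zero]
      exact (hflat m).mem.2.1 p hp
  by_cases hjk : j ≤ k
  swap
  · exact ⟨0, 0, fun h => absurd h hjk⟩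
  choose! a R haR using ih
  have hz := zero_mem_dom E
  have ha0 : ∀ i < j, ∀ m, 0 ≤ a i m := fun i hi m =>
    (norm_nonneg _).trans ((haR i hi (hi.le.trans hjk)).2 m 0 hz).1
  have hR0 : ∀ i < j, 0 ≤ R i := fun i hi =>
    (norm_nonneg _).trans ((haR i hi (hi.le.trans hjk)).2 0 0 hz).2
  set σ : ℕ → ℝ := fun m => ∑ i ∈ Finset.range j, a i m with hσ
  set Rs := ∑ i ∈ Finset.range j, R i with hRs
  have hσ0 : ∀ m, 0 ≤ σ m := fun m =>
    Finset.sum_nonneg fun i hi => ha0 i (Finset.mem_range.1 hi) m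
  have hRs0 : 0 ≤ Rs := Finset.sum_nonneg fun i hi => hR0 i (Finset.mem_range.1 hi)
  have hσs : Summable σ :=
    summable_sum fun i hi => (haR i (Finset.mem_range.1 hi) ((Finset.mem_range.1 hi).le.trans hjk)).1
  have haσ : ∀ i < j, ∀ m, a i m ≤ σ m := fun i hi m =>
    Finset.single_le_sum (f := fun i => a i m)
      (fun i hi => ha0 i (Finset.mem_range.1 hi) m) (Finset.mem_range.2 hi)
  have hRRs : ∀ i < j, R i ≤ Rs := fun i hi =>
    Finset.single_le_sum (f := R) (fun i hi => hR0 i (Finset.mem_range.1 hi))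
      (Finset.mem_range.2 hi)
  have hcont : ∀ m, ContinuousOn (iteratedFDerivWithin ℝ j (f m) (dom E)) (dom E) := fun m =>
    (hflat m).contDiffOn.continuousOn_iteratedFDerivWithin (by exact_mod_cast hjk)
      uniqueDiffOn_dom
  have hmax : ∀ g : E × ℝ → ContinuousMultilinearMap ℝ (fun _ : Fin j => E × ℝ) (E →L[ℝ] ℝ),
      ContinuousOn g (dom E) → ∃ p ∈ dom E, ∀ q ∈ dom E, ‖g q‖ ≤ ‖g p‖ := fun g hg => by
    obtain ⟨p, hp, hpm⟩ := isCompact_dom.exists_isMaxOn ⟨0, zero_mem_dom E⟩ hg.norm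
    exact ⟨p, hp, fun q hq => hpm hq⟩
  -- maxima instead of suprema: the recursion is then an inequality between values at points
  choose pb hpb hb using fun m => hmax _ (hcont m)
  choose pa hpa hα using fun m => hmax _ ((hcont (m + 1)).sub (hcont m))
  set b : ℕ → ℝ := fun m => ‖iteratedFDerivWithin ℝ j (f m) (dom E) (pb m)‖ with hbdef
  set α : ℕ → ℝ := fun m => ‖iteratedFDerivWithin ℝ j (f (m + 1)) (dom E) (pa m) -
    iteratedFDerivWithin ℝ j (f m) (dom E) (pa m)‖ with hαdef
  obtain ⟨C, hC, hest⟩ := hT.exists_iteratedFDerivWithin_sub_bound h hjk hRs0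
  have hq0 : 0 ≤ rate T * derivBound T ^ j :=
    mul_nonneg hT.rate_nonneg (pow_nonneg hT.derivBound_nonneg j)
  have hb0 : ∀ m, 0 ≤ b m := fun m => norm_nonneg _
  have hα0 : ∀ m, 0 ≤ α m := fun m => norm_nonneg _
  have hbs : ∀ m, b (m + 1) ≤ b m + α m := fun m => by
    have h1 := hb m _ (hpb (m + 1))
    have h2 := hα m _ (hpb (m + 1))
    have h3 := norm_add_le (iteratedFDerivWithin ℝ j (f m) (dom E) (pb (m + 1)))
      (iteratedFDerivWithin ℝ j (f (m + 1)) (dom E) (pb (m + 1)) -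
        iteratedFDerivWithin ℝ j (f m) (dom E) (pb (m + 1)))
    rw [add_sub_cancel] at h3
    exact h3.trans (add_le_add h1 h2)
  have hαs : ∀ m, α (m + 1) ≤ rate T * derivBound T ^ j * α m +
      C * σ m * (1 + b m + b (m + 1)) := fun m => by
    -- the scale `H` for which the derivatives of order `j` of both functions are at most `H ^ j`
    obtain ⟨H, hH1, hHj⟩ : ∃ H : ℝ, 1 ≤ H ∧ H ^ j = 1 + b m + b (m + 1) := by
      have h1 : 1 ≤ 1 + b m + b (m + 1) := by linarith [hb0 m, hb0 (m + 1)]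
      exact ⟨(1 + b m + b (m + 1)) ^ ((j : ℝ)⁻¹), Real.one_le_rpow h1 (by positivity),
        Real.rpow_inv_natCast_pow (by linarith) hj0.ne'⟩
    have hctl : ∀ n, b n ≤ H ^ j → Controlled k T j Rs H (f n) := fun n hn =>
      ⟨(hflat n).mem.2.1, (hflat n).contDiffOn,
        fun i hi p hp => ((haR i hi (hi.le.trans hjk)).2 n p hp).2.trans (hRRs i hi),
        fun p hp => (hb n p hp).trans hn⟩
    have hstep := hest H (σ m) (α m) (f (m + 1)) (f m) hH1 (hσ0 m)
      (hctl _ (by linarith [hb0 m])) (hctl _ (by linarith [hb0 (m + 1)]))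
      (fun i hi p hp => ((haR i hi (hi.le.trans hjk)).2 m p hp).1.trans (haσ i hi m)) (hα m)
    rw [hHj] at hstep
    by_cases h0 : (pa (m + 1)).2 = 0
    · have hz' : pa (m + 1) ∈ domZero E := ⟨hpa (m + 1), h0⟩
      have : α (m + 1) = 0 := by
        simp only [hαdef]
        rw [(hflat (m + 1 + 1)).flat j hjk _ hz', (hflat (m + 1)).flat j hjk _ hz', sub_zero,
          norm_zero]
      rw [this]
      have := hb0 m; have := hb0 (m + 1); have := hα0 m; have := hσ0 m
      positivity
    · have hps := (mem_domStar_iff (hpa (m + 1))).2 h0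
      have := hstep _ hps
      rw [← iteratedFDerivWithin_dom_eq hps, ← iteratedFDerivWithin_dom_eq hps, ← hsucc,
        ← hsucc] at this
      exact this
  obtain ⟨hsum, B, hB⟩ := summable_and_bounded_of_perturbed_contraction hα0 hb0
    (fun m => mul_nonneg hC (hσ0 m)) (hσs.mul_left C) hq0
    (hT.rate_mul_derivBound_pow_lt_one hj0 hjk) hbs hαs
  exact ⟨α, B, fun _ => ⟨hsum, fun m p hp => ⟨hα m p hp, (hb m p hp).trans (hB m)⟩⟩⟩

end IsLorenzMap

end Iteration

end Lorenz

theorem proposition3p4 {E : Type*} [NormedAddCommGroup E] [NormedSpace ℝ E]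
    [FiniteDimensional ℝ E] (k : ℕ) (hk : 1 ≤ k) (T : E × ℝ → E × ℝ)
    (hT : Lorenz.IsLorenzMap k T) :
    -- `Γ` maps `𝒜_L` into itself
    MapsTo (Lorenz.graphTransform T) (Lorenz.classA E (Lorenz.boundL T))
      (Lorenz.classA E (Lorenz.boundL T)) ∧
    -- `ν*` is the unique fixed point of `Γ` in `𝒜_L`
    ∃ νs ∈ Lorenz.classA E (Lorenz.boundL T),
      EqOn (Lorenz.graphTransform T νs) νs (Lorenz.dom E) ∧
      (∀ μ ∈ Lorenz.classA E (Lorenz.boundL T),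
        EqOn (Lorenz.graphTransform T μ) μ (Lorenz.dom E) → EqOn μ νs (Lorenz.dom E)) ∧
      ∀ ν ∈ Lorenz.classA E (Lorenz.boundL T),
        ContDiffOn ℝ k ν (Lorenz.dom E) →
        (∀ i ≤ k, ∀ p ∈ Lorenz.domZero E, iteratedFDerivWithin ℝ i ν (Lorenz.dom E) p = 0) →
        (∀ n : ℕ, ContDiffOn ℝ k ((Lorenz.graphTransform T)^[n] ν) (Lorenz.dom E)) ∧
        TendstoUniformlyOn (fun n : ℕ => (Lorenz.graphTransform T)^[n] ν) νs atTop
          (Lorenz.dom E) ∧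
        ∃ A : (j : ℕ) → E × ℝ → ContinuousMultilinearMap ℝ (fun _ : Fin j => E × ℝ) (E →L[ℝ] ℝ),
          ∀ j : ℕ, 1 ≤ j → j ≤ k →
            ContinuousOn (A j) (Lorenz.dom E) ∧
            TendstoUniformlyOn
              (fun n : ℕ =>
                iteratedFDerivWithin ℝ j ((Lorenz.graphTransform T)^[n] ν) (Lorenz.dom E))
              (A j) atTop (Lorenz.dom E) := by
  obtain ⟨s, K, h⟩ := hT.exists_hasSymbolBounds hk
  obtain ⟨νs, hνs, hfix⟩ := hT.exists_fixedPoint h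
  refine ⟨hT.mapsTo_graphTransform h, νs, hνs, hfix, fun μ hμ hμfix p hp => ?_,
    fun ν hν hcd hflat => ?_⟩
  · -- both fixed points are constant orbits, and orbits approach each other
    have hle : ∀ m, ‖μ p - νs p‖ ≤ Lorenz.rate T ^ m * (2 * Lorenz.boundL T) := fun m =>
      hT.norm_orbit_sub_le h (f := fun _ => μ) (g := fun _ => νs) (fun _ => hμ) (fun _ => hνs)
        (fun _ => hμfix.symm) (fun _ => hfix.symm) m p hp
    exact sub_eq_zero.1 (norm_le_zero_iff.1
      (ge_of_tendsto' hT.summable_rate_pow.tendsto_atTop_zero hle))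
  have hmem : ∀ m, Lorenz.FlatClass k T ((Lorenz.graphTransform T)^[m] ν) := by
    intro m
    induction m with
    | zero => exact ⟨hν, hcd, hflat⟩
    | succ m ih => rw [Function.iterate_succ_apply']; exact hT.flatClass_graphTransform h hk ih
  refine ⟨fun m => (hmem m).contDiffOn, ?_, ?_⟩
  · rw [Metric.tendstoUniformlyOn_iff]
    intro ε hε
    filter_upwards [hT.summable_rate_pow.tendsto_atTop_zero.eventually (gt_mem_nhds hε)]
      with m hm p hp
    rw [dist_comm, dist_eq_norm]
    exact (hT.norm_orbit_sub_le h (f := fun m => (Lorenz.graphTransform T)^[m] ν)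
      (g := fun _ => νs) (fun m => (hmem m).mem) (fun _ => hνs)
      (fun m p _ => by rw [Function.iterate_succ_apply']) (fun _ => hfix.symm) m p hp).trans_lt hm
  · choose a R haR using
      hT.exists_summable_derivative_differences h hk (ν := ν) ⟨hν, hcd, hflat⟩
    have hlim : ∀ j, ∃ A : E × ℝ → ContinuousMultilinearMap ℝ (fun _ : Fin j => E × ℝ) (E →L[ℝ] ℝ),
        j ≤ k → TendstoUniformlyOn (fun m : ℕ =>
          iteratedFDerivWithin ℝ j ((Lorenz.graphTransform T)^[m] ν) (Lorenz.dom E)) A atTop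
          (Lorenz.dom E) := fun j => by
      by_cases hj : j ≤ k
      · obtain ⟨A, hA⟩ := Lorenz.exists_tendstoUniformlyOn_of_summable
          (f := fun m : ℕ =>
            iteratedFDerivWithin ℝ j ((Lorenz.graphTransform T)^[m] ν) (Lorenz.dom E))
          (haR j hj).1 fun m p hp => ((haR j hj).2 m p hp).1
        exact ⟨A, fun _ => hA⟩
      · exact ⟨0, fun h => absurd h hj⟩
    choose A hA using hlim
    refine ⟨A, fun j _ hj => ⟨(hA j hj).continuousOn (Frequently.of_forall fun m => ?_), hA j hj⟩⟩
    exact (hmem m).contDiffOn.continuousOn_iteratedFDerivWithin (by exact_mod_cast hj)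
      Lorenz.uniqueDiffOn_dom
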